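/- Let $\Sigma$ be a closed connected Riemann surface with an anti-holomorphic involution $\tau$ whose fixed set $C$ is non-empty, such that $\Sigma'=(\Sigma\setminus C)/\tau$ is orientable. Let $\mathbf w\subset C$ be a finite set that meets every component of $C$, and put $\hat C=C\setminus\mathbf w$. (This is the situation of a multi-pointed real Heegaard diagram with orientable quotient, as it can be chosen for a real 3-manifold $(Y,\tau)$ such that the image of $Y^\tau$ in $Y/\tau$ is null-homologous, with a basepoint on each component of $Y^\tau$.) Let $m\ge 0$ be an integer, $M=\mathrm{Sym}^m(\Sigma)$, and let $R$ be the involution of $M$ induced by $\tau$. (For a Heegaard diagram, $m=g(\Sigma)+|\mathbf w|-1$, which is $2h+2(l-1)$ if each component of $C$ contains exactly one basepoint; here $h$ is the genus of $\Sigma'$ and $l$ the number of components of $C$.) Let $\hat M^R$ be the set of the points of $M$ fixed by $R$ that, as unordered $m$-tuples, contain no point of $\mathbf w$; it is a smooth $m$-manifold, locally modelled on the real part $\mathbb R^m$ of $\mathrm{Sym}^m(\mathbb C)\cong\mathbb C^m$. Then $\hat M^R$ is orientable. More precisely, choose any orientation of $\Sigma'$, orient $\hat C$ as its boundary (outward normal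 first), and choose any order of the components of $\hat C$, each of which is an open interval. (If each component of $C$ contains exactly one basepoint, this is an order of the components of $C$.) For $0\le k\le m/2$, the $k$-th stratum $\mathrm{Sym}^k(\Sigma')\times\mathrm{Sym}^{m-2k}(\hat C)$ of $\hat M^R$ consists of the points $\{z_1,\tau(z_1),\dots,z_k,\tau(z_k),c_1,\dots,c_{m-2k}\}$ with $z_i\in\Sigma\setminus C$ and $c_j\in\hat C$. At the points of its interior, where the $c_j$ are distinct, give it the product of the orientation of $\mathrm{Sym}^k(\Sigma')$ induced by that of $\Sigma'$ and of the product orientation of $I_1\times\dots\times I_{m-2k}$, multiplied by the sign $$(-1)^{h+l-k-1}.$$ Here $I_j\subset\hat C$ is an oriented interval around $c_j$, and $c_1,\dots,c_{m-2k}$ are numbered first by the order of the components of $\hat C$ and then, along each component, in the direction of the orientation. Then there is an orientation of $\hat M^R$ that restricts to these orientations on the interiors of all the strata. -/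

import Mathlib

open scoped Manifold ContDiff Topology ComplexConjugate

noncomputable section

namespace RealHF

/-! ### Smooth atlases and orientations -/

section Atlas

variable {X E : Type*} [TopologicalSpace X] [NormedAddCommGroup E] [NormedSpace ℝ E]

/-- A set of charts with values in the real vector space `E` is a smooth atlas on `X`: the charts
cover `X` and all transition maps are smooth. -/
def IsSmoothAtlas (A : Set (OpenPartialHomeomorph X E)) : Prop :=
  (∀ x : X, ∃ e ∈ A, x ∈ e.source) ∧
    ∀ e ∈ A, ∀ e' ∈ A, ContDiffOn ℝ ∞ (e' ∘ e.symm) (e.symm.trans e').source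

/-- An orientation of `X` with respect to the atlas `A`. The sign `o e x` tells whether the chart `e`
preserves the orientation at the point `x` of its domain. The signs are locally constant, and the
signs of two charts at a point differ by the sign of the Jacobian determinant of the transition
map. -/
def IsOrientation (A : Set (OpenPartialHomeomorph X E))
    (o : OpenPartialHomeomorph X E → X → ℤˣ) : Prop :=
  (∀ e ∈ A, ∀ x ∈ e.source, ∀ᶠ y in 𝓝 x, o e y = o e x) ∧
    ∀ e ∈ A, ∀ e' ∈ A, ∀ x ∈ e.source ∩ e'.source,
      0 < (((o e x * o e' x : ℤˣ) : ℤ) : ℝ) * (fderiv ℝ (e' ∘ e.symm) (e x)).det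

/-- The atlas `A` is orientable. -/
def IsOrientable (A : Set (OpenPartialHomeomorph X E)) : Prop :=
  ∃ o, IsOrientation A o

end Atlas

/-- The genus of a surface: the largest number of pairwise disjoint simple closed curves whose union
does not disconnect it. -/
def genus (X : Type*) [TopologicalSpace X] : ℕ :=
  sSup {n : ℕ | ∃ γ : Fin n → Circle → X, (∀ i, Continuous (γ i) ∧ Function.Injective (γ i)) ∧
    (∀ i j, i ≠ j → Disjoint (Set.range (γ i)) (Set.range (γ j))) ∧
    IsConnected (⋃ i, Set.range (γ i))ᶜ}

/-- The topology on the symmetric product `Sym^n(S) = S^n / S_n`: the quotient topology. -/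
instance symTopology (S : Type*) [TopologicalSpace S] (n : ℕ) : TopologicalSpace (Sym S n) :=
  TopologicalSpace.coinduced
    (fun y : Fin n → S => (⟨Finset.univ.val.map y, by simp⟩ : Sym S n)) inferInstance

section Surface

variable {S : Type*} [TopologicalSpace S]

/-! ### Fixed curve, quotient surface -/

/-- The fixed set `C` of the involution. -/
def fixedCurve (τ : S → S) : Set S := {p | τ p = p}

/-- `Ĉ = C ∖ w`. -/
def puncturedCurve (τ : S → S) (w : Finset S) : Set S := {p | τ p = p ∧ p ∉ w}

/-- Two points of `S ∖ C` are identified iff they have the same orbit `{p, τ p}`. -/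
def orbitSetoid (τ : S → S) : Setoid {p : S // τ p ≠ p} :=
  Setoid.ker (fun p => s(p.1, τ p.1))

/-- The quotient surface `Σ' = (Σ ∖ C) / τ`, with the quotient topology. -/
def QuotientSurface (τ : S → S) : Type _ := Quotient (orbitSetoid τ)

instance (τ : S → S) : TopologicalSpace (QuotientSurface τ) :=
  inferInstanceAs (TopologicalSpace (Quotient (orbitSetoid τ)))

/-- The projection `Σ ∖ C → Σ'`. -/
def proj (τ : S → S) (p : {p : S // τ p ≠ p}) : QuotientSurface τ := Quotient.mk (orbitSetoid τ) p

/-- The fixed part `M̂^R` of the symmetric product, with the divisor of the points of `w` removed: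
the `τ`-invariant unordered `m`-tuples of points of `S` none of which is in `w`. -/
def FixedLocus (τ : S → S) (w : Finset S) (m : ℕ) : Type _ :=
  {x : Sym S m // x.map τ = x ∧ ∀ p ∈ w, p ∉ x}

instance (τ : S → S) (w : Finset S) (m : ℕ) : TopologicalSpace (FixedLocus τ w m) :=
  inferInstanceAs (TopologicalSpace {x : Sym S m // x.map τ = x ∧ ∀ p ∈ w, p ∉ x})

/-- The multiset of points of an element of `M̂^R`. -/
def FixedLocus.points {τ : S → S} {w : Finset S} {m : ℕ} (x : FixedLocus τ w m) : Multiset S :=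
  x.1.1

/-- The interior of the `k`-th stratum `Sym^k(Σ') × Sym^{m-2k}(Ĉ)` of `M̂^R`: the points
`{z₁, τ z₁, …, z_k, τ z_k, c₁, …, c_{m-2k}}` with `z_i ∉ C`, `c_j ∈ Ĉ` and the `c_j` distinct.
(The `z_i` may coincide.) -/
def stratumInterior (τ : S → S) (w : Finset S) (m k : ℕ) : Set (FixedLocus τ w m) :=
  {x | ∃ (z : Fin k → S) (c : Fin (m - 2 * k) → S),
    (∀ i, τ (z i) ≠ z i) ∧ (∀ j, c j ∈ puncturedCurve τ w) ∧ Function.Injective c ∧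
    x.points = Finset.univ.val.map z + Finset.univ.val.map (fun i => τ (z i)) +
      Finset.univ.val.map c}

/-! ### Charts. From here on `S` is a Riemann surface. -/

variable [ChartedSpace ℂ S]

/-- `φ` is a holomorphic chart of `S` (its domain need not be connected). -/
def IsHolChart (φ : OpenPartialHomeomorph S ℂ) : Prop := φ ∈ IsManifold.maximalAtlas 𝓘(ℂ) ω S

/-- `τ` is an anti-holomorphic involution. -/
def IsAntiholInvolution (τ : S → S) : Prop :=
  Function.Involutive τ ∧ Continuous τ ∧ ∀ p : S,
    AnalyticAt ℂ (fun u : ℂ => conj (chartAt ℂ (τ p) (τ ((chartAt ℂ p).symm u)))) (chartAt ℂ p p)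

/-- `e` is the chart of `Σ'` induced by the holomorphic chart `φ` of `Σ ∖ C`. -/
def IsInducedChart (τ : S → S) (φ : OpenPartialHomeomorph S ℂ)
    (e : OpenPartialHomeomorph (QuotientSurface τ) ℂ) : Prop :=
  IsHolChart φ ∧ (∀ p ∈ φ.source, τ p ≠ p) ∧
    e.source = proj τ '' {p | p.1 ∈ φ.source} ∧ ∀ p, p.1 ∈ φ.source → e (proj τ p) = φ p.1

/-- The smooth structure of `Σ'`: the charts induced by the holomorphic charts of `Σ ∖ C`. -/
def quotientAtlas (τ : S → S) : Set (OpenPartialHomeomorph (QuotientSurface τ) ℂ) :=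
  {e | ∃ φ, IsInducedChart τ φ e}

/-- Given an orientation `o` of `Σ'`, the part `Σ⁺` of `Σ ∖ C` where the orientation pulled back
from `Σ'` agrees with the complex orientation of `Σ`. The projection identifies `Σ⁺` with `Σ'`,
preserving the orientations. -/
def positivePart (τ : S → S) (o : OpenPartialHomeomorph (QuotientSurface τ) ℂ →
    QuotientSurface τ → ℤˣ) : Set S :=
  {p | ∃ (h : τ p ≠ p) (φ : OpenPartialHomeomorph S ℂ)
    (e : OpenPartialHomeomorph (QuotientSurface τ) ℂ),
    IsInducedChart τ φ e ∧ p ∈ φ.source ∧ o e (proj τ ⟨p, h⟩) = 1}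

/-- A holomorphic chart with `τ`-invariant domain in which `τ` is complex conjugation. -/
def IsRealChart (τ : S → S) (φ : OpenPartialHomeomorph S ℂ) : Prop :=
  IsHolChart φ ∧ ∀ p ∈ φ.source, τ p ∈ φ.source ∧ φ (τ p) = conj (φ p)

/-- A real chart in which `Σ⁺ ≅ Σ'` is the upper half plane. The outward normal of the upper half
plane along `ℝ` is `-i`, and `(-i, 1)` is a positive basis of `ℂ`. So, with the outward normal first
convention, the boundary orientation of `C` is the one in which the coordinate `Re φ` increases. -/
def IsBoundaryChart (τ : S → S) (o : OpenPartialHomeomorph (QuotientSurface τ) ℂ →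
    QuotientSurface τ → ℤˣ) (φ : OpenPartialHomeomorph S ℂ) : Prop :=
  IsRealChart τ φ ∧ ∀ p ∈ φ.source, p ∈ positivePart τ o ↔ 0 < (φ p).im

/-- There is an arc in `Ĉ` that goes from `c` to `c'` in the direction of the boundary
orientation. -/
def PositiveArc (τ : S → S) (o : OpenPartialHomeomorph (QuotientSurface τ) ℂ →
    QuotientSurface τ → ℤˣ) (w : Finset S) (c c' : S) : Prop :=
  ∃ γ : ℝ → S, ContinuousOn γ (Set.Icc 0 1) ∧ γ 0 = c ∧ γ 1 = c' ∧
    (∀ t ∈ Set.Icc (0 : ℝ) 1, γ t ∈ puncturedCurve τ w) ∧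
    ∀ φ, IsBoundaryChart τ o φ → ∀ s t : ℝ, 0 ≤ s → s < t → t ≤ 1 →
      (∀ r ∈ Set.Icc s t, γ r ∈ φ.source) → (φ (γ s)).re < (φ (γ t)).re

/-- The order on `Ĉ`: first by the components, in the chosen order `ord`, then along each component
(an open interval that starts and ends at a basepoint) in the direction of its orientation. -/
def Precedes (τ : S → S) (o : OpenPartialHomeomorph (QuotientSurface τ) ℂ →
    QuotientSurface τ → ℤˣ) (w : Finset S)
    (ord : LinearOrder (ConnectedComponents (puncturedCurve τ w)))
    (c c' : puncturedCurve τ w) : Prop :=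
  ord.lt (ConnectedComponents.mk c) (ConnectedComponents.mk c') ∨ PositiveArc τ o w c c'

/-- The smooth structure of `M̂^R`, locally the real part `ℝ^m` of `Sym^m(ℂ) ≅ ℂ^m`. A real chart
`φ` of `S` gives the chart of `M̂^R` whose domain consists of the tuples of points in the domain of
`φ`, and whose coordinates are the elementary symmetric functions `σ₁, …, σ_m` (which are real
there) of the numbers `φ p`, for `p` in the tuple. -/
def fixedLocusAtlas (τ : S → S) (w : Finset S) (m : ℕ) :
    Set (OpenPartialHomeomorph (FixedLocus τ w m) (Fin m → ℝ)) :=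
  {e | ∃ φ, IsRealChart τ φ ∧ e.source = {x | ∀ p ∈ x.points, p ∈ φ.source} ∧
    ∀ x ∈ e.source, ∀ i, e x i = ((x.points.map φ).esymm (i + 1)).re}

/-- The vector `(Re a₁, Im a₁, …, Re a_k, Im a_k, t₁, …, t_{m-2k})` of `ℝ^m`: the identification
`ℂ^k × ℝ^{m-2k} ≅ ℝ^m` that preserves the standard orientations. -/
def interleave {m k : ℕ} (a : Fin k → ℂ) (t : Fin (m - 2 * k) → ℝ) (i : Fin m) : ℝ :=
  if h : (i : ℕ) < 2 * k then
    if (i : ℕ) % 2 = 0 then (a ⟨i / 2, by omega⟩).re else (a ⟨i / 2, by omega⟩).im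
  else t ⟨i - 2 * k, by omega⟩

/-- Positively oriented local coordinates on the interior of the stratum
`Sym^k(Σ') × Sym^{m-2k}(Ĉ)`, for the product of the orientation of `Sym^k(Σ') ≅ Sym^k(Σ⁺)` as a
complex manifold (with local coordinates the elementary symmetric functions of a holomorphic
coordinate `ψ` of `Σ⁺`) and of the orientation of `Sym^{m-2k}(Ĉ)` as a product
`I₁ × ⋯ × I_{m-2k}` of oriented intervals of `Ĉ` around the points `c₁, …, c_{m-2k}`, numbered in
the order on `Ĉ`. No sign is included here. -/
def IsStratumChart (τ : S → S) (o : OpenPartialHomeomorph (QuotientSurface τ) ℂ →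
    QuotientSurface τ → ℤˣ) (w : Finset S)
    (ord : LinearOrder (ConnectedComponents (puncturedCurve τ w))) (m k : ℕ)
    (s : OpenPartialHomeomorph (FixedLocus τ w m) (Fin m → ℝ)) : Prop :=
  ∃ (ψ : OpenPartialHomeomorph S ℂ) (φ : Fin (m - 2 * k) → OpenPartialHomeomorph S ℂ),
    IsHolChart ψ ∧ ψ.source ⊆ positivePart τ o ∧ (∀ j, IsBoundaryChart τ o (φ j)) ∧
    ∀ x ∈ s.source, ∃ (z : Fin k → S) (c : Fin (m - 2 * k) → puncturedCurve τ w),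
      (∀ i, z i ∈ ψ.source) ∧ (∀ j, (c j : S) ∈ (φ j).source) ∧
      (∀ i j, i < j → Precedes τ o w ord (c i) (c j)) ∧
      x.points = Finset.univ.val.map z + Finset.univ.val.map (fun i => τ (z i)) +
        Finset.univ.val.map (fun j => (c j : S)) ∧
      s x = interleave
        (fun i => ((Finset.univ.val.map z).map ψ).esymm (i + 1)) (fun j => (φ j (c j)).re)

end Surface

end RealHF

end

namespace RealHF

/-! ### Unordered tuples -/

/-! A real chart `φ` whose domain contains all points of a real tuple sends the tuple to the monic
polynomial with roots `φ p`. This polynomial has real coefficients, and these are the coordinates of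
the fixed locus. On the `k`-th stratum it is `Q · conj Q · ∏ (X - t_j)`, and the stratum has the
coefficients of `Q` and the `t_j` as coordinates. If all roots of `Q` lie in the upper half plane,
the Jacobian determinant of the multiplication `(Q, t) ↦ Q · conj Q · ∏ (X - t_j)` is a positive
number times `∏_{i<j} (t_i - t_j)` (`det_fderiv_stratumMap`). For increasing `t` its sign is
therefore `(-1)^(n(n-1)/2)` with `n = m - 2k`.

This singles out the ordered charts: `Σ⁺` corresponds to the upper half plane, and `Re φ` increases
in the chosen order of `Ĉ`. The sign above is the same for all of them
(`IsStratumChart.fderiv_det`), so coordinate changes between ordered charts have positive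
determinant at tuples of distinct points. Such tuples are dense (`frequently_nodup_roots`) and the
determinant never vanishes, so it is positive everywhere (`IsOrderedFixedChart.det_pos`), and the
ordered charts define an orientation.

Every finite set disjoint from `w` lies in an ordered chart
(`IsPointedRealSurface.exists_isOrderedChart_of_finset`). Chart domains need not be connected, so
small charts can be placed side by side along the real axis in the prescribed order. This needs an
order without cycles, which is the role of the basepoints: without them a component would be a
circle and a point would precede itself (`not_monoArc_self`).

Finally `n(n-1)/2 ≡ m(m-1)/2 + k` modulo 2, so the sign alternates with `k` exactly as
`(-1)^(h+l-k-1)` does. The integers `h`, `l` and `m` only contribute a global sign, absorbed into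
the choice of the orientation (`stratum_sign`).

The analytic input is that symmetric functions of the values of a holomorphic function at the roots
are analytic in the coefficients. Power sums are contour integrals (`contDiffAt_sum_roots`), and
Newton's identities give the rest. -/

theorem exists_perm_of_map_univ_eq {α : Type*} {n : ℕ} {f g : Fin n → α}
    (h : Finset.univ.val.map f = Finset.univ.val.map g) : ∃ σ : Equiv.Perm (Fin n), f = g ∘ σ := by
  classical
  -- The order is arbitrary: it only serves to sort both tuples, and sorted rearrangements of the
  -- same multiset agree.
  let _ : LinearOrder α := linearOrderOfSTO (WellOrderingRel (α := α))
  have h1 : (List.ofFn f).Perm (List.ofFn g) := by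
    rw [← Multiset.coe_eq_coe, ← Fin.univ_val_map, ← Fin.univ_val_map, h]
  have h2 : f ∘ Tuple.sort f = g ∘ Tuple.sort g :=
    List.ofFn_injective <|
      (((Tuple.sort f).ofFn_comp_perm f).trans
        (h1.trans ((Tuple.sort g).ofFn_comp_perm g).symm)).eq_of_pairwise'
      (Tuple.monotone_sort f).sortedLE_ofFn.pairwise
      (Tuple.monotone_sort g).sortedLE_ofFn.pairwise
  refine ⟨(Tuple.sort f).symm.trans (Tuple.sort g), funext fun i => ?_⟩
  have := congrFun h2 ((Tuple.sort f).symm i)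
  simpa using this

theorem map_univ_comp_perm {α : Type*} {n : ℕ} (f : Fin n → α) (σ : Equiv.Perm (Fin n)) :
    Finset.univ.val.map (f ∘ σ) = Finset.univ.val.map f := by
  rw [← Multiset.map_map, Multiset.map_univ_val_equiv]

theorem exists_map_univ_eq {α : Type*} {n : ℕ} (M : Multiset α) (h : M.card = n) :
    ∃ r : Fin n → α, Finset.univ.val.map r = M := by
  induction M using Quotient.inductionOn with
  | h l =>
    subst h
    refine ⟨fun i => l.get i, ?_⟩
    rw [Fin.univ_val_map]
    simp

/-- The image of an open set of ordered tuples under a map that forgets exactly the order has an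
open preimage. -/
theorem isOpen_preimage_image_of_perm {α β : Type*} [TopologicalSpace α] {n : ℕ}
    {q : (Fin n → α) → β} (hq : ∀ x y, q x = q y ↔ ∃ σ : Equiv.Perm (Fin n), x = y ∘ σ)
    {U : Set (Fin n → α)} (hU : IsOpen U) : IsOpen (q ⁻¹' (q '' U)) := by
  have : q ⁻¹' (q '' U) = ⋃ σ : Equiv.Perm (Fin n), (fun x : Fin n → α => x ∘ σ) ⁻¹' U := by
    ext x
    simp only [Set.mem_preimage, Set.mem_image, Set.mem_iUnion]
    constructor
    · rintro ⟨y, hy, hyx⟩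
      obtain ⟨σ, rfl⟩ := (hq _ _).1 hyx
      exact ⟨σ, hy⟩
    · rintro ⟨σ, hσ⟩
      exact ⟨_, hσ, (hq _ _).2 ⟨σ, rfl⟩⟩
  rw [this]
  exact isOpen_iUnion fun σ => hU.preimage (by fun_prop)

/-! ### Coefficients and roots of monic polynomials -/

open Polynomial in
/-- The monic polynomial with coefficients `1, -a₁, a₂, …, (-1)^m a_m`. -/
noncomputable def monicPoly {m : ℕ} (a : Fin m → ℂ) : ℂ[X] :=
  X ^ m + ∑ i : Fin m, C ((-1) ^ (i + 1 : ℕ) * a i) * X ^ (m - 1 - i : ℕ)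

/-- The elementary symmetric functions `σ₁, …, σ_m` of a multiset. -/
noncomputable def coeffVec (m : ℕ) (M : Multiset ℂ) : Fin m → ℂ := fun i => M.esymm (i + 1)

/-- The elementary symmetric functions of an ordered `m`-tuple. -/
noncomputable def rootMap (m : ℕ) (r : Fin m → ℂ) : Fin m → ℂ := coeffVec m (Finset.univ.val.map r)

open Polynomial in
theorem prod_X_sub_C_eq_monicPoly {m : ℕ} {M : Multiset ℂ} (hM : M.card = m) :
    (M.map fun t => X - C t).prod = monicPoly (coeffVec m M) := by
  rw [Multiset.prod_X_sub_X_eq_sum_esymm, hM, Finset.sum_range_succ', monicPoly, add_comm]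
  congr 1
  · simp [Multiset.esymm]
  · rw [← Fin.sum_univ_eq_sum_range
      (fun j => (-1 : ℂ[X]) ^ (j + 1) * (C (M.esymm (j + 1)) * X ^ (m - (j + 1))))]
    refine Finset.sum_congr rfl fun i _ => ?_
    simp only [coeffVec, C_mul, C_pow, C_neg, C_1, ← mul_assoc]
    congr 2
    omega

open Polynomial in
theorem monicPoly_coeff {m : ℕ} (a : Fin m → ℂ) (i : Fin m) :
    (monicPoly a).coeff (m - 1 - i) = (-1) ^ (i + 1 : ℕ) * a i := by
  simp only [monicPoly, coeff_add, coeff_X_pow, finsetSum_coeff, coeff_C_mul]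
  rw [if_neg (by omega), zero_add, Finset.sum_eq_single i]
  · simp
  · intro j _ hj
    rw [if_neg, mul_zero]
    have := Fin.val_ne_of_ne hj
    omega
  · simp

theorem monicPoly_injective {m : ℕ} : Function.Injective (monicPoly (m := m)) := by
  intro a b h
  funext i
  have := congrArg (fun p => p.coeff (m - 1 - i)) h
  simp only [monicPoly_coeff] at this
  exact mul_left_cancel₀ (pow_ne_zero _ (by norm_num)) this

open Polynomial in
theorem degree_monicPoly_sub_lt {m : ℕ} (a : Fin m → ℂ) :
    (∑ i : Fin m, C ((-1) ^ (i + 1 : ℕ) * a i) * X ^ (m - 1 - i : ℕ)).degree < (m : WithBot ℕ) := by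
  refine (degree_sum_le _ _).trans_lt ((Finset.sup_lt_iff (WithBot.bot_lt_coe m)).2 fun i _ => ?_)
  refine (degree_C_mul_X_pow_le _ _).trans_lt ?_
  have := i.2
  exact WithBot.coe_lt_coe.2 (by omega : m - 1 - (i : ℕ) < m)

theorem monicPoly_monic {m : ℕ} (a : Fin m → ℂ) : (monicPoly a).Monic :=
  Polynomial.monic_X_pow_add (degree_monicPoly_sub_lt a)

theorem monicPoly_natDegree {m : ℕ} (a : Fin m → ℂ) : (monicPoly a).natDegree = m := by
  rw [monicPoly, Polynomial.natDegree_add_eq_left_of_degree_lt, Polynomial.natDegree_X_pow]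
  rw [Polynomial.degree_X_pow]
  exact degree_monicPoly_sub_lt a

theorem monicPoly_roots_card {m : ℕ} (a : Fin m → ℂ) : (monicPoly a).roots.card = m := by
  exact (IsAlgClosed.splits (monicPoly a)).natDegree_eq_card_roots.symm.trans
    (monicPoly_natDegree a)

theorem coeffVec_roots {m : ℕ} (a : Fin m → ℂ) : coeffVec m (monicPoly a).roots = a := by
  apply monicPoly_injective
  rw [← prod_X_sub_C_eq_monicPoly (monicPoly_roots_card a)]
  exact ((IsAlgClosed.splits (monicPoly a)).eq_prod_roots_of_monic (monicPoly_monic a)).symm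

theorem roots_monicPoly_coeffVec {m : ℕ} {M : Multiset ℂ} (hM : M.card = m) :
    (monicPoly (coeffVec m M)).roots = M := by
  rw [← prod_X_sub_C_eq_monicPoly hM, Polynomial.roots_multiset_prod_X_sub_C]

theorem coeffVec_injective {m : ℕ} {M N : Multiset ℂ} (hM : M.card = m) (hN : N.card = m)
    (h : coeffVec m M = coeffVec m N) : M = N := by
  rw [← roots_monicPoly_coeffVec hM, h, roots_monicPoly_coeffVec hN]

theorem rootMap_surjective (m : ℕ) : Function.Surjective (rootMap m) := fun a => by
  obtain ⟨r, hr⟩ := exists_map_univ_eq _ (monicPoly_roots_card a)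
  exact ⟨r, by rw [rootMap, hr, coeffVec_roots]⟩

theorem roots_monicPoly_rootMap {m : ℕ} (r : Fin m → ℂ) :
    (monicPoly (rootMap m r)).roots = Finset.univ.val.map r :=
  roots_monicPoly_coeffVec (by simp)

theorem rootMap_eq_iff {m : ℕ} (r s : Fin m → ℂ) :
    rootMap m r = rootMap m s ↔ ∃ σ : Equiv.Perm (Fin m), r = s ∘ σ := by
  constructor
  · exact fun h => exists_perm_of_map_univ_eq (coeffVec_injective (by simp) (by simp) h)
  · rintro ⟨σ, rfl⟩
    rw [rootMap, map_univ_comp_perm, rootMap]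

theorem eval_monicPoly {m : ℕ} (a : Fin m → ℂ) (x : ℂ) :
    (monicPoly a).eval x = x ^ m + ∑ i : Fin m, (-1) ^ (i + 1 : ℕ) * a i * x ^ (m - 1 - i : ℕ) := by
  simp [monicPoly, Polynomial.eval_finsetSum]

theorem eval_monicPoly_rootMap {m : ℕ} (r : Fin m → ℂ) (x : ℂ) :
    (monicPoly (rootMap m r)).eval x = ∏ i, (x - r i) := by
  rw [rootMap, ← prod_X_sub_C_eq_monicPoly (by simp), Polynomial.eval_multiset_prod,
    Multiset.map_map, Multiset.map_map, Finset.prod]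
  simp

theorem contDiff_rootMap {n : ℕ∞ω} (m : ℕ) : ContDiff ℂ n (rootMap m) := by
  rw [contDiff_pi]
  intro i
  have : (fun r : Fin m → ℂ => rootMap m r i) =
      fun r => ∑ t ∈ Finset.univ.powersetCard (i + 1 : ℕ), ∏ j ∈ t, r j := by
    funext r
    rw [rootMap, coeffVec, Finset.esymm_map_val]
  rw [this]
  exact ContDiff.sum fun t _ => contDiff_prod fun j _ => contDiff_apply ℂ ℂ j

theorem continuous_rootMap (m : ℕ) : Continuous (rootMap m) :=
  (contDiff_rootMap (n := 0) m).continuous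

/-- Cauchy's bound for the roots of a monic polynomial. It makes `rootMap` proper, hence closed. -/
theorem norm_le_of_rootMap {m : ℕ} (r : Fin m → ℂ) : ‖r‖ ≤ ‖rootMap m r‖ + 1 := by
  refine (pi_norm_le_iff_of_nonneg (by positivity)).2 fun i => ?_
  have hroot : (monicPoly (rootMap m r)).IsRoot (r i) := by
    rw [Polynomial.IsRoot, eval_monicPoly_rootMap]
    exact Finset.prod_eq_zero (Finset.mem_univ i) (sub_self _)
  have h := hroot.norm_lt_cauchyBound (monicPoly_monic _).ne_zero
  refine (NNReal.coe_le_coe.2 h.le).trans ?_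
  rw [Polynomial.cauchyBound, (monicPoly_monic _).leadingCoeff, monicPoly_natDegree]
  simp only [nnnorm_one, div_one, NNReal.coe_add, NNReal.coe_one]
  gcongr
  rw [← coe_nnnorm, NNReal.coe_le_coe]
  refine Finset.sup_le fun j hj => ?_
  have hj := Finset.mem_range.1 hj
  -- The coefficient of `X ^ j` is, up to sign, the entry with index `m - 1 - j`.
  have h2 := monicPoly_coeff (rootMap m r) ⟨m - 1 - j, by omega⟩
  have h3 : m - 1 - (m - 1 - j) = j := by omega
  simp only [h3] at h2
  rw [h2]
  simpa using nnnorm_le_pi_nnnorm (rootMap m r) _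

theorem isClosedMap_rootMap (m : ℕ) : IsClosedMap (rootMap m) := by
  refine (isProperMap_iff_tendsto_cocompact.2 ⟨continuous_rootMap m, ?_⟩).isClosedMap
  rw [← Metric.cobounded_eq_cocompact,
    ← tendsto_norm_atTop_iff_cobounded]
  refine Filter.tendsto_atTop_mono (fun r => ?_)
    (Filter.tendsto_atTop_add_const_right _ (-1) tendsto_norm_cobounded_atTop)
  have := norm_le_of_rootMap r
  linarith

/-- Continuity of roots. -/
theorem isOpenMap_rootMap (m : ℕ) : IsOpenMap (rootMap m) := by
  intro U hU
  have h := isOpen_preimage_image_of_perm (rootMap_eq_iff (m := m)) hU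
  -- The complement of the saturation of `U` is closed and saturated, so its image is closed and is
  -- exactly the complement of the image of `U`.
  have h2 := isClosedMap_rootMap m _ h.isClosed_compl
  rw [← Set.preimage_compl, Set.image_preimage_eq _ (rootMap_surjective m)] at h2
  exact isClosed_compl_iff.1 h2


/-! ### Symmetric holomorphic functions of the roots -/

open Classical in
/-- The contour integral of `h * g` over a circle, as a functional of `g`. -/
theorem exists_circleIntegral_clm (h : ℂ → ℂ) (c : ℂ) {R : ℝ} (hR : 0 ≤ R)
    (hh : ContinuousOn h (Metric.sphere c R)) :
    ∃ L : C(Metric.sphere c R, ℂ) →L[ℂ] ℂ, ∀ (g : C(Metric.sphere c R, ℂ)) (k : ℂ → ℂ),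
      (∀ w : Metric.sphere c R, g w = k w) → L g = ∮ w in C(c, R), h w * k w := by
  -- The integral only sees values on the circle, so the extension by zero is harmless.
  let ext (g : C(Metric.sphere c R, ℂ)) (w : ℂ) : ℂ :=
    if hw : w ∈ Metric.sphere c R then g ⟨w, hw⟩ else 0
  have hext (g : C(Metric.sphere c R, ℂ)) (w : Metric.sphere c R) : ext g w = g w :=
    dif_pos w.2
  have hcont (g : C(Metric.sphere c R, ℂ)) : ContinuousOn (ext g) (Metric.sphere c R) := by
    rw [continuousOn_iff_continuous_domRestrict]
    convert g.continuous using 1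
    exact funext fun w => hext g w
  have hint (g : C(Metric.sphere c R, ℂ)) : CircleIntegrable (fun w => h w * ext g w) c R :=
    (hh.mul (hcont g)).circleIntegrable hR
  obtain ⟨B, hB⟩ := (isCompact_sphere c R).exists_bound_of_continuousOn hh
  let L : C(Metric.sphere c R, ℂ) →ₗ[ℂ] ℂ :=
    { toFun := fun g => ∮ w in C(c, R), h w * ext g w
      map_add' := fun g g' => by
        rw [← circleIntegral.integral_add (hint g) (hint g')]
        refine circleIntegral.integral_congr hR fun w hw => ?_
        have := hext (g + g') ⟨w, hw⟩
        have h1 := hext g ⟨w, hw⟩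
        have h2 := hext g' ⟨w, hw⟩
        simp only [ContinuousMap.add_apply] at this
        simp only [this, h1, h2, mul_add]
      map_smul' := fun a g => by
        rw [RingHom.id_apply, ← circleIntegral.integral_smul]
        refine circleIntegral.integral_congr hR fun w hw => ?_
        have := hext (a • g) ⟨w, hw⟩
        have h1 := hext g ⟨w, hw⟩
        simp only [ContinuousMap.smul_apply, smul_eq_mul] at this
        simp only [this, h1, smul_eq_mul]
        ring }
  refine ⟨L.mkContinuous (2 * Real.pi * R * |B|) fun g => ?_, fun g k hk => ?_⟩
  · have := circleIntegral.norm_integral_le_of_norm_le_const (f := fun w => h w * ext g w)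
      (C := |B| * ‖g‖) (c := c) hR fun w hw => by
        rw [norm_mul]
        have h1 := hext g ⟨w, hw⟩
        simp only at h1
        rw [h1]
        exact mul_le_mul ((hB w hw).trans (le_abs_self B)) (g.norm_coe_le_norm _)
          (norm_nonneg _) (abs_nonneg _)
    calc ‖L g‖ ≤ _ := this
      _ = _ := by ring
  · change (∮ w in C(c, R), h w * ext g w) = _
    refine circleIntegral.integral_congr hR fun w hw => ?_
    have := hext g ⟨w, hw⟩
    simp only at this
    simp only [this, hk]

/-- The polynomial depends affinely on its coefficients as an element of the Banach algebra `C(K,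
ℂ)`. Working there replaces differentiation under the integral sign. -/
theorem contDiff_monicPoly_eval {m : ℕ} {n : ℕ∞ω} (K : Set ℂ) [CompactSpace K] :
    ContDiff ℂ n (fun a : Fin m → ℂ =>
      (⟨fun w => (monicPoly a).eval w.1, by fun_prop⟩ : C(K, ℂ))) := by
  let X : C(K, ℂ) := ⟨Subtype.val, continuous_subtype_val⟩
  have : (fun a : Fin m → ℂ => (⟨fun w => (monicPoly a).eval w.1, by fun_prop⟩ : C(K, ℂ))) =
      fun a => X ^ m + ∑ i : Fin m, a i • ((-1) ^ (i + 1 : ℕ) * X ^ (m - 1 - i : ℕ)) := by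
    funext a
    ext w
    simp only [ContinuousMap.coe_mk, eval_monicPoly, ContinuousMap.add_apply,
      ContinuousMap.pow_apply, ContinuousMap.sum_apply, ContinuousMap.smul_apply,
      ContinuousMap.mul_apply, ContinuousMap.neg_apply, ContinuousMap.one_apply, smul_eq_mul, X]
    congr 1
    exact Finset.sum_congr rfl fun i _ => by ring
  rw [this]
  exact contDiff_const.add
    (ContDiff.sum fun i _ => (contDiff_apply ℂ ℂ i).smul contDiff_const)

theorem contDiff_monicPoly_derivative_eval {m : ℕ} {n : ℕ∞ω} (K : Set ℂ) [CompactSpace K] :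
    ContDiff ℂ n (fun a : Fin m → ℂ =>
      (⟨fun w => (monicPoly a).derivative.eval w.1, by fun_prop⟩ : C(K, ℂ))) := by
  let Y (p : Polynomial ℂ) : C(K, ℂ) := ⟨fun w => p.eval w.1, by fun_prop⟩
  have : (fun a : Fin m → ℂ =>
      (⟨fun w => (monicPoly a).derivative.eval w.1, by fun_prop⟩ : C(K, ℂ))) =
      fun a => Y (Polynomial.X ^ m).derivative + ∑ i : Fin m, a i •
        ((-1) ^ (i + 1 : ℕ) * Y (Polynomial.X ^ (m - 1 - i : ℕ)).derivative) := by
    funext a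
    ext w
    simp only [ContinuousMap.coe_mk, monicPoly, Polynomial.derivative_add,
      Polynomial.derivative_sum, Polynomial.derivative_C_mul, Polynomial.eval_add,
      Polynomial.eval_finsetSum, Polynomial.eval_mul, Polynomial.eval_C, ContinuousMap.add_apply,
      ContinuousMap.pow_apply, ContinuousMap.sum_apply, ContinuousMap.smul_apply,
      ContinuousMap.mul_apply, ContinuousMap.neg_apply, ContinuousMap.one_apply, smul_eq_mul, Y]
    congr 1
    exact Finset.sum_congr rfl fun i _ => by ring
  rw [this]
  exact contDiff_const.add
    (ContDiff.sum fun i _ => (contDiff_apply ℂ ℂ i).smul contDiff_const)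

theorem exists_disjoint_closedBalls (F : Finset ℂ) {V : Set ℂ} (hV : IsOpen V)
    (hF : ∀ p ∈ F, p ∈ V) : ∃ ε > 0, (∀ p ∈ F, Metric.closedBall p ε ⊆ V) ∧
      ∀ p ∈ F, ∀ q ∈ F, p ≠ q → Disjoint (Metric.closedBall p ε) (Metric.closedBall q ε) := by
  have h1 : ∀ᶠ ε : ℝ in 𝓝[>] 0, ∀ p ∈ F, Metric.closedBall p ε ⊆ V := by
    rw [Filter.eventually_all_finset]
    intro p hp
    obtain ⟨δ, hδ, hb⟩ := Metric.isOpen_iff.1 hV p (hF p hp)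
    filter_upwards [Ioo_mem_nhdsGT hδ] with ε hε
    exact (Metric.closedBall_subset_ball hε.2).trans hb
  have h2 : ∀ᶠ ε : ℝ in 𝓝[>] 0, ∀ p ∈ F, ∀ q ∈ F, p ≠ q →
      Disjoint (Metric.closedBall p ε) (Metric.closedBall q ε) := by
    rw [Filter.eventually_all_finset]
    intro p hp
    rw [Filter.eventually_all_finset]
    intro q hq
    by_cases hpq : p = q
    · simp [hpq]
    have : 0 < dist p q / 2 := half_pos (dist_pos.2 hpq)
    filter_upwards [Ioo_mem_nhdsGT this] with ε hε _
    exact Metric.closedBall_disjoint_closedBall (by linarith [hε.2])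
  obtain ⟨ε, h, hε⟩ := ((h1.and h2).and self_mem_nhdsWithin).exists
  exact ⟨ε, hε, h.1, h.2⟩

theorem eventually_exists_rootMap {m : ℕ} (r : Fin m → ℂ) {U : Set (Fin m → ℂ)}
    (hU : U ∈ 𝓝 r) : ∀ᶠ a in 𝓝 (rootMap m r), ∃ s ∈ U, rootMap m s = a :=
  (isOpenMap_rootMap m).image_mem_nhds hU

/-- Argument principle: the sum of `h` over the roots of `P` near `p` is `(2πi)⁻¹ ∮ h P'/P` over a
small circle around `p`. The circles stay fixed while `P` varies, and the integral is analytic in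
`P`. -/
theorem contDiffAt_sum_roots {m : ℕ} {V : Set ℂ} (hV : IsOpen V) {h : ℂ → ℂ}
    (hh : DifferentiableOn ℂ h V) {a₀ : Fin m → ℂ} (ha : ∀ z ∈ (monicPoly a₀).roots, z ∈ V) :
    ContDiffAt ℂ ω (fun a : Fin m → ℂ => ((monicPoly a).roots.map h).sum) a₀ := by
  classical
  obtain ⟨r, rfl⟩ := rootMap_surjective m a₀
  have hr (i) : r i ∈ V := ha _ (by rw [roots_monicPoly_rootMap]; simp)
  obtain ⟨ε, hε, hball, hdisj⟩ := exists_disjoint_closedBalls (Finset.univ.image r) hV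
    (by simpa using hr)
  have hmem (i) : r i ∈ Finset.univ.image r := by simp
  choose! L hL using fun p (hp : p ∈ Finset.univ.image r) =>
    exists_circleIntegral_clm h p hε.le
      (hh.continuousOn.mono (Metric.sphere_subset_closedBall.trans (hball p hp)))
  let A (p : ℂ) (a : Fin m → ℂ) : C(Metric.sphere p ε, ℂ) :=
    ⟨fun w => (monicPoly a).eval w.1, by fun_prop⟩
  let D (p : ℂ) (a : Fin m → ℂ) : C(Metric.sphere p ε, ℂ) :=
    ⟨fun w => (monicPoly a).derivative.eval w.1, by fun_prop⟩
  -- Roots that moved by less than `ε` stay off all circles, since the closed discs are disjoint.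
  have hne (s : Fin m → ℂ) (hs : ∀ i, s i ∈ Metric.ball (r i) ε) (p) (hp : p ∈ Finset.univ.image r)
      (w) (hw : w ∈ Metric.sphere p ε) (i) : w - s i ≠ 0 := by
    rw [sub_ne_zero]
    rintro rfl
    by_cases hpi : p = r i
    · subst hpi
      exact (Metric.mem_ball.1 (hs i)).ne hw
    · exact Set.disjoint_left.1 (hdisj p hp _ (hmem i) hpi) (Metric.sphere_subset_closedBall hw)
        (Metric.ball_subset_closedBall (hs i))
  have hunit (s : Fin m → ℂ) (hs : ∀ i, s i ∈ Metric.ball (r i) ε) (p)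
      (hp : p ∈ Finset.univ.image r) : IsUnit (A p (rootMap m s)) := by
    rw [ContinuousMap.isUnit_iff_forall_ne_zero]
    intro w
    change (monicPoly (rootMap m s)).eval w.1 ≠ 0
    rw [eval_monicPoly_rootMap]
    exact Finset.prod_ne_zero_iff.2 fun i _ => hne s hs p hp w w.2 i
  -- A continuous linear functional applied to `P' · P⁻¹`. Inversion is analytic at the units of a
  -- Banach algebra, and `P` is a unit because it has no zero on the circle.
  have hsmooth : ContDiffAt ℂ ω (fun a => ∑ p ∈ Finset.univ.image r,
      (2 * Real.pi * Complex.I : ℂ)⁻¹ * L p (D p a * Ring.inverse (A p a))) (rootMap m r) := by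
    refine ContDiffAt.sum fun p hp => contDiffAt_const.mul ?_
    refine (L p).contDiff.contDiffAt.comp _ ?_
    refine (contDiff_monicPoly_derivative_eval _).contDiffAt.mul ?_
    refine ContDiffAt.comp (g := Ring.inverse) (f := A p) _ ?_
      (contDiff_monicPoly_eval _).contDiffAt
    obtain ⟨u, hu⟩ := hunit r (fun i => Metric.mem_ball_self hε) p hp
    rw [← hu]
    exact contDiffAt_ringInverse ℂ u
  refine hsmooth.congr_of_eventuallyEq ?_
  have hU : {s : Fin m → ℂ | ∀ i, s i ∈ Metric.ball (r i) ε} ∈ 𝓝 r := by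
    have : {s : Fin m → ℂ | ∀ i, s i ∈ Metric.ball (r i) ε} =
        Set.univ.pi fun i => Metric.ball (r i) ε := by ext; simp
    rw [this]
    exact set_pi_mem_nhds Set.finite_univ fun i _ => Metric.ball_mem_nhds _ hε
  filter_upwards [eventually_exists_rootMap r hU] with a ⟨s, hs, hsa⟩
  subst hsa
  rw [roots_monicPoly_rootMap, Multiset.map_map]
  -- On the circle `P'/P = ∑ (w - s i)⁻¹`. Cauchy's integral formula evaluates the terms with `s i`
  -- inside the disc; for the other roots the integrand is holomorphic in the disc.
  have key (p) (hp : p ∈ Finset.univ.image r) : L p (D p (rootMap m s) *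
      Ring.inverse (A p (rootMap m s))) =
        ∑ i, if r i = p then 2 * Real.pi * Complex.I * h (s i) else 0 := by
    rw [hL p hp _ (fun w => ∑ i, (w - s i)⁻¹)]
    · have hci (i) : CircleIntegrable (fun w => h w * (w - s i)⁻¹) p ε := by
        refine ContinuousOn.circleIntegrable hε.le ?_
        refine (hh.continuousOn.mono
          (Metric.sphere_subset_closedBall.trans (hball p hp))).mul ?_
        exact ContinuousOn.inv₀ (by fun_prop) fun w hw => hne s hs p hp w hw i
      simp only [Finset.mul_sum]
      rw [circleIntegral.integral_fun_sum fun i _ => hci i]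
      refine Finset.sum_congr rfl fun i _ => ?_
      split_ifs with hi
      · subst hi
        have hd : DiffContOnCl ℂ h (Metric.ball (r i) ε) :=
          (hh.mono ((closure_minimal Metric.ball_subset_closedBall
            Metric.isClosed_closedBall).trans (hball _ hp))).diffContOnCl
        have := hd.circleIntegral_sub_inv_smul (hs i)
        simp only [smul_eq_mul] at this
        rw [← this]
        exact circleIntegral.integral_congr hε.le fun w _ => mul_comm _ _
      · refine DiffContOnCl.circleIntegral_eq_zero hε.le (DifferentiableOn.diffContOnCl ?_)
        intro w hw
        have hw' : w ∈ Metric.closedBall p ε :=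
          closure_minimal Metric.ball_subset_closedBall Metric.isClosed_closedBall hw
        have hsub : closure (Metric.ball p ε) ⊆ V :=
          (closure_minimal Metric.ball_subset_closedBall Metric.isClosed_closedBall).trans
            (hball _ hp)
        refine ((hh w (hsub hw)).mono hsub).mul (DifferentiableWithinAt.inv (by fun_prop) ?_)
        rw [sub_ne_zero]
        rintro rfl
        exact Set.disjoint_left.1 (hdisj p hp _ (hmem i) (Ne.symm hi)) hw'
          (Metric.ball_subset_closedBall (hs i))
    · intro w
      obtain ⟨u, hu⟩ := hunit s hs p hp
      have h1 : Ring.inverse (A p (rootMap m s)) w * A p (rootMap m s) w = 1 := by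
        rw [← ContinuousMap.mul_apply, Ring.inverse_mul_cancel _ (hunit s hs p hp)]
        rfl
      have h0 : (monicPoly (rootMap m s)).eval w.1 ≠ 0 := right_ne_zero_of_mul_eq_one h1
      have h2 := (IsAlgClosed.splits (monicPoly (rootMap m s))).eval_derivative_div_eval_of_ne_zero
        h0
      rw [roots_monicPoly_rootMap, Multiset.map_map] at h2
      rw [ContinuousMap.mul_apply, eq_inv_of_mul_eq_one_left h1]
      change (monicPoly (rootMap m s)).derivative.eval w.1 *
        ((monicPoly (rootMap m s)).eval w.1)⁻¹ = _
      rw [← div_eq_mul_inv, h2]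
      simp only [Function.comp_def, one_div]
      rfl
  rw [Finset.sum_congr rfl fun p hp => congrArg (_ * ·) (key p hp)]
  simp only [Finset.mul_sum]
  rw [Finset.sum_comm]
  change ∑ i, h (s i) = _
  refine Finset.sum_congr rfl fun i _ => ?_
  have hpi : (2 * Real.pi * Complex.I : ℂ) ≠ 0 := Complex.two_pi_I_ne_zero
  simp only [mul_ite, mul_zero]
  rw [Finset.sum_ite_eq, if_pos (hmem i), inv_mul_cancel_left₀ hpi]

/-- Newton's identities for a multiset. -/
theorem mul_esymm_eq_sum_psum (M : Multiset ℂ) (k : ℕ) :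
    k * M.esymm k = (-1) ^ (k + 1) * ∑ a ∈ Finset.HasAntidiagonal.antidiagonal k with a.1 < k,
      (-1) ^ a.1 * M.esymm a.1 * (M.map (· ^ a.2)).sum := by
  obtain ⟨r, hr⟩ := exists_map_univ_eq M rfl
  have h := congrArg (MvPolynomial.aeval r) (MvPolynomial.mul_esymm_eq_sum (Fin M.card) ℂ k)
  simp only [map_mul, map_pow, map_neg, map_one, map_sum, map_natCast,
    MvPolynomial.aeval_esymm_eq_multiset_esymm, hr, MvPolynomial.psum, MvPolynomial.aeval_X] at h
  rw [h]
  congr 1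
  refine Finset.sum_congr rfl fun a _ => ?_
  congr 1
  conv_rhs => rw [← hr]
  rw [Multiset.map_map]
  rfl

/-- Newton's identities express the `k`-th elementary symmetric function through the lower ones and
the power sums of `f`, after division by `k`. The power sums are sums over roots of the functions `f
^ j`. -/
theorem contDiffAt_esymm_roots {m : ℕ} {V : Set ℂ} (hV : IsOpen V) {f : ℂ → ℂ}
    (hf : DifferentiableOn ℂ f V) {a₀ : Fin m → ℂ} (ha : ∀ z ∈ (monicPoly a₀).roots, z ∈ V)
    (k : ℕ) : ContDiffAt ℂ ω (fun a : Fin m → ℂ => ((monicPoly a).roots.map f).esymm k) a₀ := by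
  induction k using Nat.strong_induction_on with
  | _ k ih =>
    rcases Nat.eq_zero_or_pos k with rfl | hk
    · simpa [Multiset.esymm] using contDiffAt_const
    have : (fun a : Fin m → ℂ => ((monicPoly a).roots.map f).esymm k) = fun a =>
        (k : ℂ)⁻¹ * ((-1) ^ (k + 1) * ∑ b ∈ Finset.HasAntidiagonal.antidiagonal k with b.1 < k,
          (-1) ^ b.1 * ((monicPoly a).roots.map f).esymm b.1 *
            ((monicPoly a).roots.map fun z => f z ^ b.2).sum) := by
      funext a
      have h := mul_esymm_eq_sum_psum ((monicPoly a).roots.map f) k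
      simp only [Multiset.map_map, Function.comp_def] at h
      rw [← h, inv_mul_cancel_left₀ (Nat.cast_ne_zero.2 hk.ne')]
    rw [this]
    refine contDiffAt_const.mul (contDiffAt_const.mul (ContDiffAt.sum fun b hb => ?_))
    refine (contDiffAt_const.mul (ih b.1 (Finset.mem_filter.1 hb).2)).mul ?_
    exact contDiffAt_sum_roots hV (hf.pow b.2) ha

/-- The coefficients of the monic polynomial whose roots are the images under `f` of the roots of
the monic polynomial with coefficients `a`. -/
noncomputable def transfer (m : ℕ) (f : ℂ → ℂ) (a : Fin m → ℂ) : Fin m → ℂ :=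
  coeffVec m ((monicPoly a).roots.map f)

theorem contDiffAt_transfer {m : ℕ} {V : Set ℂ} (hV : IsOpen V) {f : ℂ → ℂ}
    (hf : DifferentiableOn ℂ f V) {a₀ : Fin m → ℂ} (ha : ∀ z ∈ (monicPoly a₀).roots, z ∈ V) :
    ContDiffAt ℂ ω (transfer m f) a₀ :=
  contDiffAt_pi.2 fun i => contDiffAt_esymm_roots hV hf ha (i + 1)

theorem transfer_coeffVec {m : ℕ} (f : ℂ → ℂ) {M : Multiset ℂ} (hM : M.card = m) :
    transfer m f (coeffVec m M) = coeffVec m (M.map f) := by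
  rw [transfer, roots_monicPoly_coeffVec hM]

theorem eventually_roots_mem {m : ℕ} {V : Set ℂ} (hV : IsOpen V) {a₀ : Fin m → ℂ}
    (ha : ∀ z ∈ (monicPoly a₀).roots, z ∈ V) :
    ∀ᶠ a in 𝓝 a₀, ∀ z ∈ (monicPoly a).roots, z ∈ V := by
  obtain ⟨r, rfl⟩ := rootMap_surjective m a₀
  rw [roots_monicPoly_rootMap] at ha
  have hU : (Set.univ.pi fun _ => V) ∈ 𝓝 r :=
    set_pi_mem_nhds Set.finite_univ fun i _ => hV.mem_nhds (ha _ (by simp))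
  filter_upwards [eventually_exists_rootMap r hU] with a ⟨s, hs, hsa⟩
  subst hsa
  rw [roots_monicPoly_rootMap]
  intro z hz
  obtain ⟨i, -, rfl⟩ := Multiset.mem_map.1 hz
  exact hs i (Set.mem_univ i)


/-! ### The Jacobian determinant of the elementary symmetric functions -/

theorem prod_erase_eq_prod_Ioi_mul {R : Type*} [CommRing R] {m : ℕ} (f : Fin m → Fin m → R) :
    ∏ i, ∏ j ∈ Finset.univ.erase i, f i j =
      (∏ i, ∏ j ∈ Finset.Ioi i, f i j) * ∏ i, ∏ j ∈ Finset.Ioi i, f j i := by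
  have h1 (i : Fin m) : ∏ j ∈ Finset.univ.erase i, f i j =
      (∏ j ∈ Finset.Ioi i, f i j) * ∏ j ∈ Finset.Iio i, f i j := by
    rw [← Finset.prod_union]
    · refine Finset.prod_congr ?_ fun _ _ => rfl
      ext j
      simp [lt_or_lt_iff_ne, eq_comm]
    · rw [Finset.disjoint_left]
      intro j hj hj'
      exact lt_asymm (Finset.mem_Ioi.1 hj) (Finset.mem_Iio.1 hj')
  rw [Finset.prod_congr rfl fun i _ => h1 i, Finset.prod_mul_distrib]
  congr 1
  exact Finset.prod_comm' (by simp)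

/-- Differentiating `∏ (x - s i)` in `s` and evaluating at the roots `x = r q` shows that a
Vandermonde matrix times the Jacobian matrix is diagonal. The diagonal has determinant `∏_{i ≠ j} (r
i - r j)`, and cancelling the Vandermonde determinant leaves half of the factors. -/
theorem det_fderiv_rootMap {m : ℕ} {r : Fin m → ℂ} (hr : Function.Injective r) :
    (fderiv ℂ (rootMap m) r).det = ∏ i, ∏ j ∈ Finset.Ioi i, (r i - r j) := by
  have hd : HasFDerivAt (rootMap m) (fderiv ℂ (rootMap m) r) r :=
    ((contDiff_rootMap (n := 1) m).differentiable one_ne_zero r).hasFDerivAt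
  set D := fderiv ℂ (rootMap m) r
  have key (x : ℂ) (v : Fin m → ℂ) : ∑ l : Fin m, (-1) ^ (l : ℕ) * x ^ (l.rev : ℕ) * D v l =
      ∑ i, (∏ j ∈ Finset.univ.erase i, (x - r j)) * v i := by
    have h1 : HasFDerivAt (fun s : Fin m → ℂ => ∏ i, (x - s i))
        (∑ i, (∏ j ∈ Finset.univ.erase i, (x - r j)) •
          (-(ContinuousLinearMap.proj (R := ℂ) (φ := fun _ : Fin m => ℂ) i))) r :=
      HasFDerivAt.finsetProd fun i _ => by
        simpa using (hasFDerivAt_apply (𝕜 := ℂ) i r).const_sub x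
    have h2 : HasFDerivAt (fun s : Fin m → ℂ => x ^ m + ∑ l : Fin m,
        ((-1) ^ (l + 1 : ℕ) * x ^ (m - 1 - l : ℕ)) * rootMap m s l)
        (∑ l : Fin m, ((-1) ^ (l + 1 : ℕ) * x ^ (m - 1 - l : ℕ)) •
          (ContinuousLinearMap.proj (R := ℂ) (φ := fun _ : Fin m => ℂ) l ∘L D)) r := by
      refine HasFDerivAt.const_add _ (HasFDerivAt.fun_sum fun l _ => ?_)
      exact (((hasFDerivAt_pi'.1 hd) l).const_mul _)
    have h3 : (fun s : Fin m → ℂ => ∏ i, (x - s i)) = fun s : Fin m → ℂ => x ^ m + ∑ l : Fin m,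
        ((-1) ^ (l + 1 : ℕ) * x ^ (m - 1 - l : ℕ)) * rootMap m s l := by
      funext s
      rw [← eval_monicPoly_rootMap, eval_monicPoly]
      congr 1
      exact Finset.sum_congr rfl fun l _ => by ring
    rw [h3] at h1
    have h4 := congrArg (fun F : (Fin m → ℂ) →L[ℂ] ℂ => -(F v)) (h2.unique h1)
    simp only [sum_apply, smul_apply, neg_apply, ContinuousLinearMap.comp_apply, ContinuousLinearMap.proj_apply,
      smul_eq_mul, ← Finset.sum_neg_distrib] at h4
    convert h4 using 1
    · refine Finset.sum_congr rfl fun l _ => ?_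
      have : (l.rev : ℕ) = m - 1 - l := by rw [Fin.val_rev]; omega
      rw [this, pow_succ]
      ring
    · exact Finset.sum_congr rfl fun l _ => by ring
  set J := LinearMap.toMatrix' (D : (Fin m → ℂ) →ₗ[ℂ] Fin m → ℂ) with hJ
  -- The constant `-1` in the projective Vandermonde matrix supplies the alternating signs, and the
  -- reversed exponents match the descending powers in `key`.
  have hWJ : Matrix.projVandermonde (fun _ => -1) r * J =
      Matrix.diagonal fun q => ∏ j ∈ Finset.univ.erase q, (r q - r j) := by
    ext q i
    rw [Matrix.mul_apply]
    have := key (r q) (Pi.single i 1)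
    simp only [Matrix.projVandermonde_apply, hJ, LinearMap.toMatrix'_apply]
    refine this.trans ?_
    rw [Finset.sum_eq_single i, Matrix.diagonal_apply]
    · by_cases hqi : q = i
      · simp [hqi]
      · rw [if_neg hqi, Finset.prod_eq_zero (i := q), zero_mul]
        · simp [hqi]
        · simp
    · intro j _ hj
      simp [hj]
    · simp
  have hdet := congrArg Matrix.det hWJ
  rw [Matrix.det_mul, Matrix.det_projVandermonde, Matrix.det_diagonal,
    prod_erase_eq_prod_Ioi_mul, mul_comm] at hdet
  have hV : ∏ i, ∏ j ∈ Finset.Ioi i, (r j - r i) ≠ 0 :=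
    Finset.prod_ne_zero_iff.2 fun i _ => Finset.prod_ne_zero_iff.2 fun j hj =>
      sub_ne_zero.2 fun h => (Finset.mem_Ioi.1 hj).ne (hr h.symm)
  have h1 : ∏ i, ∏ j ∈ Finset.Ioi i, (-1 * r i - -1 * r j) =
      ∏ i, ∏ j ∈ Finset.Ioi i, (r j - r i) :=
    Finset.prod_congr rfl fun i _ => Finset.prod_congr rfl fun j _ => by ring
  rw [h1] at hdet
  have := mul_right_cancel₀ hV hdet
  rw [← this, hJ, LinearMap.det_toMatrix']

/-! ### Products over pairs -/

theorem prod_pairs_succ {R : Type*} [CommMonoid R] (m : ℕ) (f : ℕ → ℕ → R) :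
    ∏ j ∈ Finset.range (m + 1), ∏ i ∈ Finset.range j, f i j =
      (∏ j ∈ Finset.range m, f 0 (j + 1)) *
        ∏ j ∈ Finset.range m, ∏ i ∈ Finset.range j, f (i + 1) (j + 1) := by
  rw [Finset.prod_range_succ']
  simp only [Finset.range_zero, Finset.prod_empty, mul_one, Finset.prod_range_succ' _ (_ : ℕ)]
  rw [Finset.prod_mul_distrib, mul_comm]

theorem prod_Ioi_eq_prod_range {R : Type*} [CommMonoid R] (m : ℕ) (f : ℕ → ℕ → R) :
    ∏ i : Fin m, ∏ j ∈ Finset.Ioi i, f i j =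
      ∏ j ∈ Finset.range m, ∏ i ∈ Finset.range j, f i j := by
  induction m generalizing f with
  | zero => simp
  | succ m ih =>
    rw [prod_pairs_succ, Fin.prod_univ_succ, Fin.prod_Ioi_zero, ← ih fun i j => f (i + 1) (j + 1),
      ← Fin.prod_univ_eq_prod_range (fun j => f 0 (j + 1)) m]
    simp [Fin.prod_Ioi_succ]

/-! ### Interleaved coordinates -/

/-- The sequence `z₀, conj z₀, …, z_{k-1}, conj z_{k-1}, t₀, t₁, …`. -/
noncomputable def conjSeq : ℕ → (ℕ → ℂ) → (ℕ → ℝ) → ℕ → ℂ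
  | 0, _, t, i => t i
  | _ + 1, z, _, 0 => z 0
  | _ + 1, z, _, 1 => conj (z 0)
  | k + 1, z, t, i + 2 => conjSeq k (fun j => z (j + 1)) t i

/-- The sequence `Re z₀, Im z₀, …, Re z_{k-1}, Im z_{k-1}, t₀, t₁, …`. -/
noncomputable def realSeq : ℕ → (ℕ → ℂ) → (ℕ → ℝ) → ℕ → ℝ
  | 0, _, t, i => t i
  | _ + 1, z, _, 0 => (z 0).re
  | _ + 1, z, _, 1 => (z 0).im
  | k + 1, z, t, i + 2 => realSeq k (fun j => z (j + 1)) t i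

/-- The matrix of the passage from `realSeq` to `conjSeq`. -/
noncomputable def conjMatrix : ℕ → ℕ → ℕ → ℂ
  | 0, i, j => if i = j then 1 else 0
  | _ + 1, 0, 0 => 1
  | _ + 1, 0, 1 => Complex.I
  | _ + 1, 1, 0 => 1
  | _ + 1, 1, 1 => -Complex.I
  | k + 1, i + 2, j + 2 => conjMatrix k i j
  | _ + 1, _, _ => 0

theorem sum_conjMatrix_mul_realSeq (k n : ℕ) (z : ℕ → ℂ) (t : ℕ → ℝ) (i : ℕ) (hi : i < 2 * k + n) :
    ∑ j ∈ Finset.range (2 * k + n), conjMatrix k i j * (realSeq k z t j : ℂ) =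
      conjSeq k z t i := by
  induction k generalizing z i with
  | zero =>
    simp only [conjMatrix, realSeq, conjSeq, ite_mul, one_mul, zero_mul]
    rw [Finset.sum_ite_eq, if_pos (Finset.mem_range.2 hi)]
  | succ k ih =>
    have : 2 * (k + 1) + n = 2 * k + n + 1 + 1 := by ring
    rw [this, Finset.sum_range_succ', Finset.sum_range_succ']
    match i with
    | 0 =>
      simp only [conjMatrix, zero_mul, Finset.sum_const_zero, realSeq, conjSeq, zero_add]
      apply Complex.ext <;> simp
    | 1 =>
      simp only [conjMatrix, zero_mul, Finset.sum_const_zero, realSeq, conjSeq, zero_add]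
      apply Complex.ext <;> simp
    | i + 2 =>
      simp only [conjMatrix, zero_mul, realSeq, conjSeq, add_zero]
      exact ih _ _ (by omega)

/-- The matrix is block diagonal, and each conjugate pair contributes a block of determinant `-2i`.
-/
theorem det_conjMatrix (k m : ℕ) (h : 2 * k ≤ m) :
    (Matrix.of fun i j : Fin m => conjMatrix k i j).det = (-2 * Complex.I) ^ k := by
  induction k generalizing m with
  | zero =>
    have : (Matrix.of fun i j : Fin m => conjMatrix 0 i j) = 1 := by
      ext i j
      simp [conjMatrix, Matrix.one_apply, Fin.ext_iff]
    rw [this, Matrix.det_one, pow_zero]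
  | succ k ih =>
    obtain ⟨m, rfl⟩ : ∃ m', m = 2 + m' := ⟨m - 2, by omega⟩
    rw [← Matrix.det_submatrix_equiv_self finSumFinEquiv]
    have : (Matrix.of fun i j : Fin (2 + m) => conjMatrix (k + 1) i j).submatrix
        finSumFinEquiv finSumFinEquiv =
        Matrix.fromBlocks !![1, Complex.I; 1, -Complex.I] 0 0
          (Matrix.of fun i j : Fin m => conjMatrix k i j) := by
      ext i j
      rcases i with i | i <;> rcases j with j | j
      · fin_cases i <;> fin_cases j <;> simp [conjMatrix]
      · fin_cases i <;> simp [add_comm 2, conjMatrix]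
      · fin_cases j <;> simp [add_comm 2, conjMatrix]
      · simp [add_comm 2, conjMatrix]
    rw [this, Matrix.det_fromBlocks_zero₂₁, ih m (by omega), Matrix.det_fin_two, pow_succ']
    congr 1
    simp
    ring

theorem prod_conjSeq {R : Type*} [CommMonoid R] (k n : ℕ) (z : ℕ → ℂ) (t : ℕ → ℝ) (F : ℂ → R) :
    ∏ j ∈ Finset.range (2 * k + n), F (conjSeq k z t j) =
      (∏ i ∈ Finset.range k, (F (z i) * F (conj (z i)))) * ∏ j ∈ Finset.range n, F (t j) := by
  induction k generalizing z with
  | zero => simp [conjSeq]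
  | succ k ih =>
    have : 2 * (k + 1) + n = 2 * k + n + 1 + 1 := by ring
    rw [this, Finset.prod_range_succ', Finset.prod_range_succ', Finset.prod_range_succ' _ k]
    simp only [conjSeq]
    rw [ih]
    simp only [mul_assoc]
    congr 1
    rw [mul_comm, mul_comm (F (conj (z 0))), mul_assoc]

/-- The factor by which the Jacobian determinants of the coordinates of the `k`-th and the `0`-th
stratum differ. -/
noncomputable def stratumFactor (k n : ℕ) (z : ℕ → ℂ) (t : ℕ → ℝ) : ℝ :=
  (∏ i ∈ Finset.range k, 4 * (z i).im) *
    (∏ j ∈ Finset.range k, ∏ i ∈ Finset.range j, Complex.normSq (z i - conj (z j))) *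
    ∏ i ∈ Finset.range k, ∏ j ∈ Finset.range n, Complex.normSq (z i - t j)

/-- Each difference `z - conj z = 2i Im z` meets one factor `-2i` and gives `4 Im z`. The other
differences group under conjugation into `|z_i - z_j|² |z_i - conj z_j|²` and `|z_i - t_j|²`, so
that only the pairs of real entries can contribute a sign when all `Im z_i` are positive. -/
theorem prod_pairs_conjSeq (k n : ℕ) (z : ℕ → ℂ) (t : ℕ → ℝ) :
    (∏ j ∈ Finset.range (2 * k + n), ∏ i ∈ Finset.range j, (conjSeq k z t i - conjSeq k z t j)) *
      (-2 * Complex.I) ^ k =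
    ((stratumFactor k n z t *
      (∏ j ∈ Finset.range k, ∏ i ∈ Finset.range j, Complex.normSq (z i - z j)) *
      ∏ j ∈ Finset.range n, ∏ i ∈ Finset.range j, (t i - t j) : ℝ) : ℂ) := by
  induction k generalizing z with
  | zero => simp [conjSeq, stratumFactor]
  | succ k ih =>
    have hm : 2 * (k + 1) + n = 2 * k + n + 1 + 1 := by ring
    rw [hm, prod_pairs_succ, prod_pairs_succ, Finset.prod_range_succ']
    simp only [conjSeq]
    have h1 (a : ℂ) : ∏ j ∈ Finset.range (2 * k + n), (a - conjSeq k (fun j => z (j + 1)) t j) =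
        _ := prod_conjSeq k n _ t fun w => a - w
    rw [h1, h1]
    have h2 := ih fun j => z (j + 1)
    have h3 : stratumFactor (k + 1) n z t = 4 * (z 0).im *
        (∏ j ∈ Finset.range k, Complex.normSq (z 0 - conj (z (j + 1)))) *
        (∏ j ∈ Finset.range n, Complex.normSq (z 0 - t j)) *
        stratumFactor k n (fun j => z (j + 1)) t := by
      simp only [stratumFactor]
      rw [prod_pairs_succ, Finset.prod_range_succ', Finset.prod_range_succ' _ k]
      ring
    rw [h3, prod_pairs_succ]
    have h4 (a b : ℂ) : ((Complex.normSq (a - b) : ℝ) : ℂ) = (a - b) * (conj a - conj b) := by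
      rw [← map_sub, Complex.mul_conj]
    have h5 : z 0 - conj (z 0) = 2 * ((z 0).im : ℂ) * Complex.I := by
      rw [Complex.sub_conj]; push_cast; ring
    push_cast at h2 ⊢
    simp only [h4, Complex.conj_conj, Complex.conj_ofReal, Finset.prod_mul_distrib] at h2 ⊢
    rw [h5, pow_succ]
    -- The induction hypothesis is multiplied by all factors that involve `z 0` or its conjugate;
    -- the last term is the correction by `I ^ 2 = -1`.
    linear_combination (4 * ((z 0).im : ℂ) *
      (∏ x ∈ Finset.range k, (z 0 - (starRingEnd ℂ) (z (x + 1)))) *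
      (∏ x ∈ Finset.range k, ((starRingEnd ℂ) (z 0) - z (x + 1))) *
      (∏ x ∈ Finset.range n, (z 0 - t x)) *
      (∏ x ∈ Finset.range n, ((starRingEnd ℂ) (z 0) - t x)) *
      (∏ x ∈ Finset.range k, (z 0 - z (x + 1))) *
      (∏ x ∈ Finset.range k, ((starRingEnd ℂ) (z 0) - (starRingEnd ℂ) (z (x + 1))))) * h2 +
      (-4 * ((z 0).im : ℂ) *
      (∏ x ∈ Finset.range k, (z 0 - (starRingEnd ℂ) (z (x + 1)))) *
      (∏ x ∈ Finset.range k, ((starRingEnd ℂ) (z 0) - z (x + 1))) *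
      (∏ x ∈ Finset.range n, (z 0 - t x)) *
      (∏ x ∈ Finset.range n, ((starRingEnd ℂ) (z 0) - t x)) *
      (∏ x ∈ Finset.range k, (z 0 - z (x + 1))) *
      (∏ x ∈ Finset.range k, ((starRingEnd ℂ) (z 0) - (starRingEnd ℂ) (z (x + 1)))) *
      (∏ j ∈ Finset.range (2 * k + n), ∏ i ∈ Finset.range j,
        (conjSeq k (fun j => z (j + 1)) t i - conjSeq k (fun j => z (j + 1)) t j)) *
      (-2 * Complex.I) ^ k) * Complex.I_sq


/-- Extension of a finite sequence by zero. -/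
def extendZero {R : Type*} [Zero R] {n : ℕ} (a : Fin n → R) (i : ℕ) : R :=
  if h : i < n then a ⟨i, h⟩ else 0

@[simp]
theorem extendZero_val {R : Type*} [Zero R] {n : ℕ} (a : Fin n → R) (i : Fin n) :
    extendZero a i = a i := dif_pos i.2

theorem realSeq_eq (k : ℕ) (z : ℕ → ℂ) (t : ℕ → ℝ) (i : ℕ) : realSeq k z t i =
    if i < 2 * k then if i % 2 = 0 then (z (i / 2)).re else (z (i / 2)).im else t (i - 2 * k) := by
  induction k generalizing z i with
  | zero => simp [realSeq]
  | succ k ih =>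
    match i with
    | 0 => simp [realSeq]
    | 1 =>
      rw [realSeq, if_pos (by omega)]
      simp
    | i + 2 =>
      rw [realSeq, ih]
      have h1 : (i + 2) / 2 = i / 2 + 1 := by omega
      have h2 : (i + 2) % 2 = i % 2 := by omega
      have h3 : i + 2 - 2 * (k + 1) = i - 2 * k := by omega
      have h4 : i + 2 < 2 * (k + 1) ↔ i < 2 * k := by omega
      simp only [h1, h2, h3, h4]

theorem interleave_eq_realSeq {m k : ℕ} (a : Fin k → ℂ)
    (t : Fin (m - 2 * k) → ℝ) (i : Fin m) :
    interleave a t i = realSeq k (extendZero a) (extendZero t) i := by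
  rw [realSeq_eq, interleave]
  have hi := i.2
  split_ifs with h1 h2
  · rw [extendZero, dif_pos]
  · rw [extendZero, dif_pos]
  · rw [extendZero, dif_pos]

/-- `interleave` as a linear isomorphism. -/
noncomputable def interleaveLinearEquiv {m k : ℕ} (hk : 2 * k ≤ m) :
    ((Fin k → ℂ) × (Fin (m - 2 * k) → ℝ)) ≃ₗ[ℝ] (Fin m → ℝ) where
  toFun p := interleave p.1 p.2
  map_add' p q := by
    funext i
    simp only [interleave, Pi.add_apply, Prod.fst_add, Prod.snd_add]
    split_ifs <;> simp
  map_smul' c p := by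
    funext i
    simp only [interleave, Pi.smul_apply, Prod.smul_fst, Prod.smul_snd]
    split_ifs <;> simp
  invFun y := (fun i => ⟨y ⟨2 * i, by omega⟩, y ⟨2 * i + 1, by omega⟩⟩,
    fun j => y ⟨2 * k + j, by omega⟩)
  left_inv p := by
    refine Prod.ext (funext fun i => ?_) (funext fun j => ?_)
    · have hi := i.2
      have h1 : (2 * (i : ℕ) + 1) / 2 = i := by omega
      simp only [interleave]
      rw [dif_pos (by omega), dif_pos (by omega), if_pos (by omega), if_neg (by omega)]
      apply Complex.ext <;> simp [h1]
    · simp [interleave]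
  right_inv y := by
    funext i
    have hi := i.2
    simp only [interleave]
    split_ifs with h1 h2
    · exact congrArg y (Fin.ext (by dsimp only; omega))
    · exact congrArg y (Fin.ext (by dsimp only; omega))
    · exact congrArg y (Fin.ext (by dsimp only; omega))

/-- `interleave` as a continuous linear isomorphism. -/
noncomputable def interleaveEquiv {m k : ℕ} (hk : 2 * k ≤ m) :
    ((Fin k → ℂ) × (Fin (m - 2 * k) → ℝ)) ≃L[ℝ] (Fin m → ℝ) :=
  (interleaveLinearEquiv hk).toContinuousLinearEquiv

theorem interleaveEquiv_apply {m k : ℕ} (hk : 2 * k ≤ m)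
    (p : (Fin k → ℂ) × (Fin (m - 2 * k) → ℝ)) :
    interleaveEquiv hk p = interleave p.1 p.2 := rfl

/-- The real determinant of a complex linear map is `|det|²`, so the complex directions never change
the sign. -/
theorem det_interleaveEquiv_conj {m k : ℕ} (hk : 2 * k ≤ m) (A : (Fin k → ℂ) →L[ℂ] (Fin k → ℂ))
    (B : (Fin (m - 2 * k) → ℝ) →L[ℝ] (Fin (m - 2 * k) → ℝ)) :
    ((interleaveEquiv hk : _ →L[ℝ] (Fin m → ℝ)) ∘L ((A.restrictScalars ℝ).prodMap B) ∘L
      ((interleaveEquiv hk).symm : (Fin m → ℝ) →L[ℝ] _)).det = Complex.normSq A.det * B.det := by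
  have h1 := LinearMap.det_conj
    (((A : (Fin k → ℂ) →ₗ[ℂ] (Fin k → ℂ)).restrictScalars ℝ).prodMap
      (B : (Fin (m - 2 * k) → ℝ) →ₗ[ℝ] (Fin (m - 2 * k) → ℝ))) (interleaveLinearEquiv hk)
  rw [LinearMap.det_prodMap, LinearMap.det_restrictScalars] at h1
  rw [Algebra.norm_complex_apply] at h1
  exact h1

/-! ### Real multisets of roots -/

theorem esymm_map_ringHom {R S : Type*} [CommSemiring R] [CommSemiring S] (f : R →+* S)
    (M : Multiset R) (n : ℕ) : (M.map f).esymm n = f (M.esymm n) := by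
  rw [Multiset.esymm, Multiset.esymm, Multiset.powersetCard_map, Multiset.map_map,
    map_multiset_sum, Multiset.map_map]
  congr 1
  exact Multiset.map_congr rfl fun s _ => by simp [map_multiset_prod]

theorem coeffVec_map_conj {m : ℕ} (M : Multiset ℂ) :
    coeffVec m (M.map conj) = fun i => conj (coeffVec m M i) :=
  funext fun _ => esymm_map_ringHom (starRingEnd ℂ) M _

theorem ofReal_re_coeffVec {m : ℕ} {M : Multiset ℂ} (hM : M.map conj = M) (i : Fin m) :
    (((coeffVec m M i).re : ℝ) : ℂ) = coeffVec m M i := by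
  have := congrFun (coeffVec_map_conj (m := m) M) i
  rw [hM] at this
  exact Complex.conj_eq_iff_re.1 this.symm

theorem map_conj_eq_of_coeffVec {m : ℕ} {M : Multiset ℂ} (hc : M.card = m)
    (h : ∀ i, (coeffVec m M i).im = 0) : M.map conj = M := by
  refine coeffVec_injective (m := m) (by simpa using hc) hc ?_
  rw [coeffVec_map_conj]
  exact funext fun i => Complex.conj_eq_iff_im.2 (h i)

/-- The generating polynomial turns unions of multisets into products, which yields `esymm_add`. -/
theorem coeff_prod_one_add_C_mul_X (M : Multiset ℂ) (n : ℕ) :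
    ((M.map fun r => 1 + Polynomial.C r * Polynomial.X).prod).coeff n = M.esymm n := by
  induction M using Multiset.induction generalizing n with
  | empty => cases n with
    | zero => simp [Multiset.esymm]
    | succ n =>
      rw [Multiset.esymm, Multiset.powersetCard_eq_empty _ (by simp)]
      simp [Polynomial.coeff_one]
  | cons a M ih =>
    rw [Multiset.map_cons, Multiset.prod_cons, add_mul, one_mul, mul_assoc, Polynomial.coeff_add,
      Polynomial.coeff_C_mul, ih]
    cases n with
    | zero => simp [Multiset.esymm]
    | succ n =>
      rw [Polynomial.coeff_X_mul, ih]
      simp [Multiset.esymm, Multiset.powersetCard_cons, Multiset.sum_map_mul_left]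

theorem esymm_add (M N : Multiset ℂ) (n : ℕ) : (M + N).esymm n =
    ∑ p ∈ Finset.HasAntidiagonal.antidiagonal n, M.esymm p.1 * N.esymm p.2 := by
  rw [← coeff_prod_one_add_C_mul_X, Multiset.map_add, Multiset.prod_add, Polynomial.coeff_mul]
  simp only [coeff_prod_one_add_C_mul_X]

/-- The roots of `Q_a · conj Q_a · ∏ (X - t_j)`. -/
noncomputable def stratumRoots {m k : ℕ} (p : (Fin k → ℂ) × (Fin (m - 2 * k) → ℝ)) : Multiset ℂ :=
  (monicPoly p.1).roots + (monicPoly p.1).roots.map conj +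
    Finset.univ.val.map fun j => (p.2 j : ℂ)

/-- The coefficients of `Q_a · conj Q_a · ∏ (X - t_j)`. -/
noncomputable def stratumMap (m k : ℕ) (p : (Fin k → ℂ) × (Fin (m - 2 * k) → ℝ)) : Fin m → ℝ :=
  fun i => (coeffVec m (stratumRoots p) i).re

theorem stratumRoots_card {m k : ℕ} (hk : 2 * k ≤ m)
    (p : (Fin k → ℂ) × (Fin (m - 2 * k) → ℝ)) : (stratumRoots p).card = m := by
  simp only [stratumRoots, Multiset.card_add, Multiset.card_map, monicPoly_roots_card,
    Finset.card_val, Finset.card_univ, Fintype.card_fin]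
  omega

theorem stratumRoots_map_conj {m k : ℕ} (p : (Fin k → ℂ) × (Fin (m - 2 * k) → ℝ)) :
    (stratumRoots p).map conj = stratumRoots p := by
  simp only [stratumRoots, Multiset.map_add, Multiset.map_map, Function.comp_def,
    Complex.conj_conj, Complex.conj_ofReal, Multiset.map_id']
  rw [add_comm ((monicPoly p.1).roots)]

theorem ofReal_stratumMap {m k : ℕ} (p : (Fin k → ℂ) × (Fin (m - 2 * k) → ℝ)) (i : Fin m) :
    (stratumMap m k p i : ℂ) = coeffVec m (stratumRoots p) i :=
  ofReal_re_coeffVec (stratumRoots_map_conj p) i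

theorem contDiff_esymm_roots {k : ℕ} (n : ℕ) :
    ContDiff ℂ ω (fun a : Fin k → ℂ => (monicPoly a).roots.esymm n) := by
  rw [contDiff_iff_contDiffAt]
  intro a
  simpa using contDiffAt_esymm_roots isOpen_univ (f := id) differentiableOn_id
    (a₀ := a) (fun z _ => Set.mem_univ z) n

theorem contDiff_stratumMap (m k : ℕ) : ContDiff ℝ ω (stratumMap m k) := by
  rw [contDiff_pi]
  intro i
  refine Complex.reCLM.contDiff.comp ?_
  simp only [coeffVec, stratumRoots, esymm_add]
  have hroots (n : ℕ) : ContDiff ℝ ω (fun p : (Fin k → ℂ) × (Fin (m - 2 * k) → ℝ) =>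
      (monicPoly p.1).roots.esymm n) :=
    ((contDiff_esymm_roots n).restrict_scalars ℝ).comp contDiff_fst
  refine ContDiff.sum fun q _ => (ContDiff.sum fun q' _ => (hroots _).mul ?_).mul ?_
  · simp only [esymm_map_ringHom (starRingEnd ℂ)]
    exact Complex.conjCLE.contDiff.comp (hroots _)
  · simp only [Finset.esymm_map_val]
    refine ContDiff.sum fun s _ => contDiff_prod fun j _ => ?_
    exact Complex.ofRealCLM.contDiff.comp ((contDiff_apply ℝ ℝ j).comp contDiff_snd)

theorem map_univ_conjSeq {m k : ℕ} (hk : 2 * k ≤ m) (z : Fin k → ℂ) (t : Fin (m - 2 * k) → ℝ) :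
    (Finset.univ.val.map fun i : Fin m => conjSeq k (extendZero z) (extendZero t) i) =
      stratumRoots (rootMap k z, t) := by
  have hsum (n : ℕ) (f : Fin n → ℂ) : Finset.univ.val.map f = ∑ i, {f i} := by
    rw [Finset.sum, ← Function.comp_def (fun x => ({x} : Multiset ℂ)) f, ← Multiset.map_map,
      Multiset.sum_map_singleton]
  -- The product formula is applied to singletons in the additive monoid of multisets, written
  -- multiplicatively.
  have h := congrArg Multiplicative.toAdd (prod_conjSeq k (m - 2 * k) (extendZero z)
    (extendZero t) (fun w => Multiplicative.ofAdd ({w} : Multiset ℂ)))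
  rw [Nat.add_sub_cancel' hk, Finset.prod_mul_distrib] at h
  simp only [toAdd_mul, toAdd_prod, toAdd_ofAdd] at h
  rw [stratumRoots, roots_monicPoly_rootMap, Multiset.map_map, hsum, hsum, hsum, hsum]
  rw [← Fin.sum_univ_eq_sum_range (fun i => ({conjSeq k (extendZero z) (extendZero t) i} :
    Multiset ℂ)), ← Fin.sum_univ_eq_sum_range (fun i => ({extendZero z i} : Multiset ℂ)),
    ← Fin.sum_univ_eq_sum_range (fun i => ({conj (extendZero z i)} : Multiset ℂ)),
    ← Fin.sum_univ_eq_sum_range (fun i => ({((extendZero t i : ℝ) : ℂ)} : Multiset ℂ))] at h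
  simpa using h

/-- The map from `(z, t)` to the coefficients of the real polynomial is computed in two ways.
Through the coefficients of `Q` its determinant is the wanted one times `|det|²` of `rootMap k`.
Through the full list of complex roots it is the determinant of `rootMap m` times `(-2i)^k`. Both
root maps have Vandermonde determinants, and the quotient is the claim. -/
theorem det_fderiv_stratumMap_of_injective {m k : ℕ} (hk : 2 * k ≤ m) {z : Fin k → ℂ}
    (hz : Function.Injective z) (t : Fin (m - 2 * k) → ℝ)
    (hinj : Function.Injective fun i : Fin m => conjSeq k (extendZero z) (extendZero t) i) :
    (fderiv ℝ (stratumMap m k ∘ (interleaveEquiv hk).symm)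
      (interleaveEquiv hk (rootMap k z, t))).det =
    stratumFactor k (m - 2 * k) (extendZero z) (extendZero t) *
      ∏ i, ∏ j ∈ Finset.Ioi i, (t i - t j) := by
  let Λ := interleaveEquiv hk
  -- The real linear map from the real coordinates of `(z, t)` to the list of roots `z_i`, `conj
  -- z_i`, `t_j`.
  let B : (Fin m → ℝ) →L[ℝ] (Fin m → ℂ) := LinearMap.toContinuousLinearMap
    (((Matrix.of fun i j : Fin m => conjMatrix k i j).mulVecLin.restrictScalars ℝ) ∘ₗ
      (LinearMap.pi fun i : Fin m => Complex.ofRealLI.toLinearMap ∘ₗ LinearMap.proj i))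
  have hB (w : Fin k → ℂ) (s : Fin (m - 2 * k) → ℝ) : B (Λ (w, s)) =
      fun i : Fin m => conjSeq k (extendZero w) (extendZero s) i := by
    funext i
    rw [← sum_conjMatrix_mul_realSeq k (m - 2 * k) _ _ _ (by omega), Nat.add_sub_cancel' hk,
      ← Fin.sum_univ_eq_sum_range (fun j => conjMatrix k i j *
        ((realSeq k (extendZero w) (extendZero s) j : ℝ) : ℂ))]
    change ∑ j : Fin m, conjMatrix k i j * ((Λ (w, s) j : ℝ) : ℂ) = _
    simp only [Λ, interleaveEquiv_apply, interleave_eq_realSeq]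
  -- From the real coordinates of `(z, t)` to the real coefficients; `hH` identifies it with
  -- `rootMap m ∘ B`.
  let H : (Fin m → ℝ) → (Fin m → ℝ) :=
    (stratumMap m k ∘ Λ.symm) ∘ (Λ ∘ Prod.map (rootMap k) id ∘ Λ.symm)
  have hH (y : Fin m → ℝ) (i : Fin m) : ((H y i : ℝ) : ℂ) = rootMap m (B y) i := by
    obtain ⟨⟨w, s⟩, rfl⟩ := Λ.surjective y
    simp only [H, Function.comp_apply, ContinuousLinearEquiv.symm_apply_apply, Prod.map_apply, id]
    rw [ofReal_stratumMap, hB, ← map_univ_conjSeq hk, rootMap]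
  set y₀ := Λ (z, t)
  have hE : HasFDerivAt (rootMap k) (fderiv ℂ (rootMap k) z) z :=
    ((contDiff_rootMap (n := 1) k).differentiable one_ne_zero z).hasFDerivAt
  have hd1 : HasFDerivAt (Λ ∘ Prod.map (rootMap k) id ∘ Λ.symm)
      ((Λ : _ →L[ℝ] (Fin m → ℝ)) ∘L
        (((fderiv ℂ (rootMap k) z).restrictScalars ℝ).prodMap
          (ContinuousLinearMap.id ℝ (Fin (m - 2 * k) → ℝ))) ∘L
        (Λ.symm : (Fin m → ℝ) →L[ℝ] _)) y₀ := by
    refine Λ.hasFDerivAt.comp _ (HasFDerivAt.comp _ ?_ Λ.symm.hasFDerivAt)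
    simp only [y₀, ContinuousLinearEquiv.symm_apply_apply]
    exact HasFDerivAt.prodMap (p := (z, t)) (hE.restrictScalars ℝ) (hasFDerivAt_id t)
  have hG : ContDiff ℝ 1 (stratumMap m k ∘ Λ.symm) :=
    ((contDiff_stratumMap m k).of_le le_top).comp Λ.symm.contDiff
  have hd2 := (hG.differentiable one_ne_zero
    ((Λ ∘ Prod.map (rootMap k) id ∘ Λ.symm) y₀)).hasFDerivAt
  have hd3 := hd2.comp y₀ hd1
  have hpt : (Λ ∘ Prod.map (rootMap k) id ∘ Λ.symm) y₀ = Λ (rootMap k z, t) := by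
    simp [y₀]
  rw [hpt] at hd3
  set D := fderiv ℝ (stratumMap m k ∘ Λ.symm) (Λ (rootMap k z, t)) with hD
  set H' := D ∘L ((Λ : _ →L[ℝ] (Fin m → ℝ)) ∘L
        (((fderiv ℂ (rootMap k) z).restrictScalars ℝ).prodMap
          (ContinuousLinearMap.id ℝ (Fin (m - 2 * k) → ℝ))) ∘L
        (Λ.symm : (Fin m → ℝ) →L[ℝ] _)) with hH'
  have hdet1 : H'.det = D.det * Complex.normSq (fderiv ℂ (rootMap k) z).det := by
    have h2 := det_interleaveEquiv_conj hk (fderiv ℂ (rootMap k) z)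
      (ContinuousLinearMap.id ℝ (Fin (m - 2 * k) → ℝ))
    have h3 : (ContinuousLinearMap.id ℝ (Fin (m - 2 * k) → ℝ)).det = 1 := LinearMap.det_id
    rw [h3, mul_one] at h2
    rw [← h2]
    exact LinearMap.det_comp _ _
  have hEm : HasFDerivAt (rootMap m) (fderiv ℂ (rootMap m) (B y₀)) (B y₀) :=
    ((contDiff_rootMap (n := 1) m).differentiable one_ne_zero _).hasFDerivAt
  have hd4 := (hEm.restrictScalars ℝ).comp y₀ B.hasFDerivAt
  have hentry (v : Fin m → ℝ) (i : Fin m) :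
      ((H' v i : ℝ) : ℂ) = fderiv ℂ (rootMap m) (B y₀) (B v) i := by
    have h5 : HasFDerivAt (fun y => ((H y i : ℝ) : ℂ))
        (Complex.ofRealCLM ∘L (ContinuousLinearMap.proj i ∘L H')) y₀ :=
      Complex.ofRealCLM.hasFDerivAt.comp y₀ ((hasFDerivAt_pi'.1 hd3) i)
    have h6 := (hasFDerivAt_pi'.1 hd4) i
    have h7 : (fun y => ((H y i : ℝ) : ℂ)) = fun y => (rootMap m ∘ B) y i :=
      funext fun y => hH y i
    rw [h7] at h5
    exact congrArg (fun F : (Fin m → ℝ) →L[ℝ] ℂ => F v) (h5.unique h6)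
  have hmat : (LinearMap.toMatrix' (H' : (Fin m → ℝ) →ₗ[ℝ] (Fin m → ℝ))).map (Complex.ofRealHom) =
      LinearMap.toMatrix' (fderiv ℂ (rootMap m) (B y₀) : (Fin m → ℂ) →ₗ[ℂ] (Fin m → ℂ)) *
        Matrix.of fun i j : Fin m => conjMatrix k i j := by
    ext i j
    rw [Matrix.map_apply, LinearMap.toMatrix'_apply, Matrix.mul_apply]
    refine (hentry _ i).trans ?_
    have hBj : B (Pi.single j 1) = fun l : Fin m => conjMatrix k l j := by
      funext l
      change ∑ j' : Fin m, conjMatrix k l j' * ((Pi.single j (1 : ℝ) : Fin m → ℝ) j' : ℂ) = _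
      rw [Finset.sum_eq_single j]
      · simp
      · intro b _ hb
        simp [hb]
      · simp
    have hB2 : B (Pi.single j 1) = ∑ l : Fin m, conjMatrix k l j • (Pi.single l (1 : ℂ)) := by
      rw [hBj]
      funext l
      simp [Pi.single_apply]
    rw [hB2, map_sum]
    simp only [map_smul, Finset.sum_apply, Pi.smul_apply, smul_eq_mul, LinearMap.toMatrix'_apply,
      Matrix.of_apply]
    refine Finset.sum_congr rfl fun l _ => ?_
    rw [mul_comm]
    rfl
  have hdet2 : ((H'.det : ℝ) : ℂ) = (fderiv ℂ (rootMap m) (B y₀)).det * (-2 * Complex.I) ^ k := by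
    have := congrArg Matrix.det hmat
    rw [Matrix.det_mul, det_conjMatrix k m hk, LinearMap.det_toMatrix'] at this
    refine Eq.trans ?_ this
    have h9 := RingHom.map_det Complex.ofRealHom
      (LinearMap.toMatrix' (H' : (Fin m → ℝ) →ₗ[ℝ] (Fin m → ℝ)))
    rw [LinearMap.det_toMatrix'] at h9
    exact h9
  rw [hB, det_fderiv_rootMap hinj, prod_Ioi_eq_prod_range m fun i j =>
    conjSeq k (extendZero z) (extendZero t) i - conjSeq k (extendZero z) (extendZero t) j] at hdet2
  have h10 := prod_pairs_conjSeq k (m - 2 * k) (extendZero z) (extendZero t)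
  rw [Nat.add_sub_cancel' hk] at h10
  rw [h10, Complex.ofReal_inj] at hdet2
  have h11 : Complex.normSq (fderiv ℂ (rootMap k) z).det = ∏ j ∈ Finset.range k,
      ∏ i ∈ Finset.range j, Complex.normSq (extendZero z i - extendZero z j) := by
    rw [det_fderiv_rootMap hz, map_prod, ← prod_Ioi_eq_prod_range k fun i j =>
      Complex.normSq (extendZero z i - extendZero z j)]
    simp [map_prod]
  have h12 : Complex.normSq (fderiv ℂ (rootMap k) z).det ≠ 0 := by
    rw [det_fderiv_rootMap hz, Ne, map_eq_zero]
    exact Finset.prod_ne_zero_iff.2 fun i _ => Finset.prod_ne_zero_iff.2 fun j hj =>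
      sub_ne_zero.2 fun h => (Finset.mem_Ioi.1 hj).ne (hz h)
  have h13 : ∏ i, ∏ j ∈ Finset.Ioi i, (t i - t j) = ∏ j ∈ Finset.range (m - 2 * k),
      ∏ i ∈ Finset.range j, (extendZero t i - extendZero t j) := by
    rw [← prod_Ioi_eq_prod_range (m - 2 * k) fun i j => extendZero t i - extendZero t j]
    simp
  rw [hdet1, ← h11] at hdet2
  rw [h13]
  apply mul_right_cancel₀ h12
  rw [hdet2]
  ring


theorem stratumFactor_pos {k n : ℕ} {z : ℕ → ℂ} (t : ℕ → ℝ) (hz : ∀ i < k, 0 < (z i).im) :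
    0 < stratumFactor k n z t := by
  refine mul_pos (mul_pos ?_ ?_) ?_
  · exact Finset.prod_pos fun i hi => mul_pos (by norm_num) (hz i (Finset.mem_range.1 hi))
  · refine Finset.prod_pos fun j hj => Finset.prod_pos fun i hi => Complex.normSq_pos.2 ?_
    have hj := Finset.mem_range.1 hj
    have hi := Finset.mem_range.1 hi
    intro h
    have h1 := congrArg Complex.im h
    simp only [Complex.sub_im, Complex.conj_im, Complex.zero_im] at h1
    linarith [hz j hj, hz i (hi.trans hj)]
  · refine Finset.prod_pos fun i hi => Finset.prod_pos fun j _ => Complex.normSq_pos.2 ?_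
    intro h
    have h1 := congrArg Complex.im h
    simp only [Complex.sub_im, Complex.ofReal_im, Complex.zero_im] at h1
    linarith [hz i (Finset.mem_range.1 hi)]

theorem injective_of_prod_pairs_ne_zero {R : Type*} [CommRing R] [IsDomain R] {m : ℕ} {f : ℕ → R}
    (h : ∏ j ∈ Finset.range m, ∏ i ∈ Finset.range j, (f i - f j) ≠ 0) :
    Function.Injective fun i : Fin m => f i := by
  have key (i j : Fin m) (hij : i < j) : f i ≠ f j := by
    rw [Finset.prod_ne_zero_iff] at h
    have := h j (Finset.mem_range.2 j.2)
    rw [Finset.prod_ne_zero_iff] at this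
    exact sub_ne_zero.1 (this i (Finset.mem_range.2 hij))
  intro i j hij
  by_contra hne
  rcases lt_or_gt_of_ne hne with h1 | h1
  · exact key i j h1 hij
  · exact key j i h1 hij.symm

theorem prod_pairs_ne_zero {R : Type*} [CommRing R] [IsDomain R] {m : ℕ} {f : Fin m → R}
    (hf : Function.Injective f) :
    ∏ i, ∏ j ∈ Finset.Ioi i, (f i - f j) ≠ 0 :=
  Finset.prod_ne_zero_iff.2 fun _ _ => Finset.prod_ne_zero_iff.2 fun _ hj =>
    sub_ne_zero.2 fun h => (Finset.mem_Ioi.1 hj).ne (hf h)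

/-- Distinctness is read off from the product formula, whose right-hand side does not vanish. -/
theorem conjSeq_injective {m k : ℕ} (hk : 2 * k ≤ m) {z : Fin k → ℂ} {t : Fin (m - 2 * k) → ℝ}
    (hz : Function.Injective z) (ht : Function.Injective t) (him : ∀ i, 0 < (z i).im) :
    Function.Injective fun i : Fin m => conjSeq k (extendZero z) (extendZero t) i := by
  apply injective_of_prod_pairs_ne_zero
  have h := prod_pairs_conjSeq k (m - 2 * k) (extendZero z) (extendZero t)
  rw [Nat.add_sub_cancel' hk] at h
  refine left_ne_zero_of_mul (b := (-2 * Complex.I) ^ k) ?_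
  rw [h, Complex.ofReal_ne_zero]
  refine mul_ne_zero (mul_ne_zero (stratumFactor_pos _ fun i hi => ?_).ne' ?_) ?_
  · have := him ⟨i, hi⟩
    rwa [← extendZero_val z ⟨i, hi⟩] at this
  · rw [← prod_Ioi_eq_prod_range k fun i j => Complex.normSq (extendZero z i - extendZero z j)]
    simp only [extendZero_val, ← map_prod]
    exact (map_ne_zero _).2 (prod_pairs_ne_zero hz)
  · rw [← prod_Ioi_eq_prod_range (m - 2 * k) fun i j => extendZero t i - extendZero t j]
    simp only [extendZero_val]
    exact prod_pairs_ne_zero ht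

theorem continuous_extendZero {R : Type*} [Zero R] [TopologicalSpace R] {n : ℕ} (i : ℕ) :
    Continuous fun a : Fin n → R => extendZero a i := by
  unfold extendZero
  split_ifs <;> fun_prop

/-- Both sides are continuous in `z`, so the case of distinct `z i` extends to coinciding ones.
These must be included because a stratum allows repeated points off the fixed curve. -/
theorem det_fderiv_stratumMap {m k : ℕ} (hk : 2 * k ≤ m) {z : Fin k → ℂ}
    {t : Fin (m - 2 * k) → ℝ} (ht : Function.Injective t) (him : ∀ i, 0 < (z i).im) :
    (fderiv ℝ (stratumMap m k ∘ (interleaveEquiv hk).symm)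
      (interleaveEquiv hk (rootMap k z, t))).det =
    stratumFactor k (m - 2 * k) (extendZero z) (extendZero t) *
      ∏ i, ∏ j ∈ Finset.Ioi i, (t i - t j) := by
  -- Distinct real shifts separate coinciding entries and keep the imaginary parts. For each pair of
  -- indices at most one value of `ε` has to be avoided.
  let p (ε : ℝ) : Fin k → ℂ := fun i => z i + ((ε * (i : ℕ) : ℝ) : ℂ)
  have hp : Continuous p := by fun_prop
  have hp0 : p 0 = z := by simp [p]
  have hpim (ε i) : (p ε i).im = (z i).im := by simp [p]
  have hinj : ∀ᶠ ε : ℝ in 𝓝[>] 0, Function.Injective (p ε) := by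
    have h1 : ∀ᶠ ε : ℝ in 𝓝[>] 0, ∀ i j : Fin k, i ≠ j → p ε i ≠ p ε j := by
      refine Filter.eventually_all.2 fun i => Filter.eventually_all.2 fun j => ?_
      by_cases hij : i = j
      · simp [hij]
      have hij' : ((i : ℕ) : ℝ) - ((j : ℕ) : ℝ) ≠ 0 := by
        rw [sub_ne_zero]
        exact_mod_cast fun h => hij (Fin.ext h)
      have h2 : ∀ᶠ ε : ℝ in 𝓝[>] 0,
          ε ≠ ((z j).re - (z i).re) / (((i : ℕ) : ℝ) - ((j : ℕ) : ℝ)) := by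
        by_cases h0 : ((z j).re - (z i).re) / (((i : ℕ) : ℝ) - ((j : ℕ) : ℝ)) = 0
        · rw [h0]
          filter_upwards [self_mem_nhdsWithin] with ε hε using ne_of_gt hε
        · exact nhdsWithin_le_nhds (isOpen_ne.mem_nhds (Ne.symm h0))
      filter_upwards [h2] with ε hε _ h
      apply hε
      have := congrArg Complex.re h
      simp only [p, Complex.add_re, Complex.ofReal_re] at this
      rw [eq_div_iff hij']
      linarith
    filter_upwards [h1] with ε hε i j hij
    by_contra hne
    exact hε i j hne hij
  have hG : ContDiff ℝ 1 (stratumMap m k ∘ (interleaveEquiv hk).symm) :=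
    ((contDiff_stratumMap m k).of_le le_top).comp (interleaveEquiv hk).symm.contDiff
  have hL : Continuous fun ε => (fderiv ℝ (stratumMap m k ∘ (interleaveEquiv hk).symm)
      (interleaveEquiv hk (rootMap k (p ε), t))).det := by
    refine ContinuousLinearMap.continuous_det.comp ((hG.continuous_fderiv one_ne_zero).comp ?_)
    exact (interleaveEquiv hk).continuous.comp
      (((continuous_rootMap k).comp hp).prodMk continuous_const)
  have hR : Continuous fun ε =>
      stratumFactor k (m - 2 * k) (extendZero (p ε)) (extendZero t) *
        ∏ i, ∏ j ∈ Finset.Ioi i, (t i - t j) := by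
    have hc (i : ℕ) : Continuous fun ε => extendZero (p ε) i := (continuous_extendZero i).comp hp
    unfold stratumFactor
    fun_prop
  have h1 := (hL.tendsto 0).mono_left (nhdsWithin_le_nhds (s := Set.Ioi 0))
  have h2 := (hR.tendsto 0).mono_left (nhdsWithin_le_nhds (s := Set.Ioi 0))
  rw [hp0] at h1 h2
  refine tendsto_nhds_unique h1 (h2.congr' ?_)
  filter_upwards [hinj] with ε hε
  refine (det_fderiv_stratumMap_of_injective hk hε t ?_).symm
  exact conjSeq_injective hk hε ht fun i => by rw [hpim]; exact him i

/-- All `n(n-1)/2` factors are negative. -/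
theorem prod_pairs_sign {n : ℕ} {t : Fin n → ℝ} (ht : StrictMono t) :
    0 < (-1) ^ (n * (n - 1) / 2) * ∏ i, ∏ j ∈ Finset.Ioi i, (t i - t j) := by
  have h1 : ((-1) ^ (n * (n - 1) / 2) : ℝ) = ∏ i : Fin n, ∏ j ∈ Finset.Ioi i, (-1) := by
    rw [prod_Ioi_eq_prod_range n fun _ _ => (-1 : ℝ)]
    simp only [Finset.prod_const, Finset.card_range]
    rw [Finset.prod_pow_eq_pow_sum, Finset.sum_range_id]
  rw [h1, ← Finset.prod_mul_distrib]
  refine Finset.prod_pos fun i _ => ?_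
  rw [← Finset.prod_mul_distrib]
  refine Finset.prod_pos fun j hj => ?_
  have := ht (Finset.mem_Ioi.1 hj)
  linarith

/-- The sign of the Jacobian determinant of the multiplication of polynomials. -/
theorem det_fderiv_stratumMap_sign {m k : ℕ} (hk : 2 * k ≤ m) {a : Fin k → ℂ}
    {t : Fin (m - 2 * k) → ℝ} (ha : ∀ z ∈ (monicPoly a).roots, 0 < z.im) (ht : StrictMono t) :
    0 < (-1) ^ ((m - 2 * k) * (m - 2 * k - 1) / 2) *
      (fderiv ℝ (stratumMap m k ∘ (interleaveEquiv hk).symm) (interleaveEquiv hk (a, t))).det := by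
  obtain ⟨z, rfl⟩ := rootMap_surjective k a
  rw [roots_monicPoly_rootMap] at ha
  have hz (i) : 0 < (z i).im := ha _ (by simp)
  rw [det_fderiv_stratumMap hk ht.injective hz, mul_left_comm]
  refine mul_pos (stratumFactor_pos _ fun i hi => ?_) (prod_pairs_sign ht)
  simpa [extendZero, hi] using hz ⟨i, hi⟩


/-! ### Monotone arcs in a one-dimensional manifold -/

/-- The same local coordinates with the reversed direction. -/
def reverseCharts {S : Type*} (F : Set (Set S × (S → ℝ))) : Set (Set S × (S → ℝ)) :=
  (fun φ => (φ.1, -φ.2)) '' F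

theorem reverseCharts_reverseCharts {S : Type*} (F : Set (Set S × (S → ℝ))) :
    reverseCharts (reverseCharts F) = F := by
  simp [reverseCharts, Set.image_image]

section Arcs

variable {S : Type*} [TopologicalSpace S]

/-- There is an arc in `X` from `c` to `c'` along which the functions `u` of all the local
coordinates `(U, u) ∈ F` increase. -/
def MonoArc (X : Set S) (F : Set (Set S × (S → ℝ))) (c c' : S) : Prop :=
  ∃ γ : ℝ → S, ContinuousOn γ (Set.Icc 0 1) ∧ γ 0 = c ∧ γ 1 = c' ∧
    (∀ t ∈ Set.Icc (0 : ℝ) 1, γ t ∈ X) ∧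
    ∀ φ ∈ F, ∀ s t : ℝ, 0 ≤ s → s < t → t ≤ 1 →
      (∀ r ∈ Set.Icc s t, γ r ∈ φ.1) → φ.2 (γ s) < φ.2 (γ t)

/-- The coordinate `u` identifies `X ∩ U` with an interval, and segments of this interval are
monotone arcs. -/
structure IsArcChart (X : Set S) (F : Set (Set S × (S → ℝ))) (U : Set S) (u : S → ℝ) : Prop where
  mem : (U, u) ∈ F
  isOpen : IsOpen U
  continuousOn : ContinuousOn u U
  exists_inverse : ∃ v : ℝ → S, ContinuousOn v (u '' (X ∩ U)) ∧ ∀ x ∈ X ∩ U, v (u x) = x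
  ordConnected : (u '' (X ∩ U)).OrdConnected
  monoArc : ∀ x ∈ X ∩ U, ∀ y ∈ X ∩ U, u x < u y → MonoArc X F x y

variable {X : Set S} {F : Set (Set S × (S → ℝ))}

theorem MonoArc.left_mem {c c' : S} (h : MonoArc X F c c') : c ∈ X := by
  obtain ⟨γ, -, h0, -, hX, -⟩ := h
  exact h0 ▸ hX 0 (by simp)

theorem MonoArc.right_mem {c c' : S} (h : MonoArc X F c c') : c' ∈ X := by
  obtain ⟨γ, -, -, h1, hX, -⟩ := h
  exact h1 ▸ hX 1 (by simp)

theorem MonoArc.reverse {c c' : S} (h : MonoArc X F c c') : MonoArc X (reverseCharts F) c' c := by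
  obtain ⟨γ, hc, h0, h1, hX, hm⟩ := h
  refine ⟨fun t => γ (1 - t), hc.comp (by fun_prop) fun t ht => ?_, by simpa, by simpa,
    fun t ht => hX _ ?_, ?_⟩
  · exact ⟨by linarith [ht.2], by linarith [ht.1]⟩
  · exact ⟨by linarith [ht.2], by linarith [ht.1]⟩
  · rintro _ ⟨φ, hφ, rfl⟩ s t hs hst ht hr
    have := hm φ hφ (1 - t) (1 - s) (by linarith) (by linarith) (by linarith) fun r hr' => by
      simpa using hr (1 - r) ⟨by linarith [hr'.2], by linarith [hr'.1]⟩
    simpa using this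

theorem monoArc_reverse_iff {c c' : S} : MonoArc X (reverseCharts F) c' c ↔ MonoArc X F c c' :=
  ⟨fun h => by simpa only [reverseCharts_reverseCharts] using h.reverse, fun h => h.reverse⟩

theorem IsArcChart.reverse {U : Set S} {u : S → ℝ} (h : IsArcChart X F U u) :
    IsArcChart X (reverseCharts F) U (-u) where
  mem := ⟨_, h.mem, rfl⟩
  isOpen := h.isOpen
  continuousOn := h.continuousOn.neg
  exists_inverse := by
    obtain ⟨v, hv, hvu⟩ := h.exists_inverse
    refine ⟨fun t => v (-t), hv.comp (by fun_prop) ?_, fun x hx => by simpa using hvu x hx⟩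
    rintro _ ⟨x, hx, rfl⟩
    exact ⟨x, hx, by simp⟩
  ordConnected := by
    have : (-u) '' (X ∩ U) = Neg.neg ⁻¹' (u '' (X ∩ U)) := by
      ext t
      simp only [Set.mem_image, Set.mem_preimage, Pi.neg_apply, neg_eq_iff_eq_neg]
    rw [this]
    refine ⟨fun a ha b hb c hc => ?_⟩
    exact h.ordConnected.out hb ha ⟨neg_le_neg hc.2, neg_le_neg hc.1⟩
  monoArc x hx y hy hxy := (h.monoArc y hy x hx (by simpa using hxy)).reverse

theorem MonoArc.restrict {γ : ℝ → S} (hc : ContinuousOn γ (Set.Icc 0 1))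
    (hX : ∀ t ∈ Set.Icc (0 : ℝ) 1, γ t ∈ X)
    (hm : ∀ φ ∈ F, ∀ s t : ℝ, 0 ≤ s → s < t → t ≤ 1 →
      (∀ r ∈ Set.Icc s t, γ r ∈ φ.1) → φ.2 (γ s) < φ.2 (γ t))
    {a b : ℝ} (ha : 0 ≤ a) (hab : a < b) (hb : b ≤ 1) : MonoArc X F (γ a) (γ b) := by
  have hmap {t : ℝ} (ht : t ∈ Set.Icc (0 : ℝ) 1) : a + t * (b - a) ∈ Set.Icc (0 : ℝ) 1 :=
    ⟨by nlinarith [ht.1], by nlinarith [ht.2]⟩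
  refine ⟨fun t => γ (a + t * (b - a)), hc.comp (by fun_prop) fun t ht => hmap ht, by simp,
    by simp, fun t ht => hX _ (hmap ht), fun φ hφ s t hs hst ht hr => ?_⟩
  refine hm φ hφ _ _ (hmap ⟨hs, by linarith⟩).1 (by nlinarith) (hmap ⟨by linarith, ht⟩).2
    fun r hr' => ?_
  have h := hr ((r - a) / (b - a)) ⟨?_, ?_⟩
  · beta_reduce at h
    rwa [div_mul_cancel₀ _ (by linarith : b - a ≠ 0), add_sub_cancel] at h
  · rw [le_div_iff₀ (by linarith)]
    linarith [hr'.1]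
  · rw [div_le_iff₀ (by linarith)]
    linarith [hr'.2]

theorem MonoArc.trans {c c' c'' : S} (h : MonoArc X F c c') (h' : MonoArc X F c' c'') :
    MonoArc X F c c'' := by
  obtain ⟨γ, hc, h0, h1, hX, hm⟩ := h
  obtain ⟨γ', hc', h0', h1', hX', hm'⟩ := h'
  let δ : ℝ → S := fun t => if t ≤ 1 / 2 then γ (2 * t) else γ' (2 * t - 1)
  have hδ1 {t : ℝ} (ht : t ≤ 1 / 2) : δ t = γ (2 * t) := if_pos ht
  have hδ2 {t : ℝ} (ht : 1 / 2 ≤ t) : δ t = γ' (2 * t - 1) := by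
    rcases ht.eq_or_lt with rfl | ht
    · rw [hδ1 le_rfl]
      norm_num [h1, h0']
    · exact if_neg (not_le.2 ht)
  refine ⟨δ, ?_, ?_, ?_, fun t ht => ?_, fun φ hφ s t hs hst ht hr => ?_⟩
  · have : Set.Icc (0 : ℝ) 1 = Set.Icc 0 (1 / 2) ∪ Set.Icc (1 / 2) 1 :=
      (Set.Icc_union_Icc_eq_Icc (by norm_num) (by norm_num)).symm
    rw [this]
    refine ContinuousOn.union_of_isClosed ?_ ?_ isClosed_Icc isClosed_Icc
    · refine ContinuousOn.congr (hc.comp (f := fun t : ℝ => 2 * t) (by fun_prop) fun t ht => ?_)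
        fun t ht => hδ1 ht.2
      exact ⟨by linarith [ht.1], by linarith [ht.2]⟩
    · refine ContinuousOn.congr (hc'.comp (f := fun t : ℝ => 2 * t - 1) (by fun_prop)
        fun t ht => ?_) fun t ht => hδ2 ht.1
      exact ⟨by linarith [ht.1], by linarith [ht.2]⟩
  · rw [hδ1 (by norm_num), mul_zero, h0]
  · rw [hδ2 (by norm_num), ← h1']
    norm_num
  · rcases le_total t (1 / 2) with h | h
    · rw [hδ1 h]
      exact hX _ ⟨by linarith [ht.1], by linarith⟩
    · rw [hδ2 h]
      exact hX' _ ⟨by linarith, by linarith [ht.2]⟩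
  · have left {s t : ℝ} (hs : 0 ≤ s) (hst : s < t) (ht : t ≤ 1 / 2)
        (hr : ∀ r ∈ Set.Icc s t, δ r ∈ φ.1) : φ.2 (δ s) < φ.2 (δ t) := by
      rw [hδ1 ht, hδ1 (hst.le.trans ht)]
      refine hm φ hφ _ _ (by linarith) (by linarith) (by linarith) fun r hr' => ?_
      have := hr (r / 2) ⟨by linarith [hr'.1], by linarith [hr'.2]⟩
      rwa [hδ1 (by linarith [hr'.2]), mul_div_cancel₀ _ (by norm_num)] at this
    have right {s t : ℝ} (hs : 1 / 2 ≤ s) (hst : s < t) (ht : t ≤ 1)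
        (hr : ∀ r ∈ Set.Icc s t, δ r ∈ φ.1) : φ.2 (δ s) < φ.2 (δ t) := by
      rw [hδ2 hs, hδ2 (hs.trans hst.le)]
      refine hm' φ hφ _ _ (by linarith) (by linarith) (by linarith) fun r hr' => ?_
      have := hr ((r + 1) / 2) ⟨by linarith [hr'.1], by linarith [hr'.2]⟩
      rwa [hδ2 (by linarith [hr'.1]), mul_div_cancel₀ _ (by norm_num), add_sub_cancel_right] at this
    rcases le_or_gt t (1 / 2) with h | h
    · exact left hs hst h hr
    rcases le_or_gt (1 / 2) s with h' | h'
    · exact right h' hst ht hr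
    exact (left hs h' le_rfl fun r hr' => hr r ⟨hr'.1, hr'.2.trans h.le⟩).trans
      (right le_rfl h ht fun r hr' => hr r ⟨h'.le.trans hr'.1, hr'.2⟩)

theorem IsArcChart.injOn {U : Set S} {u : S → ℝ} (h : IsArcChart X F U u) :
    Set.InjOn u (X ∩ U) := by
  obtain ⟨v, -, hv⟩ := h.exists_inverse
  intro x hx y hy hxy
  rw [← hv x hx, hxy, hv y hy]

/-- Any two points in the domain of a coordinate are comparable. -/
theorem IsArcChart.trichotomy {U : Set S} {u : S → ℝ} (h : IsArcChart X F U u) {x y : S}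
    (hx : x ∈ X ∩ U) (hy : y ∈ X ∩ U) : MonoArc X F x y ∨ x = y ∨ MonoArc X F y x := by
  rcases lt_trichotomy (u x) (u y) with hlt | heq | hgt
  · exact .inl (h.monoArc x hx y hy hlt)
  · exact .inr (.inl (h.injOn hx hy heq))
  · exact .inr (.inr (h.monoArc y hy x hx hgt))

/-- The points that can be reached from `b` form an open set. -/
theorem MonoArc.eventually_right {b c : S} (hbc : MonoArc X F b c) {U : Set S} {u : S → ℝ}
    (hU : IsArcChart X F U u) (hc : c ∈ U) : ∀ᶠ q in 𝓝 c, q ∈ X → MonoArc X F b q := by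
  have hcX := hbc.right_mem
  obtain ⟨γ, hγ, h0, h1, hX, hm⟩ := hbc
  have hev : ∀ᶠ t in 𝓝[Set.Icc 0 1] (1 : ℝ), γ t ∈ U := by
    refine (hγ 1 (by simp)).eventually ?_
    rw [h1]
    exact hU.isOpen.mem_nhds hc
  obtain ⟨δ, hδ, hball⟩ := Metric.mem_nhdsWithin_iff.1 hev
  -- After time `t₀` the arc stays in the chart, so `u (γ t₀) < u c`. The arc up to `γ t₀` can then
  -- be continued to any `q` with larger coordinate.
  obtain ⟨t₀, ht1, ht2⟩ : ∃ t₀ : ℝ, max 0 (1 - δ) < t₀ ∧ t₀ < 1 :=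
    exists_between (max_lt one_pos (by linarith))
  have ht0 : 0 < t₀ := (le_max_left _ _).trans_lt ht1
  have htδ : 1 - δ < t₀ := (le_max_right _ _).trans_lt ht1
  have hin (r : ℝ) (hr : r ∈ Set.Icc t₀ 1) : γ r ∈ U := by
    refine hball ⟨?_, ht0.le.trans hr.1, hr.2⟩
    rw [Metric.mem_ball, Real.dist_eq, abs_lt]
    exact ⟨by linarith [hr.1], by linarith [hr.2]⟩
  have hlt : u (γ t₀) < u c := by
    rw [← h1]
    exact hm _ hU.mem t₀ 1 ht0.le ht2 le_rfl hin
  have h1' : ∀ᶠ q in 𝓝 c, u (γ t₀) < u q :=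
    (hU.continuousOn.continuousAt (hU.isOpen.mem_nhds hc)).eventually (lt_mem_nhds hlt)
  filter_upwards [h1', hU.isOpen.mem_nhds hc] with q hq hqU hqX
  have h2 := hU.monoArc _ ⟨hX t₀ ⟨ht0.le, ht2.le⟩, hin t₀ ⟨le_rfl, ht2.le⟩⟩ q ⟨hqX, hqU⟩ hq
  refine MonoArc.trans ?_ h2
  rw [← h0]
  exact MonoArc.restrict hγ hX hm le_rfl ht0 ht2.le

theorem MonoArc.eventually_left {b c : S} (hbc : MonoArc X F b c) {U : Set S} {u : S → ℝ}
    (hU : IsArcChart X F U u) (hb : b ∈ U) : ∀ᶠ q in 𝓝 b, q ∈ X → MonoArc X F q c := by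
  filter_upwards [hbc.reverse.eventually_right hU.reverse hb] with q hq hqX
  exact monoArc_reverse_iff.1 (hq hqX)

/-- The starting point of an arc that ends in the domain of a coordinate is comparable with every
point of this domain. -/
theorem MonoArc.comparable_of_chart [T2Space S] {c y y' : S} (h : MonoArc X F c y') {U : Set S}
    {u : S → ℝ} (hU : IsArcChart X F U u) (hy' : y' ∈ U) (hy : y ∈ X ∩ U) :
    MonoArc X F c y ∨ c = y ∨ MonoArc X F y c := by
  have hy'X := h.right_mem
  rcases le_or_gt (u y') (u y) with hle | hgt
  · rcases hle.eq_or_lt with heq | hlt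
    · rw [← hU.injOn ⟨hy'X, hy'⟩ hy heq]
      exact .inl h
    · exact .inl (h.trans (hU.monoArc _ ⟨hy'X, hy'⟩ _ hy hlt))
  by_cases hcU : c ∈ U
  · exact hU.trichotomy ⟨h.left_mem, hcU⟩ hy
  obtain ⟨γ, hγ, h0, h1, hX, hm⟩ := h
  -- The times at which the arc is outside `U`; `t₁` is the last one.
  let B : Set ℝ := {t ∈ Set.Icc (0 : ℝ) 1 | γ t ∈ Uᶜ}
  have hBclosed : IsClosed B := hγ.preimage_isClosed_of_isClosed isClosed_Icc hU.isOpen.isClosed_compl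
  have hBcompact : IsCompact B := isCompact_Icc.of_isClosed_subset hBclosed fun t ht => ht.1
  have hBne : B.Nonempty := ⟨0, by simp, by rwa [h0]⟩
  obtain ⟨t₁, ht₁, hmax⟩ := hBcompact.exists_isGreatest hBne
  have ht₁1 : t₁ < 1 := by
    refine lt_of_le_of_ne ht₁.1.2 ?_
    rintro rfl
    exact ht₁.2 (by rwa [h1])
  have hin (t : ℝ) (ht : t ∈ Set.Ioc t₁ 1) : γ t ∈ U := by
    by_contra hn
    exact not_lt.2 (hmax ⟨⟨ht₁.1.1.trans ht.1.le, ht.2⟩, hn⟩) ht.1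
  have hle' (t : ℝ) (ht : t ∈ Set.Ioc t₁ 1) : u (γ t) ≤ u y' := by
    rcases ht.2.eq_or_lt with rfl | hlt
    · rw [h1]
    · rw [← h1]
      exact (hm _ hU.mem t 1 (ht₁.1.1.trans ht.1.le) hlt le_rfl fun r hr =>
        hin r ⟨ht.1.trans_le hr.1, hr.2⟩).le
  -- After entering `U` for good, the arc must take a coordinate at most `u y`. Otherwise it would
  -- stay in the compact segment over `[u y, u y']`, and its limit `γ t₁` would lie in `U` as well.
  obtain ⟨t, ht, htle⟩ : ∃ t ∈ Set.Ioc t₁ 1, u (γ t) ≤ u y := by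
    by_contra! hcon
    obtain ⟨v, hv, hvu⟩ := hU.exists_inverse
    have hsub : Set.Icc (u y) (u y') ⊆ u '' (X ∩ U) :=
      hU.ordConnected.out ⟨y, hy, rfl⟩ ⟨y', ⟨hy'X, hy'⟩, rfl⟩
    have hcl : IsClosed (v '' Set.Icc (u y) (u y')) :=
      (isCompact_Icc.image_of_continuousOn (hv.mono hsub)).isClosed
    have hmem : γ t₁ ∈ v '' Set.Icc (u y) (u y') := by
      have htend : Filter.Tendsto γ (𝓝[Set.Ioc t₁ 1] t₁) (𝓝 (γ t₁)) :=
        (hγ t₁ ht₁.1).mono fun t ht => ⟨ht₁.1.1.trans ht.1.le, ht.2⟩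
      have : (𝓝[Set.Ioc t₁ 1] t₁).NeBot := by
        rw [nhdsWithin_Ioc_eq_nhdsGT ht₁1]
        infer_instance
      refine hcl.mem_of_tendsto htend ?_
      filter_upwards [self_mem_nhdsWithin] with t ht
      exact ⟨u (γ t), ⟨(hcon t ht).le, hle' t ht⟩,
        hvu _ ⟨hX t ⟨ht₁.1.1.trans ht.1.le, ht.2⟩, hin t ht⟩⟩
    obtain ⟨s, hs, hsv⟩ := hmem
    obtain ⟨x, hx, hxs⟩ := hsub hs
    apply ht₁.2
    rw [← hsv, ← hxs, hvu x hx]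
    exact hx.2
  have ht0 : 0 < t := ht₁.1.1.trans_lt ht.1
  have hct : MonoArc X F c (γ t) := by
    rw [← h0]
    exact MonoArc.restrict hγ hX hm le_rfl ht0 ht.2
  have htU : γ t ∈ X ∩ U := ⟨hX t ⟨ht0.le, ht.2⟩, hin t ht⟩
  rcases htle.eq_or_lt with heq | hlt
  · rw [← hU.injOn htU hy heq]
    exact .inl hct
  · exact .inl (hct.trans (hU.monoArc _ htU _ hy hlt))

theorem comparable_of_chart [T2Space S] {c x y : S}
    (h : MonoArc X F c x ∨ c = x ∨ MonoArc X F x c) {U : Set S}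
    {u : S → ℝ} (hU : IsArcChart X F U u) (hx : x ∈ X ∩ U) (hy : y ∈ X ∩ U) :
    MonoArc X F c y ∨ c = y ∨ MonoArc X F y c := by
  rcases h with h | rfl | h
  · exact h.comparable_of_chart hU hx.2 hy
  · exact hU.trichotomy hx hy
  · have := h.reverse.comparable_of_chart hU.reverse hx.2 hy
    simp only [monoArc_reverse_iff] at this
    tauto

/-- Two points of a component of `X` are comparable. -/
theorem comparable_of_mk_eq [T2Space S]
    (hchart : ∀ x ∈ X, ∃ U u, IsArcChart X F U u ∧ x ∈ U) {c c' : X}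
    (h : ConnectedComponents.mk c = ConnectedComponents.mk c') :
    MonoArc X F c c' ∨ (c : S) = c' ∨ MonoArc X F c' c := by
  -- The points comparable with `c` form a clopen set, because within one chart domain comparability
  -- with `c` holds at all points or at none.
  let Q : Set X := {q | MonoArc X F c q ∨ (c : S) = q ∨ MonoArc X F q c}
  have key (q : X) : ∃ N : Set X, IsOpen N ∧ q ∈ N ∧ ∀ q' ∈ N, (q' ∈ Q ↔ q ∈ Q) := by
    obtain ⟨U, u, hU, hq⟩ := hchart q q.2
    exact ⟨Subtype.val ⁻¹' U, hU.isOpen.preimage continuous_subtype_val, hq, fun q' hq' =>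
      ⟨fun h => comparable_of_chart h hU ⟨q'.2, hq'⟩ ⟨q.2, hq⟩,
        fun h => comparable_of_chart h hU ⟨q.2, hq⟩ ⟨q'.2, hq'⟩⟩⟩
  have hQ : IsClopen Q := by
    constructor
    · rw [← isOpen_compl_iff, isOpen_iff_forall_mem_open]
      intro q hq
      obtain ⟨N, hN, hqN, h⟩ := key q
      exact ⟨N, fun q' hq' hc => hq ((h q' hq').1 hc), hN, hqN⟩
    · rw [isOpen_iff_forall_mem_open]
      intro q hq
      obtain ⟨N, hN, hqN, h⟩ := key q
      exact ⟨N, fun q' hq' => (h q' hq').2 hq, hN, hqN⟩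
  have hsub := hQ.connectedComponent_subset (show c ∈ Q from .inr (.inl rfl))
  exact hsub (ConnectedComponents.coe_eq_coe'.1 h.symm)

theorem MonoArc.mk_eq {c c' : X} (h : MonoArc X F c c') :
    ConnectedComponents.mk c = ConnectedComponents.mk c' := by
  obtain ⟨γ, hγ, h0, h1, hX, -⟩ := h
  let δ : Set.Icc (0 : ℝ) 1 → X := fun t => ⟨γ t, hX t t.2⟩
  have hδ : Continuous δ := (continuousOn_iff_continuous_domRestrict.1 hγ).subtype_mk _
  have hpre := isPreconnected_range hδ
  have hc : c ∈ Set.range δ := ⟨⟨0, by simp⟩, Subtype.ext h0⟩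
  have hc' : c' ∈ Set.range δ := ⟨⟨1, by simp⟩, Subtype.ext h1⟩
  exact (ConnectedComponents.coe_eq_coe'.2 (hpre.subset_connectedComponent hc' hc))

/-- The image of an arc contains a left neighbourhood of each of its points. -/
theorem arc_image_left {γ : ℝ → S} (hγ : ContinuousOn γ (Set.Icc 0 1))
    (hX : ∀ t ∈ Set.Icc (0 : ℝ) 1, γ t ∈ X)
    (hm : ∀ φ ∈ F, ∀ s t : ℝ, 0 ≤ s → s < t → t ≤ 1 →
      (∀ r ∈ Set.Icc s t, γ r ∈ φ.1) → φ.2 (γ s) < φ.2 (γ t))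
    {U : Set S} {u : S → ℝ} (hU : IsArcChart X F U u) {t : ℝ} (ht0 : 0 < t) (ht1 : t ≤ 1)
    (htU : γ t ∈ U) :
    ∀ᶠ q in 𝓝 (γ t), q ∈ X → u q ≤ u (γ t) → q ∈ γ '' Set.Icc 0 1 := by
  have hev : ∀ᶠ s in 𝓝[Set.Icc 0 1] t, γ s ∈ U :=
    (hγ t ⟨ht0.le, ht1⟩).eventually (hU.isOpen.mem_nhds htU)
  obtain ⟨δ, hδ, hball⟩ := Metric.mem_nhdsWithin_iff.1 hev
  obtain ⟨t₀, h1, h2⟩ : ∃ t₀ : ℝ, max 0 (t - δ) < t₀ ∧ t₀ < t :=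
    exists_between (max_lt ht0 (by linarith))
  have ht₀ : 0 < t₀ := (le_max_left _ _).trans_lt h1
  have htδ : t - δ < t₀ := (le_max_right _ _).trans_lt h1
  have hsub : Set.Icc t₀ t ⊆ Set.Icc 0 1 := Set.Icc_subset_Icc ht₀.le ht1
  have hin (r : ℝ) (hr : r ∈ Set.Icc t₀ t) : γ r ∈ U := by
    refine hball ⟨?_, hsub hr⟩
    rw [Metric.mem_ball, Real.dist_eq, abs_lt]
    exact ⟨by linarith [hr.1], by linarith [hr.2]⟩
  have hlt : u (γ t₀) < u (γ t) := hm _ hU.mem t₀ t ht₀.le h2 ht1 hin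
  have hcont : ContinuousOn (fun s => u (γ s)) (Set.Icc t₀ t) :=
    hU.continuousOn.comp (hγ.mono hsub) hin
  have h1' : ∀ᶠ q in 𝓝 (γ t), u (γ t₀) < u q :=
    (hU.continuousOn.continuousAt (hU.isOpen.mem_nhds htU)).eventually (lt_mem_nhds hlt)
  filter_upwards [h1', hU.isOpen.mem_nhds htU] with q hq hqU hqX hqt
  obtain ⟨s, hs, hsq⟩ := intermediate_value_Icc h2.le hcont ⟨hq.le, hqt⟩
  exact ⟨s, hsub hs, hU.injOn ⟨hX s (hsub hs), hin s hs⟩ ⟨hqX, hqU⟩ hsq⟩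

theorem arc_image_right {γ : ℝ → S} (hγ : ContinuousOn γ (Set.Icc 0 1))
    (hX : ∀ t ∈ Set.Icc (0 : ℝ) 1, γ t ∈ X)
    (hm : ∀ φ ∈ F, ∀ s t : ℝ, 0 ≤ s → s < t → t ≤ 1 →
      (∀ r ∈ Set.Icc s t, γ r ∈ φ.1) → φ.2 (γ s) < φ.2 (γ t))
    {U : Set S} {u : S → ℝ} (hU : IsArcChart X F U u) {t : ℝ} (ht0 : 0 ≤ t) (ht1 : t < 1)
    (htU : γ t ∈ U) :
    ∀ᶠ q in 𝓝 (γ t), q ∈ X → u (γ t) ≤ u q → q ∈ γ '' Set.Icc 0 1 := by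
  have hmap {t : ℝ} (ht : t ∈ Set.Icc (0 : ℝ) 1) : 1 - t ∈ Set.Icc (0 : ℝ) 1 :=
    ⟨by linarith [ht.2], by linarith [ht.1]⟩
  have := arc_image_left (X := X) (F := reverseCharts F) (γ := fun t => γ (1 - t))
    (hγ.comp (by fun_prop) fun t ht => hmap ht) (fun t ht => hX _ (hmap ht)) (by
      rintro _ ⟨φ, hφ, rfl⟩ s t hs hst ht hr
      have := hm φ hφ (1 - t) (1 - s) (by linarith) (by linarith) (by linarith) fun r hr' => by
        simpa using hr (1 - r) ⟨by linarith [hr'.2], by linarith [hr'.1]⟩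
      simpa using this) hU.reverse (t := 1 - t) (by linarith) (by linarith) (by simpa using htU)
  simp only [sub_sub_cancel] at this
  filter_upwards [this] with q hq hqX hqt
  obtain ⟨s, hs, hsq⟩ := hq hqX (by simpa using hqt)
  exact ⟨1 - s, hmap hs, hsq⟩

/-- There is no closed arc in `C ∖ w` if `w` meets all components of `C`. -/
theorem not_monoArc_self [T2Space S] {C : Set S} (hXC : X ⊆ C)
    (hopen : ∃ V, IsOpen V ∧ X = C ∩ V)
    (hmeet : ∀ K : ConnectedComponents C, ∃ p : C, (p : S) ∉ X ∧ ConnectedComponents.mk p = K)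
    (hchart : ∀ x ∈ X, ∃ U u, IsArcChart X F U u ∧ x ∈ U) (c : S) : ¬ MonoArc X F c c := by
  intro h
  have hcX := h.left_mem
  obtain ⟨γ, hγ, h0, h1, hX, hm⟩ := h
  -- The trace of a closed arc is compact, and it is open in `X`. Since `X` is open in `C`, it is
  -- clopen in `C` and contains a whole component, contrary to the point of this component outside
  -- `X`.
  set L := γ '' Set.Icc 0 1 with hL
  have hcL : c ∈ L := ⟨0, by simp, h0⟩
  have hLX : L ⊆ X := by
    rintro _ ⟨t, ht, rfl⟩
    exact hX t ht
  have hLcl : IsClosed L := (isCompact_Icc.image_of_continuousOn hγ).isClosed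
  obtain ⟨V, hV, hXV⟩ := hopen
  have hLop (p : S) (hp : p ∈ L) : ∀ᶠ q in 𝓝 p, q ∈ X → q ∈ L := by
    obtain ⟨U, u, hU, hpU⟩ := hchart p (hLX hp)
    have hleft : ∀ᶠ q in 𝓝 p, q ∈ X → u q ≤ u p → q ∈ L := by
      obtain ⟨t, ht, htp⟩ := hp
      -- At the base of the loop the left neighbourhood comes from the end `t = 1`, and in `hright`
      -- the right one comes from the start `t = 0`.
      rcases ht.1.eq_or_lt with rfl | ht0
      · have h1p : γ 1 = p := by rw [h1, ← htp, h0]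
        rw [← h1p] at hpU ⊢
        exact arc_image_left hγ hX hm hU one_pos le_rfl hpU
      · rw [← htp] at hpU ⊢
        exact arc_image_left hγ hX hm hU ht0 ht.2 hpU
    have hright : ∀ᶠ q in 𝓝 p, q ∈ X → u p ≤ u q → q ∈ L := by
      obtain ⟨t, ht, htp⟩ := hp
      rcases ht.2.eq_or_lt with rfl | ht1
      · have h1p : γ 0 = p := by rw [h0, ← htp, h1]
        rw [← h1p] at hpU ⊢
        exact arc_image_right hγ hX hm hU le_rfl one_pos hpU
      · rw [← htp] at hpU ⊢
        exact arc_image_right hγ hX hm hU ht.1 ht1 hpU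
    filter_upwards [hleft, hright] with q hq1 hq2 hqX
    exact (le_total (u q) (u p)).elim (hq1 hqX) (hq2 hqX)
  let Q : Set C := Subtype.val ⁻¹' L
  have hQ : IsClopen Q := by
    refine ⟨hLcl.preimage continuous_subtype_val, ?_⟩
    rw [isOpen_iff_mem_nhds]
    intro p hp
    have hpV : (p : S) ∈ V := (hXV ▸ hLX hp : (p : S) ∈ C ∩ V).2
    have h2 : ∀ᶠ q : C in 𝓝 p, (q : S) ∈ X → (q : S) ∈ L :=
      (continuous_subtype_val.tendsto p).eventually (hLop p hp)
    have h3 : ∀ᶠ q : C in 𝓝 p, (q : S) ∈ V :=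
      (continuous_subtype_val.tendsto p).eventually (hV.mem_nhds hpV)
    filter_upwards [h2, h3] with q hq hqV
    exact hq (hXV ▸ ⟨q.2, hqV⟩)
  obtain ⟨p, hpX, hpK⟩ := hmeet (ConnectedComponents.mk ⟨c, hXC hcX⟩)
  have hsub := hQ.connectedComponent_subset (show (⟨c, hXC hcX⟩ : C) ∈ Q from hcL)
  exact hpX (hLX (hsub (ConnectedComponents.coe_eq_coe'.1 hpK)))

end Arcs


/-! ### Holomorphic charts -/

section Surface

variable {S : Type*} [TopologicalSpace S]

theorem eventually_leftInverse {φ : OpenPartialHomeomorph S ℂ} {p : S} (hp : p ∈ φ.source)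
    {P : S → Prop} (h : ∀ᶠ q in 𝓝 p, P q) : ∀ᶠ u in 𝓝 (φ p), P (φ.symm u) := by
  have := φ.symm.continuousAt (φ.map_source hp)
  rw [ContinuousAt, φ.left_inv hp] at this
  exact this.eventually h

variable [ChartedSpace ℂ S]

theorem IsHolChart.contDiffOn {φ ψ : OpenPartialHomeomorph S ℂ} (hφ : IsHolChart φ)
    (hψ : IsHolChart ψ) : ContDiffOn ℂ ω (ψ ∘ φ.symm) (φ.symm.trans ψ).source := by
  have h := IsManifold.compatible_of_mem_maximalAtlas hφ hψ
  rw [contDiffGroupoid, mem_groupoid_of_pregroupoid] at h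
  simpa [contDiffPregroupoid] using h.1

theorem IsHolChart.analyticAt {φ ψ : OpenPartialHomeomorph S ℂ} (hφ : IsHolChart φ)
    (hψ : IsHolChart ψ) {p : S} (hp : p ∈ φ.source) (hp' : p ∈ ψ.source) :
    AnalyticAt ℂ (ψ ∘ φ.symm) (φ p) :=
  ((hφ.contDiffOn hψ).contDiffAt ((φ.symm.trans ψ).open_source.mem_nhds (by
    simp [hp, hp']))).analyticAt

theorem deriv_ne_zero_of_leftInverse {f g : ℂ → ℂ} {x : ℂ} (hf : DifferentiableAt ℂ f x)
    (hg : DifferentiableAt ℂ g (f x)) (h : ∀ᶠ u in 𝓝 x, g (f u) = u) : deriv f x ≠ 0 := by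
  have h1 := hg.hasDerivAt.comp x hf.hasDerivAt
  have h2 : HasDerivAt (g ∘ f) 1 x := (hasDerivAt_id x).congr_of_eventuallyEq h
  exact right_ne_zero_of_mul (h1.unique h2 ▸ one_ne_zero)

theorem IsHolChart.deriv_ne_zero {φ ψ : OpenPartialHomeomorph S ℂ} (hφ : IsHolChart φ)
    (hψ : IsHolChart ψ) {p : S} (hp : p ∈ φ.source) (hp' : p ∈ ψ.source) :
    deriv (ψ ∘ φ.symm) (φ p) ≠ 0 := by
  have h1 : (ψ ∘ φ.symm) (φ p) = ψ p := by simp [hp]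
  refine deriv_ne_zero_of_leftInverse (g := φ ∘ ψ.symm)
    (hφ.analyticAt hψ hp hp').differentiableAt ?_ ?_
  · rw [h1]
    exact (hψ.analyticAt hφ hp' hp).differentiableAt
  · filter_upwards [eventually_leftInverse hp (ψ.open_source.mem_nhds hp'),
      φ.open_target.mem_nhds (φ.map_source hp)] with u hu hu'
    simp only [Function.comp_apply]
    rw [ψ.left_inv hu, φ.right_inv hu']

variable {τ : S → S}

theorem IsRealChart.im_eq_zero {φ : OpenPartialHomeomorph S ℂ} (hφ : IsRealChart τ φ) {p : S}
    (hp : p ∈ φ.source) (hfix : τ p = p) : (φ p).im = 0 := by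
  have := (hφ.2 p hp).2
  rw [hfix] at this
  exact Complex.conj_eq_iff_im.1 this.symm

theorem IsRealChart.fixed_of_im_eq_zero {φ : OpenPartialHomeomorph S ℂ} (hφ : IsRealChart τ φ)
    {p : S} (hp : p ∈ φ.source) (him : (φ p).im = 0) : τ p = p := by
  refine φ.injOn (hφ.2 p hp).1 hp ?_
  rw [(hφ.2 p hp).2]
  exact Complex.conj_eq_iff_im.2 him

theorem IsRealChart.ofReal_re {φ : OpenPartialHomeomorph S ℂ} (hφ : IsRealChart τ φ) {p : S}
    (hp : p ∈ φ.source) (hfix : τ p = p) : (((φ p).re : ℝ) : ℂ) = φ p :=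
  Complex.ext (by simp) (by simp [hφ.im_eq_zero hp hfix])

variable [IsManifold 𝓘(ℂ) ω S]

theorem isHolChart_chartAt (p : S) : IsHolChart (chartAt ℂ p) :=
  IsManifold.chart_mem_maximalAtlas p

/-- An open partial homeomorphism which near each point of its domain is the composition of a
holomorphic chart and a holomorphic function with non-zero derivative is a holomorphic chart. -/
theorem isHolChart_of_local (e : OpenPartialHomeomorph S ℂ)
    (h : ∀ p ∈ e.source, ∃ (φ : OpenPartialHomeomorph S ℂ) (g : ℂ → ℂ), IsHolChart φ ∧
      p ∈ φ.source ∧ (∀ᶠ q in 𝓝 p, e q = g (φ q)) ∧ AnalyticAt ℂ g (φ p) ∧ deriv g (φ p) ≠ 0) :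
    IsHolChart e := by
  refine OpenPartialHomeomorph.mem_maximalAtlas_of_contMDiffOn e ?_ ?_
  · intro p hp
    obtain ⟨φ, g, hφ, hpφ, heq, hg, -⟩ := h p hp
    refine ContMDiffAt.contMDiffWithinAt (ContMDiffAt.congr_of_eventuallyEq ?_ heq)
    exact ContMDiffAt.comp p hg.contDiffAt.contMDiffAt (contMDiffAt_of_mem_maximalAtlas hφ hpφ)
  · intro y hy
    obtain ⟨φ, g, hφ, hpφ, heq, hg, hg'⟩ := h _ (e.map_target hy)
    set p := e.symm y with hp
    have hpe : p ∈ e.source := e.map_target hy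
    have hep : e p = y := e.right_inv hy
    have h1 : ∀ᶠ u in 𝓝 (φ p), (φ.symm.trans e) u = g u := by
      filter_upwards [eventually_leftInverse hpφ heq,
        φ.open_target.mem_nhds (φ.map_source hpφ)] with u hu hu'
      rw [OpenPartialHomeomorph.trans_apply, hu, φ.right_inv hu']
    have hsymm : (φ.symm.trans e).symm y = φ p := by
      simp [OpenPartialHomeomorph.trans_symm_eq_symm_trans_symm, hp]
    have h2 : ContDiffAt ℂ ω (φ.symm.trans e).symm y := by
      refine OpenPartialHomeomorph.contDiffAt_symm_deriv (f₀' := deriv g (φ p)) _ hg' ?_ ?_ ?_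
      · rw [OpenPartialHomeomorph.trans_target]
        exact ⟨hy, by simpa using hpφ⟩
      · rw [hsymm]
        exact hg.differentiableAt.hasDerivAt.congr_of_eventuallyEq h1
      · rw [hsymm]
        exact hg.contDiffAt.congr_of_eventuallyEq h1
    have h3 : ContMDiffAt 𝓘(ℂ) 𝓘(ℂ) ω φ.symm ((φ.symm.trans e).symm y) := by
      rw [hsymm]
      exact contMDiffAt_symm_of_mem_maximalAtlas hφ (φ.map_source hpφ)
    refine ContMDiffAt.contMDiffWithinAt ?_
    refine (ContMDiffAt.comp y h3 h2.contMDiffAt).congr_of_eventuallyEq ?_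
    have h4 : ∀ᶠ v in 𝓝 y, e.symm v ∈ φ.source :=
      (e.symm.continuousAt hy).eventually (φ.open_source.mem_nhds hpφ)
    filter_upwards [h4] with v hv
    simp [OpenPartialHomeomorph.trans_symm_eq_symm_trans_symm, hv]

theorem IsHolChart.restrOpen {φ : OpenPartialHomeomorph S ℂ} (hφ : IsHolChart φ) {U : Set S}
    (hU : IsOpen U) : IsHolChart (φ.restrOpen U hU) :=
  isHolChart_of_local _ fun p hp => ⟨φ, id, hφ, hp.1, by simp, analyticAt_id, by simp⟩

theorem IsHolChart.disjointUnion {φ ψ : OpenPartialHomeomorph S ℂ} (hφ : IsHolChart φ)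
    (hψ : IsHolChart ψ) [∀ x, Decidable (x ∈ φ.source)] [∀ y, Decidable (y ∈ φ.target)]
    (Hs : Disjoint φ.source ψ.source) (Ht : Disjoint φ.target ψ.target) :
    IsHolChart (φ.disjointUnion ψ Hs Ht) := by
  refine isHolChart_of_local _ fun p hp => ?_
  rcases hp with hp | hp
  · refine ⟨φ, id, hφ, hp, ?_, analyticAt_id, by simp⟩
    filter_upwards [φ.open_source.mem_nhds hp] with q hq
    exact if_pos hq
  · refine ⟨ψ, id, hψ, hp, ?_, analyticAt_id, by simp⟩
    filter_upwards [ψ.open_source.mem_nhds hp] with q hq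
    exact if_neg (Set.disjoint_right.1 Hs hq)

theorem IsHolChart.transHomeomorph {φ : OpenPartialHomeomorph S ℂ} (hφ : IsHolChart φ)
    (g : ℂ ≃ₜ ℂ) (hg : AnalyticOnNhd ℂ g Set.univ) (hg' : ∀ u, deriv g u ≠ 0) :
    IsHolChart (φ.transHomeomorph g) :=
  isHolChart_of_local _ fun p hp => ⟨φ, g, hφ, hp, by simp, hg _ trivial, hg' _⟩

/-! ### Anti-holomorphic involutions -/

theorem analyticAt_conj_conj {f : ℂ → ℂ} {x : ℂ} (hf : AnalyticAt ℂ f x) :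
    AnalyticAt ℂ (fun u => conj (f (conj u))) (conj x) := by
  rw [Complex.analyticAt_iff_eventually_differentiableAt] at hf ⊢
  have hc : Filter.Tendsto (fun u : ℂ => conj u) (𝓝 (conj x)) (𝓝 x) := by
    simpa using (Complex.continuous_conj.tendsto (conj x))
  filter_upwards [hc.eventually hf] with u hu
  have := hu.hasDerivAt.conj_conj
  simp only [Complex.conj_conj] at this
  exact this.differentiableAt

/-- The definition of an antiholomorphic involution only uses the preferred charts; composing with
holomorphic transition maps on both sides gives all charts. -/
theorem analyticAt_antihol (hτ : IsAntiholInvolution τ) {φ ψ : OpenPartialHomeomorph S ℂ}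
    (hφ : IsHolChart φ) (hψ : IsHolChart ψ) {p : S} (hp : p ∈ φ.source) (hp' : τ p ∈ ψ.source) :
    AnalyticAt ℂ (fun u => conj (ψ (τ (φ.symm u)))) (φ p) := by
  have h1 := hφ.analyticAt (isHolChart_chartAt p) hp (mem_chart_source ℂ p)
  have h2 := hτ.2.2 p
  have h3 := analyticAt_conj_conj
    ((isHolChart_chartAt (τ p)).analyticAt hψ (mem_chart_source ℂ (τ p)) hp')
  have e1 : (chartAt ℂ p ∘ φ.symm) (φ p) = chartAt ℂ p p := by simp [hp]
  have h4 := AnalyticAt.comp (f := chartAt ℂ p ∘ φ.symm)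
    (g := fun u : ℂ => conj (chartAt ℂ (τ p) (τ ((chartAt ℂ p).symm u)))) (x := φ p)
    (by rw [e1]; exact h2) h1
  have h5 := AnalyticAt.comp (f := (fun u : ℂ => conj (chartAt ℂ (τ p)
    (τ ((chartAt ℂ p).symm u)))) ∘ chartAt ℂ p ∘ φ.symm)
    (g := fun u => conj ((ψ ∘ (chartAt ℂ (τ p)).symm) (conj u))) (x := φ p)
    (by simpa [hp] using h3) h4
  refine h5.congr ?_
  have hev : ∀ᶠ q in 𝓝 p, τ q ∈ (chartAt ℂ (τ p)).source :=
    (hτ.2.1.tendsto p).eventually ((chartAt ℂ (τ p)).open_source.mem_nhds (mem_chart_source ℂ _))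
  filter_upwards [eventually_leftInverse hp hev, eventually_leftInverse hp
    ((chartAt ℂ p).open_source.mem_nhds (mem_chart_source ℂ p))] with u hu hu'
  simp only [Function.comp_apply, Complex.conj_conj]
  rw [(chartAt ℂ p).left_inv hu', (chartAt ℂ (τ p)).left_inv hu]

theorem deriv_antihol_ne_zero (hτ : IsAntiholInvolution τ) {φ ψ : OpenPartialHomeomorph S ℂ}
    (hφ : IsHolChart φ) (hψ : IsHolChart ψ) {p : S} (hp : p ∈ φ.source) (hp' : τ p ∈ ψ.source) :
    deriv (fun u => conj (ψ (τ (φ.symm u)))) (φ p) ≠ 0 := by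
  have hττ : τ (τ p) = p := hτ.1 p
  have h1 := analyticAt_conj_conj (analyticAt_antihol hτ hψ hφ hp' (by rwa [hττ]))
  refine deriv_ne_zero_of_leftInverse
    (g := fun v => conj (conj (φ (τ (ψ.symm (conj v))))))
    (analyticAt_antihol hτ hφ hψ hp hp').differentiableAt ?_ ?_
  · simpa [hp] using h1.differentiableAt
  · have hev : ∀ᶠ q in 𝓝 p, τ q ∈ ψ.source :=
      (hτ.2.1.tendsto p).eventually (ψ.open_source.mem_nhds hp')
    filter_upwards [eventually_leftInverse hp hev, φ.open_target.mem_nhds (φ.map_source hp)]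
      with u hu hu'
    simp [hu, hu', hτ.1 _]

/-! ### Real charts -/

theorem IsRealChart.restrOpen {φ : OpenPartialHomeomorph S ℂ} (hφ : IsRealChart τ φ) {U : Set S}
    (hU : IsOpen U) (hτU : ∀ p ∈ U, τ p ∈ U) : IsRealChart τ (φ.restrOpen U hU) :=
  ⟨hφ.1.restrOpen hU, fun p hp => ⟨⟨(hφ.2 p hp.1).1, hτU p hp.2⟩, (hφ.2 p hp.1).2⟩⟩

/-- Near a fixed point of `τ` there is a holomorphic chart in which `τ` is complex conjugation. -/
theorem exists_isRealChart (hτ : IsAntiholInvolution τ) {c : S} (hc : τ c = c) :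
    ∃ φ, IsRealChart τ φ ∧ c ∈ φ.source := by
  set φ := chartAt ℂ c
  have hφ : IsHolChart φ := isHolChart_chartAt c
  have hcφ : c ∈ φ.source := mem_chart_source ℂ c
  have hcφ' : τ c ∈ φ.source := by rwa [hc]
  set g : ℂ → ℂ := fun u => conj (φ (τ (φ.symm u)))
  have hg : AnalyticAt ℂ g (φ c) := analyticAt_antihol hτ hφ hφ hcφ hcφ'
  -- The derivative of `Φ` below. The choice `a = 1` works unless `deriv g = -1`, and then `a = i`
  -- gives `2i`.
  obtain ⟨a, ha⟩ : ∃ a : ℂ, a + conj a * deriv g (φ c) ≠ 0 := by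
    by_cases h : 1 + deriv g (φ c) = 0
    · refine ⟨Complex.I, ?_⟩
      rw [eq_neg_of_add_eq_zero_right h, Complex.conj_I]
      intro h2
      have := congrArg Complex.im h2
      norm_num at this
    · exact ⟨1, by simpa using h⟩
  -- In terms of points, `Φ` is `a φ(p) + conj (a φ(τ p))`, which is conjugated when `p` is replaced
  -- by `τ p`.
  set Φ : ℂ → ℂ := fun u => a * u + conj a * g u
  have hΦ {u : ℂ} (hu : AnalyticAt ℂ g u) : AnalyticAt ℂ Φ u :=
    (analyticAt_const.mul analyticAt_id).add (analyticAt_const.mul hu)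
  have hΦ' : HasDerivAt Φ (a + conj a * deriv g (φ c)) (φ c) := by
    have h := ((hasDerivAt_id (φ c)).const_mul a).add
      (hg.differentiableAt.hasDerivAt.const_mul (conj a))
    rw [mul_one] at h
    exact h
  have hΦd : deriv Φ (φ c) ≠ 0 := by rwa [hΦ'.deriv]
  have hΦe : HasFDerivAt Φ ((ContinuousLinearEquiv.unitsEquivAut ℂ (Units.mk0 _ ha) :
      ℂ ≃L[ℂ] ℂ) : ℂ →L[ℂ] ℂ) (φ c) := by
    refine hΦ'.hasFDerivAt.congr_fderiv ?_
    ext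
    simp
  let Θ := ((hΦ hg).contDiffAt (n := ω)).toOpenPartialHomeomorph Φ hΦe (by simp)
  have hΘ : (Θ : ℂ → ℂ) = Φ := rfl
  have hcΘ : φ c ∈ Θ.source :=
    ((hΦ hg).contDiffAt (n := ω)).mem_toOpenPartialHomeomorph_source hΦe (by simp)
  let e₁ := φ.trans Θ
  have hev : ∀ᶠ p in 𝓝 c, p ∈ e₁.source ∧ deriv Φ (φ p) ≠ 0 := by
    refine Filter.Eventually.and (e₁.open_source.mem_nhds ⟨hcφ, hcΘ⟩) ?_
    have h1 : ContinuousAt (deriv Φ) (φ c) := (hΦ hg).deriv.continuousAt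
    exact (h1.comp (φ.continuousAt hcφ)).eventually_ne hΦd
  obtain ⟨W, hWsub, hWopen, hcW⟩ := mem_nhds_iff.1 hev
  -- A `τ`-invariant neighbourhood on which the construction is valid.
  let D := W ∩ τ ⁻¹' W
  have hD : IsOpen D := hWopen.inter (hWopen.preimage hτ.2.1)
  have hτD (p : S) (hp : p ∈ D) : τ p ∈ D := ⟨hp.2, by simpa [hτ.1 p] using hp.1⟩
  have hform (p : S) (hp : p ∈ D) : e₁ p = a * φ p + conj (a * φ (τ p)) := by
    have : p ∈ φ.source := (hWsub hp.1).1.1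
    simp [e₁, hΘ, Φ, g, this]
  refine ⟨e₁.restrOpen D hD, ⟨isHolChart_of_local _ fun p hp => ?_, fun p hp => ?_⟩, ?_⟩
  · exact ⟨φ, Φ, hφ, (hWsub hp.2.1).1.1, by simp [e₁, hΘ],
      hΦ (analyticAt_antihol hτ hφ hφ (hWsub hp.2.1).1.1 (hWsub hp.2.2).1.1), (hWsub hp.2.1).2⟩
  · refine ⟨⟨(hWsub hp.2.2).1, hτD p hp.2⟩, ?_⟩
    change e₁ (τ p) = conj (e₁ p)
    rw [hform _ (hτD p hp.2), hform p hp.2, hτ.1 p]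
    simp [add_comm]
  · exact ⟨⟨hcφ, hcΘ⟩, hcW, by simpa [hc] using hcW⟩

end Surface


/-! ### The quotient surface and its orientation -/

theorem det_smulRight_one (d : ℂ) :
    ((ContinuousLinearMap.toSpanSingleton ℂ d).restrictScalars ℝ : ℂ →L[ℝ] ℂ).det =
      Complex.normSq d := by
  rw [ContinuousLinearMap.det]
  have : (((ContinuousLinearMap.toSpanSingleton ℂ d).restrictScalars ℝ : ℂ →L[ℝ] ℂ) :
      ℂ →ₗ[ℝ] ℂ) = (LinearMap.toSpanSingleton ℂ ℂ d).restrictScalars ℝ := rfl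
  rw [this, LinearMap.det_restrictScalars, Algebra.norm_complex_apply]
  congr 1
  simp

theorem det_fderiv_of_hasDerivAt {f : ℂ → ℂ} {d z : ℂ} (h : HasDerivAt f d z) :
    (fderiv ℝ f z).det = Complex.normSq d := by
  rw [(h.hasFDerivAt.restrictScalars ℝ).fderiv, det_smulRight_one]

theorem det_fderiv_conj_of_hasDerivAt {f : ℂ → ℂ} {d z : ℂ}
    (h : HasDerivAt (fun u => conj (f u)) d z) : (fderiv ℝ f z).det = -Complex.normSq d := by
  have h1 := Complex.conjCLE.hasFDerivAt.comp z (h.hasFDerivAt.restrictScalars ℝ)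
  have h2 : (Complex.conjCLE : ℂ → ℂ) ∘ (fun u => conj (f u)) = f := by
    funext u
    simp
  rw [h2] at h1
  rw [h1.fderiv]
  refine (LinearMap.det_comp _ _).trans ?_
  have h3 := det_smulRight_one d
  rw [ContinuousLinearMap.det] at h3
  have h4 : LinearMap.det ((Complex.conjCLE : ℂ →L[ℝ] ℂ) : ℂ →ₗ[ℝ] ℂ) = -1 := Complex.det_conjAe
  rw [h4, neg_one_mul]
  exact congrArg Neg.neg h3

section Quotient

variable {S : Type*} [TopologicalSpace S] {τ : S → S}

omit [TopologicalSpace S] in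
theorem proj_eq_iff (hτ : Function.Involutive τ) {p q : {p : S // τ p ≠ p}} :
    proj τ p = proj τ q ↔ p.1 = q.1 ∨ p.1 = τ q.1 := by
  refine Quotient.eq.trans ?_
  change s(p.1, τ p.1) = s(q.1, τ q.1) ↔ _
  rw [Sym2.eq_iff]
  constructor
  · rintro (h | h)
    · exact .inl h.1
    · exact .inr h.1
  · rintro (h | h)
    · exact .inl ⟨h, by rw [h]⟩
    · exact .inr ⟨h, by rw [h, hτ]⟩

omit [TopologicalSpace S] in
theorem ne_of_ne (hτ : Function.Involutive τ) {p : S} (hp : τ p ≠ p) : τ (τ p) ≠ τ p := by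
  rw [hτ p]
  exact hp.symm

omit [TopologicalSpace S] in
theorem proj_involution (hτ : Function.Involutive τ) {p : S} (hp : τ p ≠ p) :
    proj τ ⟨τ p, ne_of_ne hτ hp⟩ = proj τ ⟨p, hp⟩ :=
  (proj_eq_iff hτ).2 (.inr rfl)

theorem continuous_proj : Continuous (proj τ) := continuous_quotient_mk'

theorem isOpenMap_proj (hτ : Function.Involutive τ) (hc : Continuous τ) : IsOpenMap (proj τ) := by
  intro U hU
  let τ' : {p : S // τ p ≠ p} → {p : S // τ p ≠ p} := fun p => ⟨τ p, ne_of_ne hτ p.2⟩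
  have hτ' : Continuous τ' := (hc.comp continuous_subtype_val).subtype_mk _
  have : proj τ ⁻¹' (proj τ '' U) = U ∪ τ' ⁻¹' U := by
    ext q
    constructor
    · rintro ⟨p, hp, hpq⟩
      rcases (proj_eq_iff hτ).1 hpq with h | h
      · exact .inl (Subtype.ext h ▸ hp)
      · have h' : p = τ' q := Subtype.ext h
        exact .inr (by rwa [Set.mem_preimage, ← h'])
    · rintro (h | h)
      · exact ⟨q, h, rfl⟩
      · exact ⟨τ' q, h, proj_involution hτ q.2⟩
  exact isOpen_coinduced.2 (this ▸ hU.union (hU.preimage hτ'))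

variable [T2Space S] [ChartedSpace ℂ S]

omit [ChartedSpace ℂ S] in
theorem isOpen_ne_fixed (hc : Continuous τ) : IsOpen {p : S | τ p ≠ p} :=
  isOpen_ne_fun hc continuous_id

/-- The projection is an open map, and it is injective on a set that does not meet its image under
`τ`. -/
theorem exists_isInducedChart_of_disjoint (hτ : Function.Involutive τ) (hc : Continuous τ)
    {φ : OpenPartialHomeomorph S ℂ} (hφ : IsHolChart φ) {p₀ : S} (hp₀ : p₀ ∈ φ.source)
    (hdisj : ∀ p ∈ φ.source, τ p ∉ φ.source) : ∃ e, IsInducedChart τ φ e := by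
  have hne (p : S) (hp : p ∈ φ.source) : τ p ≠ p := fun h => hdisj p hp (h.symm ▸ hp)
  let P : TopologicalSpace.Opens S := ⟨{p : S | τ p ≠ p}, isOpen_ne_fixed hc⟩
  have : Nonempty P := ⟨⟨p₀, hne p₀ hp₀⟩⟩
  let A : Set P := {p | p.1 ∈ φ.source}
  have hA : IsOpen A := φ.open_source.preimage continuous_subtype_val
  let π : P → QuotientSurface τ := proj τ
  have hinj : Set.InjOn π A := by
    intro p hp q hq hpq
    rcases (proj_eq_iff hτ).1 hpq with h | h
    · exact Subtype.ext h
    · exact absurd (h ▸ hp : τ q.1 ∈ φ.source) (hdisj _ hq)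
  let π' : OpenPartialHomeomorph P (QuotientSurface τ) :=
    OpenPartialHomeomorph.ofContinuousOpen (hinj.bijOn_image.toPartialEquiv π A (π '' A))
      continuous_proj.continuousOn (isOpenMap_proj hτ hc) hA
  have hπ' : (π' : P → QuotientSurface τ) = π := rfl
  have hleft (p : P) (hp : p ∈ A) : π'.symm (π p) = p := π'.left_inv hp
  refine ⟨π'.symm.trans (φ.subtypeRestr (s := P) this), hφ, hne, ?_, fun p hp => ?_⟩
  · rw [OpenPartialHomeomorph.trans_source, OpenPartialHomeomorph.subtypeRestr_source]
    change π '' A ∩ π'.symm ⁻¹' A = π '' A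
    refine Set.inter_eq_left.2 ?_
    rintro _ ⟨p, hp, rfl⟩
    rw [Set.mem_preimage, hleft p hp]
    exact hp
  · change φ (π'.symm (π p)).1 = φ p.1
    rw [hleft p hp]

variable [IsManifold 𝓘(ℂ) ω S]

/-- Every point of `Σ ∖ C` lies in the domain of an induced chart. -/
theorem exists_isInducedChart (hτ : IsAntiholInvolution τ) {p : S} (hp : τ p ≠ p) :
    ∃ φ e, IsInducedChart τ φ e ∧ p ∈ φ.source := by
  obtain ⟨U, V, hU, hV, hpU, hpV, hUV⟩ := t2_separation hp
  have hW : IsOpen (V ∩ τ ⁻¹' U) := hV.inter (hU.preimage hτ.2.1)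
  have hp' : p ∈ ((chartAt ℂ p).restrOpen _ hW).source := ⟨mem_chart_source ℂ p, hpV, hpU⟩
  obtain ⟨e, he⟩ := exists_isInducedChart_of_disjoint hτ.1 hτ.2.1
    ((isHolChart_chartAt p).restrOpen hW) hp' fun q hq hq' =>
      Set.disjoint_left.1 hUV hq.2.2 hq'.2.1
  exact ⟨_, e, he, hp'⟩

variable {o : OpenPartialHomeomorph (QuotientSurface τ) ℂ → QuotientSurface τ → ℤˣ}

omit [T2Space S] [IsManifold 𝓘(ℂ) ω S] in
theorem IsInducedChart.mem_source {φ : OpenPartialHomeomorph S ℂ}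
    {e : OpenPartialHomeomorph (QuotientSurface τ) ℂ} (h : IsInducedChart τ φ e) {p : S}
    (hp : p ∈ φ.source) (hne : τ p ≠ p) : proj τ ⟨p, hne⟩ ∈ e.source := by
  rw [h.2.2.1]
  exact ⟨⟨p, hne⟩, hp, rfl⟩

omit [T2Space S] [IsManifold 𝓘(ℂ) ω S] in
theorem IsInducedChart.eventually_symm {φ : OpenPartialHomeomorph S ℂ}
    {e : OpenPartialHomeomorph (QuotientSurface τ) ℂ} (h : IsInducedChart τ φ e) {p : S}
    (hp : p ∈ φ.source) : ∀ᶠ u in 𝓝 (φ p), ∃ hne : τ (φ.symm u) ≠ φ.symm u,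
      e.symm u = proj τ ⟨φ.symm u, hne⟩ := by
  filter_upwards [φ.open_target.mem_nhds (φ.map_source hp)] with u hu
  have hus := φ.map_target hu
  refine ⟨h.2.1 _ hus, ?_⟩
  have h1 := h.2.2.2 ⟨φ.symm u, h.2.1 _ hus⟩ hus
  exact (congrArg e.symm (h1.trans (φ.right_inv hu))).symm.trans (e.left_inv (h.mem_source hus _))

omit [T2Space S] [IsManifold 𝓘(ℂ) ω S] in
-- The transition map is holomorphic, so its Jacobian `|d|²` is not negative and the signs must
-- agree.
theorem orientation_eq (ho : IsOrientation (quotientAtlas τ) o) {φ φ' : OpenPartialHomeomorph S ℂ}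
    {e e' : OpenPartialHomeomorph (QuotientSurface τ) ℂ} (h : IsInducedChart τ φ e)
    (h' : IsInducedChart τ φ' e') {p : S} (hne : τ p ≠ p) (hp : p ∈ φ.source)
    (hp' : p ∈ φ'.source) : o e (proj τ ⟨p, hne⟩) = o e' (proj τ ⟨p, hne⟩) := by
  have h1 := ho.2 e ⟨φ, h⟩ e' ⟨φ', h'⟩ _ ⟨h.mem_source hp hne, h'.mem_source hp' hne⟩
  rw [h.2.2.2 _ hp] at h1
  have h2 : HasDerivAt (e' ∘ e.symm) (deriv (φ' ∘ φ.symm) (φ p)) (φ p) := by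
    refine (h.1.analyticAt h'.1 hp hp').differentiableAt.hasDerivAt.congr_of_eventuallyEq ?_
    filter_upwards [h.eventually_symm hp,
      eventually_leftInverse hp (φ'.open_source.mem_nhds hp')] with u ⟨hu1, hu2⟩ hu'
    simp only [Function.comp_apply, hu2]
    exact h'.2.2.2 ⟨_, hu1⟩ hu'
  rw [det_fderiv_of_hasDerivAt h2] at h1
  have h3 := Complex.normSq_nonneg (deriv (φ' ∘ φ.symm) (φ p))
  rcases Int.units_eq_one_or (o e (proj τ ⟨p, hne⟩)) with h4 | h4 <;>
    rcases Int.units_eq_one_or (o e' (proj τ ⟨p, hne⟩)) with h5 | h5 <;>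
    rw [h4, h5] at h1 ⊢ <;> exfalso <;> norm_num at h1 <;> linarith

omit [T2Space S] in
-- On the two sheets over `Σ'` the transition map is antiholomorphic, with Jacobian `-|d|²`.
theorem orientation_eq_neg (hτ : IsAntiholInvolution τ) (ho : IsOrientation (quotientAtlas τ) o)
    {φ φ' : OpenPartialHomeomorph S ℂ}
    {e e' : OpenPartialHomeomorph (QuotientSurface τ) ℂ} (h : IsInducedChart τ φ e)
    (h' : IsInducedChart τ φ' e') {p : S} (hne : τ p ≠ p) (hp : p ∈ φ.source)
    (hp' : τ p ∈ φ'.source) : o e (proj τ ⟨p, hne⟩) = -o e' (proj τ ⟨p, hne⟩) := by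
  have hmem := h'.mem_source hp' (ne_of_ne hτ.1 hne)
  rw [proj_involution hτ.1 hne] at hmem
  have h1 := ho.2 e ⟨φ, h⟩ e' ⟨φ', h'⟩ _ ⟨h.mem_source hp hne, hmem⟩
  rw [h.2.2.2 _ hp] at h1
  have h2 : HasDerivAt (fun u => conj ((e' ∘ e.symm) u))
      (deriv (fun u => conj (φ' (τ (φ.symm u)))) (φ p)) (φ p) := by
    refine (analyticAt_antihol hτ h.1 h'.1 hp
      hp').differentiableAt.hasDerivAt.congr_of_eventuallyEq ?_
    have hev : ∀ᶠ q in 𝓝 p, τ q ∈ φ'.source :=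
      (hτ.2.1.tendsto p).eventually (φ'.open_source.mem_nhds hp')
    filter_upwards [h.eventually_symm hp, eventually_leftInverse hp hev] with u ⟨hu1, hu2⟩ hu'
    simp only [Function.comp_apply, hu2]
    rw [← proj_involution hτ.1 hu1]
    exact congrArg conj (h'.2.2.2 ⟨_, ne_of_ne hτ.1 hu1⟩ hu')
  rw [det_fderiv_conj_of_hasDerivAt h2] at h1
  have h3 := Complex.normSq_nonneg (deriv (fun u => conj (φ' (τ (φ.symm u)))) (φ p))
  rcases Int.units_eq_one_or (o e (proj τ ⟨p, hne⟩)) with h4 | h4 <;>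
    rcases Int.units_eq_one_or (o e' (proj τ ⟨p, hne⟩)) with h5 | h5 <;>
    rw [h4, h5] at h1 ⊢ <;> first | (exfalso; norm_num at h1; linarith) | simp

omit [T2Space S] [IsManifold 𝓘(ℂ) ω S] in
theorem mem_positivePart_iff (ho : IsOrientation (quotientAtlas τ) o)
    {φ : OpenPartialHomeomorph S ℂ} {e : OpenPartialHomeomorph (QuotientSurface τ) ℂ}
    (h : IsInducedChart τ φ e) {p : S} (hne : τ p ≠ p) (hp : p ∈ φ.source) :
    p ∈ positivePart τ o ↔ o e (proj τ ⟨p, hne⟩) = 1 := by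
  constructor
  · rintro ⟨_, φ', e', h', hp', h1⟩
    rw [orientation_eq ho h h' hne hp hp', h1]
  · exact fun h1 => ⟨hne, φ, e, h, hp, h1⟩

/-- Since `τ` reverses the complex orientation, exactly one of the two points over each point of
`Σ'` is positive. -/
theorem involution_mem_positivePart_iff (hτ : IsAntiholInvolution τ)
    (ho : IsOrientation (quotientAtlas τ) o) {p : S} (hne : τ p ≠ p) :
    τ p ∈ positivePart τ o ↔ p ∉ positivePart τ o := by
  obtain ⟨φ, e, h, hp⟩ := exists_isInducedChart hτ hne
  obtain ⟨φ', e', h', hp'⟩ := exists_isInducedChart hτ (ne_of_ne hτ.1 hne)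
  rw [mem_positivePart_iff ho h hne hp, mem_positivePart_iff ho h' (ne_of_ne hτ.1 hne) hp',
    proj_involution hτ.1 hne, orientation_eq_neg hτ ho h h' hne hp hp']
  rcases Int.units_eq_one_or (o e' (proj τ ⟨p, hne⟩)) with h5 | h5 <;> rw [h5] <;> decide

theorem isOpen_positivePart (hτ : IsAntiholInvolution τ) (ho : IsOrientation (quotientAtlas τ) o) :
    IsOpen (positivePart τ o) := by
  rw [isOpen_iff_mem_nhds]
  intro p hp
  have hne := hp.1
  obtain ⟨φ, e, h, hpφ⟩ := exists_isInducedChart hτ hne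
  have h1 := (mem_positivePart_iff ho h hne hpφ).1 hp
  have h2 : ∀ᶠ q : {p : S // τ p ≠ p} in 𝓝 ⟨p, hne⟩, o e (proj τ q) = 1 := by
    filter_upwards [(continuous_proj.tendsto _).eventually
      (ho.1 e ⟨φ, h⟩ _ (h.mem_source hpφ hne))] with q hq
    rw [hq, h1]
  rw [nhds_subtype_eq_comap, Filter.eventually_comap] at h2
  filter_upwards [h2, φ.open_source.mem_nhds hpφ,
    (isOpen_ne_fixed hτ.2.1).mem_nhds hne] with q hq hqφ hqne
  exact (mem_positivePart_iff ho h hqne hqφ).2 (hq ⟨q, hqne⟩ rfl)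

/-- Off the fixed curve, the positive part and its image under `τ` are disjoint open sets that cover
everything. -/
theorem isPreconnected_subset_positivePart (hτ : IsAntiholInvolution τ)
    (ho : IsOrientation (quotientAtlas τ) o) {U : Set S} (hU : IsPreconnected U)
    (hne : ∀ p ∈ U, τ p ≠ p) : U ⊆ positivePart τ o ∨ ∀ p ∈ U, p ∉ positivePart τ o := by
  have h1 := isOpen_positivePart hτ ho
  have h2 : IsOpen (τ ⁻¹' positivePart τ o) := h1.preimage hτ.2.1
  have h3 : Disjoint (positivePart τ o) (τ ⁻¹' positivePart τ o) := Set.disjoint_left.2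
    fun p hp hp' => (involution_mem_positivePart_iff hτ ho hp.1).1 hp' hp
  have h4 : U ⊆ positivePart τ o ∪ τ ⁻¹' positivePart τ o := by
    intro p hp
    by_cases h : p ∈ positivePart τ o
    · exact .inl h
    · exact .inr ((involution_mem_positivePart_iff hτ ho (hne p hp)).2 h)
  rcases hU.subset_or_subset h1 h2 h3 h4 with h | h
  · exact .inl h
  · exact .inr fun p hp => (involution_mem_positivePart_iff hτ ho (hne p hp)).1 (h hp)

end Quotient


/-! ### Boundary charts -/

section Boundary

variable {S : Type*} [TopologicalSpace S] [ChartedSpace ℂ S] {τ : S → S}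
  {o : OpenPartialHomeomorph (QuotientSurface τ) ℂ → QuotientSurface τ → ℤˣ}

theorem IsBoundaryChart.restrOpen [IsManifold 𝓘(ℂ) ω S] {φ : OpenPartialHomeomorph S ℂ}
    (hφ : IsBoundaryChart τ o φ) {U : Set S} (hU : IsOpen U) (hτU : ∀ p ∈ U, τ p ∈ U) :
    IsBoundaryChart τ o (φ.restrOpen U hU) :=
  ⟨hφ.1.restrOpen hU hτU, fun p hp => hφ.2 p hp.1⟩

/-- The upper half plane decides the lower one, because `τ` exchanges them and also exchanges
positive and non-positive points. -/
theorem IsRealChart.isBoundaryChart [T2Space S] [IsManifold 𝓘(ℂ) ω S]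
    (hτ : IsAntiholInvolution τ) (ho : IsOrientation (quotientAtlas τ) o)
    {φ : OpenPartialHomeomorph S ℂ} (hφ : IsRealChart τ φ)
    (h : ∀ p ∈ φ.source, 0 < (φ p).im → p ∈ positivePart τ o) : IsBoundaryChart τ o φ := by
  refine ⟨hφ, fun p hp => ⟨fun hpos => ?_, h p hp⟩⟩
  by_contra him
  rcases (not_lt.1 him).eq_or_lt with h0 | h0
  · exact hpos.1 (hφ.fixed_of_im_eq_zero hp h0)
  · refine (involution_mem_positivePart_iff hτ ho hpos.1).1 (h _ (hφ.2 p hp).1 ?_) hpos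
    rw [(hφ.2 p hp).2, Complex.conj_im]
    linarith

/-- Near a fixed point there are arbitrarily small boundary charts whose image is a disc. -/
theorem exists_isBoundaryChart [T2Space S] [IsManifold 𝓘(ℂ) ω S]
    (hτ : IsAntiholInvolution τ) (ho : IsOrientation (quotientAtlas τ) o) {c : S} (hc : τ c = c)
    {N : Set S} (hN : N ∈ 𝓝 c) : ∃ φ r, IsBoundaryChart τ o φ ∧ c ∈ φ.source ∧ φ.source ⊆ N ∧
      φ.target = Metric.ball (φ c) r := by
  obtain ⟨φ, hφ, hcφ⟩ := exists_isRealChart hτ hc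
  have h1 : ∀ᶠ u in 𝓝 (φ c), u ∈ φ.target ∧ φ.symm u ∈ N :=
    .and (φ.open_target.mem_nhds (φ.map_source hcφ)) (eventually_leftInverse hcφ hN)
  obtain ⟨r, hr, hball⟩ := Metric.mem_nhds_iff.1 h1
  have hDo : IsOpen (φ.source ∩ φ ⁻¹' Metric.ball (φ c) r) :=
    φ.isOpen_inter_preimage Metric.isOpen_ball
  have hcc : conj (φ c) = φ c := Complex.conj_eq_iff_im.2 (hφ.im_eq_zero hcφ hc)
  have hconj (u : ℂ) : dist (conj u) (φ c) = dist u (φ c) := by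
    conv_lhs => rw [← hcc]
    exact Complex.dist_conj_conj u _
  let φ₁ := φ.restrOpen _ hDo
  have hφ₁ : IsRealChart τ φ₁ := hφ.restrOpen hDo fun p hp =>
    ⟨(hφ.2 p hp.1).1, by rw [Set.mem_preimage, (hφ.2 p hp.1).2, Metric.mem_ball, hconj]; exact hp.2⟩
  have hsymm {u : ℂ} (hu : u ∈ Metric.ball (φ c) r) : φ (φ.symm u) = u := φ.right_inv (hball hu).1
  have htarget : φ₁.target = Metric.ball (φ c) r := by
    ext u
    constructor
    · rintro ⟨hu, -, hu'⟩
      rwa [Set.mem_preimage, φ.right_inv hu] at hu'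
    · intro hu
      exact ⟨(hball hu).1, φ.map_target (hball hu).1, by rwa [Set.mem_preimage, hsymm hu]⟩
  have hcφ₁ : c ∈ φ₁.source := ⟨hcφ, hcφ, Metric.mem_ball_self hr⟩
  have hsub : φ₁.source ⊆ N := by
    rintro p ⟨hp, -, hp'⟩
    have := (hball hp').2
    rwa [φ.left_inv hp] at this
  -- The upper half disc is connected and contains no fixed points, so it lies entirely in `Σ⁺` or
  -- entirely outside.
  have hpre : IsPreconnected (φ₁.symm '' (Metric.ball (φ c) r ∩ {u | 0 < u.im})) := by
    refine ((convex_ball _ _).inter (convex_halfSpace_im_gt 0)).isPreconnected.image _ ?_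
    exact φ₁.symm.continuousOn.mono fun u hu => by
      rw [OpenPartialHomeomorph.symm_source, htarget]
      exact hu.1
  have hmem {p : S} (hp : p ∈ φ₁.source) (him : 0 < (φ p).im) :
      p ∈ φ₁.symm '' (Metric.ball (φ c) r ∩ {u | 0 < u.im}) :=
    ⟨φ₁ p, ⟨htarget ▸ φ₁.map_source hp, him⟩, φ₁.left_inv hp⟩
  have hfree : ∀ p ∈ φ₁.symm '' (Metric.ball (φ c) r ∩ {u | 0 < u.im}), τ p ≠ p := by
    rintro _ ⟨u, ⟨hu, him⟩, rfl⟩ hfix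
    have hu' : u ∈ φ₁.target := htarget ▸ hu
    have := hφ₁.im_eq_zero (φ₁.map_target hu') hfix
    rw [φ₁.right_inv hu'] at this
    exact him.ne' this
  rcases isPreconnected_subset_positivePart hτ ho hpre hfree with h | h
  · exact ⟨φ₁, r, hφ₁.isBoundaryChart hτ ho fun p hp him => h (hmem hp him), hcφ₁, hsub, htarget⟩
  -- If the upper half disc is on the wrong side, `-φ` is the required chart.
  · let φ₂ := φ₁.transHomeomorph (Homeomorph.neg ℂ)
    have hφ₂ : IsRealChart τ φ₂ := by
      refine ⟨hφ₁.1.transHomeomorph _ (fun u _ => analyticAt_id.neg) fun u => ?_, fun p hp =>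
        ⟨(hφ₁.2 p hp).1, ?_⟩⟩
      · have : deriv (fun u : ℂ => -u) u = -1 := (hasDerivAt_id u).neg.deriv
        exact this ▸ neg_ne_zero.2 one_ne_zero
      · change -(φ₁ (τ p)) = conj (-(φ₁ p))
        rw [(hφ₁.2 p hp).2, map_neg]
    refine ⟨φ₂, r, hφ₂.isBoundaryChart hτ ho fun p hp him => ?_, hcφ₁, hsub, ?_⟩
    · have him' : 0 < (-φ p).im := him
      have hne : τ p ≠ p := fun hfix => by
        have := hφ.im_eq_zero hp.1 hfix
        simp [this] at him'
      have h2 := h _ (hmem (hφ₁.2 p hp).1 (by rw [(hφ.2 p hp.1).2]; simpa using him'))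
      rw [involution_mem_positivePart_iff hτ ho hne] at h2
      exact not_not.1 h2
    · change (Homeomorph.neg ℂ).symm ⁻¹' φ₁.target = Metric.ball (-φ c) r
      rw [htarget]
      ext u
      change dist (-u) (φ c) < r ↔ dist u (-φ c) < r
      rw [← dist_neg_neg, neg_neg]

/-- At a fixed point, the derivative of the transition map between boundary charts is a positive
real number. -/
theorem IsBoundaryChart.deriv_pos [IsManifold 𝓘(ℂ) ω S] {φ φ' : OpenPartialHomeomorph S ℂ}
    (hφ : IsBoundaryChart τ o φ) (hφ' : IsBoundaryChart τ o φ') {c : S} (hc : τ c = c)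
    (hcφ : c ∈ φ.source) (hcφ' : c ∈ φ'.source) :
    0 < (deriv (φ' ∘ φ.symm) (φ c)).re ∧ (deriv (φ' ∘ φ.symm) (φ c)).im = 0 := by
  set f := φ' ∘ φ.symm with hf
  have hd : HasDerivAt f (deriv f (φ c)) (φ c) :=
    (hφ.1.1.analyticAt hφ'.1.1 hcφ hcφ').differentiableAt.hasDerivAt
  have hne : deriv f (φ c) ≠ 0 := hφ.1.1.deriv_ne_zero hφ'.1.1 hcφ hcφ'
  have hx := hφ.1.im_eq_zero hcφ hc
  have hev : ∀ᶠ u in 𝓝 (φ c), u ∈ φ.target ∧ φ.symm u ∈ φ'.source :=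
    .and (φ.open_target.mem_nhds (φ.map_source hcφ))
      (eventually_leftInverse hcφ (φ'.open_source.mem_nhds hcφ'))
  -- Direction `v = 1` stays real, so the derivative is real. Direction `v = i` enters the upper
  -- half plane, so its real part is not negative, and it is not zero.
  have hline (v : ℂ) : HasDerivAt (fun y : ℝ => (f (φ c + y * v)).im)
      (deriv f (φ c) * v).im 0 ∧ ∀ᶠ y : ℝ in 𝓝 0, φ c + y * v ∈ φ.target ∧
        φ.symm (φ c + y * v) ∈ φ'.source := by
    have h1 : HasDerivAt (fun y : ℝ => φ c + y * v) v 0 := by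
      simpa using ((Complex.ofRealCLM.hasDerivAt (x := (0 : ℝ))).mul_const v).const_add (φ c)
    constructor
    · have h2 : HasDerivAt f (deriv f (φ c)) (φ c + ((0 : ℝ) : ℂ) * v) := by simpa using hd
      have h3 := h2.comp (0 : ℝ) h1
      exact (Complex.imCLM.hasFDerivAt.comp_hasDerivAt (0 : ℝ) h3)
    · have h2 : Filter.Tendsto (fun y : ℝ => φ c + y * v) (𝓝 0) (𝓝 (φ c)) := by
        simpa using h1.continuousAt.tendsto
      exact h2.eventually hev
  have him : (deriv f (φ c)).im = 0 := by
    obtain ⟨h1, h2⟩ := hline 1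
    have h3 : HasDerivAt (fun y : ℝ => (f (φ c + y * 1)).im) 0 0 := by
      refine (hasDerivAt_const (0 : ℝ) (0 : ℝ)).congr_of_eventuallyEq ?_
      filter_upwards [h2] with y ⟨hy, hy'⟩
      refine hφ'.1.im_eq_zero hy' (hφ.1.fixed_of_im_eq_zero (φ.map_target hy) ?_)
      rw [φ.right_inv hy]
      simpa using hx
    simpa using h1.unique h3
  refine ⟨lt_of_le_of_ne ?_ fun h => hne (Complex.ext h.symm him), him⟩
  obtain ⟨h1, h2⟩ := hline Complex.I
  have h3 := h1.tendsto_slope_zero_right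
  have h4 : (deriv f (φ c) * Complex.I).im = (deriv f (φ c)).re := by simp
  rw [h4] at h3
  refine ge_of_tendsto h3 ?_
  filter_upwards [nhdsWithin_le_nhds h2, self_mem_nhdsWithin] with y ⟨hy, hy'⟩ hpos
  have h5 : (f (φ c)).im = 0 := by
    rw [hf, Function.comp_apply, φ.left_inv hcφ]
    exact hφ'.1.im_eq_zero hcφ' hc
  have h6 : 0 < (f (φ c + y * Complex.I)).im := by
    refine (hφ'.2 _ hy').1 ((hφ.2 _ (φ.map_target hy)).2 ?_)
    rw [φ.right_inv hy]
    simpa [hx] using hpos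
  simp only [zero_add, Complex.ofReal_zero, zero_mul, add_zero, h5, sub_zero, smul_eq_mul]
  exact mul_nonneg (inv_nonneg.2 (le_of_lt hpos)) h6.le

/-- The real coordinates of the fixed curve given by the boundary charts. -/
def boundaryCoords (τ : S → S) (o : OpenPartialHomeomorph (QuotientSurface τ) ℂ →
    QuotientSurface τ → ℤˣ) : Set (Set S × (S → ℝ)) :=
  (fun φ => (φ.source, fun p => (φ p).re)) '' {φ | IsBoundaryChart τ o φ}

theorem positiveArc_iff {w : Finset S} {c c' : S} :
    PositiveArc τ o w c c' ↔ MonoArc (puncturedCurve τ w) (boundaryCoords τ o) c c' := by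
  simp only [PositiveArc, MonoArc, boundaryCoords, Set.forall_mem_image, Set.mem_ofPred_eq]

theorem IsBoundaryChart.hasDerivAt_re [IsManifold 𝓘(ℂ) ω S] {φ φ' : OpenPartialHomeomorph S ℂ}
    (hφ : IsBoundaryChart τ o φ) (hφ' : IsBoundaryChart τ o φ') {c : S} (hc : τ c = c)
    (hcφ : c ∈ φ.source) (hcφ' : c ∈ φ'.source) :
    ∃ d : ℝ, 0 < d ∧ HasDerivAt (fun y : ℝ => (φ' (φ.symm y)).re) d (φ c).re := by
  refine ⟨_, (hφ.deriv_pos hφ' hc hcφ hcφ').1, ?_⟩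
  refine HasDerivAt.real_of_complex (e := φ' ∘ φ.symm) ?_
  rw [hφ.1.ofReal_re hcφ hc]
  exact (hφ.1.1.analyticAt hφ'.1.1 hcφ hcφ').differentiableAt.hasDerivAt

/-- Straight segments on the real axis of a convex chart are monotone for every other boundary
chart, by `IsBoundaryChart.deriv_pos`. -/
theorem IsBoundaryChart.isArcChart [IsManifold 𝓘(ℂ) ω S] {w : Finset S}
    {φ : OpenPartialHomeomorph S ℂ}
    (hφ : IsBoundaryChart τ o φ) (hconv : Convex ℝ φ.target) (hw : ∀ p ∈ w, p ∉ φ.source) :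
    IsArcChart (puncturedCurve τ w) (boundaryCoords τ o) φ.source (fun p => (φ p).re) := by
  have hleft {p : S} (hp : p ∈ puncturedCurve τ w ∩ φ.source) : φ.symm ((φ p).re : ℂ) = p := by
    rw [hφ.1.ofReal_re hp.2 hp.1.1, φ.left_inv hp.2]
  have htar {p : S} (hp : p ∈ puncturedCurve τ w ∩ φ.source) : (((φ p).re : ℝ) : ℂ) ∈ φ.target := by
    rw [hφ.1.ofReal_re hp.2 hp.1.1]
    exact φ.map_source hp.2
  have hright {y : ℝ} (hy : (y : ℂ) ∈ φ.target) :
      φ.symm y ∈ puncturedCurve τ w ∩ φ.source ∧ (φ (φ.symm y)).re = y := by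
    have h1 := φ.map_target hy
    refine ⟨⟨⟨hφ.1.fixed_of_im_eq_zero h1 ?_, fun h => hw _ h h1⟩, h1⟩, ?_⟩ <;>
    simp [φ.right_inv hy]
  have hord {x y : ℝ} (hx : (x : ℂ) ∈ φ.target) (hy : (y : ℂ) ∈ φ.target) {t : ℝ}
      (ht : t ∈ Set.Icc (0 : ℝ) 1) : ((x + t * (y - x) : ℝ) : ℂ) ∈ φ.target := by
    have := hconv hx hy (a := 1 - t) (b := t) (by linarith [ht.2]) ht.1 (by ring)
    convert this using 1
    simp only [Complex.real_smul]
    push_cast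
    ring
  refine ⟨⟨φ, hφ, rfl⟩, φ.open_source, ?_, ⟨fun y => φ.symm y, ?_, fun x hx => hleft hx⟩, ?_, ?_⟩
  · exact Complex.continuous_re.comp_continuousOn φ.continuousOn
  · refine φ.symm.continuousOn.comp Complex.continuous_ofReal.continuousOn ?_
    rintro _ ⟨p, hp, rfl⟩
    exact htar hp
  · rw [Set.ordConnected_iff]
    rintro _ ⟨p, hp, rfl⟩ _ ⟨q, hq, rfl⟩ hle y hy
    have hy' : (y : ℂ) ∈ φ.target := by
      rcases hle.eq_or_lt with heq | hlt
      · have : y = (φ p).re := le_antisymm (hy.2.trans_eq heq.symm) hy.1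
        rw [this]
        exact htar hp
      · have h0 : (φ q).re - (φ p).re ≠ 0 := (sub_pos.2 hlt).ne'
        have := hord (htar hp) (htar hq) (t := (y - (φ p).re) / ((φ q).re - (φ p).re))
          ⟨div_nonneg (by linarith [hy.1]) (by linarith),
            (div_le_one (sub_pos.2 hlt)).2 (by linarith [hy.2])⟩
        rwa [div_mul_cancel₀ _ h0, add_sub_cancel] at this
    exact ⟨_, (hright hy').1, (hright hy').2⟩
  · intro p hp q hq hlt
    set x := (φ p).re
    set y := (φ q).re
    have hγ (t : ℝ) (ht : t ∈ Set.Icc (0 : ℝ) 1) := hright (hord (htar hp) (htar hq) ht)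
    have hc : ContinuousOn (fun t : ℝ => φ.symm ((x + t * (y - x) : ℝ) : ℂ)) (Set.Icc 0 1) :=
      φ.symm.continuousOn.comp (by fun_prop) fun t ht => hord (htar hp) (htar hq) ht
    refine ⟨fun t => φ.symm ((x + t * (y - x) : ℝ) : ℂ), hc, ?_, ?_, fun t ht => (hγ t ht).1.1, ?_⟩
    · simpa using hleft hp
    · simpa using hleft hq
    · rintro _ ⟨φ', hφ', rfl⟩ s t hs hst ht hst'
      -- Chain rule: a positive transition derivative times the speed `y - x > 0` of the segment.
      have key (r : ℝ) (hr : r ∈ Set.Icc s t) : ∃ d : ℝ, 0 < d ∧ HasDerivAt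
          (fun r : ℝ => (φ' (φ.symm ((x + r * (y - x) : ℝ) : ℂ))).re) d r := by
        have h1 := hγ r ⟨hs.trans hr.1, hr.2.trans ht⟩
        obtain ⟨d, hd, hder⟩ := hφ.hasDerivAt_re hφ' h1.1.1.1 h1.1.2 (hst' r hr)
        rw [h1.2] at hder
        have h2 : HasDerivAt (fun r : ℝ => x + r * (y - x)) (y - x) r := by
          simpa using ((hasDerivAt_id r).mul_const (y - x)).const_add x
        exact ⟨d * (y - x), mul_pos hd (sub_pos.2 hlt), 
          HasDerivAt.comp (h₂ := fun v : ℝ => (φ' (φ.symm (v : ℂ))).re) r hder h2⟩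
      refine strictMonoOn_of_deriv_pos
        (f := fun r : ℝ => (φ' (φ.symm ((x + r * (y - x) : ℝ) : ℂ))).re) (convex_Icc s t) (fun r hr => ?_) (fun r hr => ?_)
        (Set.left_mem_Icc.2 hst.le) (Set.right_mem_Icc.2 hst.le) hst
      · obtain ⟨d, -, hd⟩ := key r hr
        exact hd.continuousAt.continuousWithinAt
      · obtain ⟨d, hd0, hd⟩ := key r (interior_subset hr)
        rw [hd.deriv]
        exact hd0

end Boundary


/-! ### The order on the punctured fixed curve -/

section Order

variable {S : Type*} [TopologicalSpace S] [ChartedSpace ℂ S]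

/-- A real surface with oriented quotient and with basepoints on every component of the fixed
curve. -/
structure IsPointedRealSurface (τ : S → S)
    (o : OpenPartialHomeomorph (QuotientSurface τ) ℂ → QuotientSurface τ → ℤˣ)
    (w : Finset S) : Prop where
  involution : IsAntiholInvolution τ
  orientation : IsOrientation (quotientAtlas τ) o
  meets (K : ConnectedComponents (fixedCurve τ)) :
    ∃ p : fixedCurve τ, (p : S) ∈ w ∧ ConnectedComponents.mk p = K

variable {τ : S → S} {o : OpenPartialHomeomorph (QuotientSurface τ) ℂ → QuotientSurface τ → ℤˣ}
  {w : Finset S} {ord : LinearOrder (ConnectedComponents (puncturedCurve τ w))}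

theorem PositiveArc.trans {a b c : S} (h : PositiveArc τ o w a b) (h' : PositiveArc τ o w b c) :
    PositiveArc τ o w a c :=
  positiveArc_iff.2 ((positiveArc_iff.1 h).trans (positiveArc_iff.1 h'))

theorem PositiveArc.mk_eq {a b : puncturedCurve τ w} (h : PositiveArc τ o w a b) :
    ConnectedComponents.mk a = ConnectedComponents.mk b :=
  (positiveArc_iff.1 h).mk_eq

theorem Precedes.trans {a b c : puncturedCurve τ w} (h : Precedes τ o w ord a b)
    (h' : Precedes τ o w ord b c) : Precedes τ o w ord a c := by
  rcases h with h | h <;> rcases h' with h' | h'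
  · exact .inl (@lt_trans _ ord.toPreorder _ _ _ h h')
  · exact .inl (h'.mk_eq ▸ h)
  · exact .inl (h.mk_eq ▸ h')
  · exact .inr (h.trans h')

variable [T2Space S] [IsManifold 𝓘(ℂ) ω S] (hs : IsPointedRealSurface τ o w)

include hs

theorem IsPointedRealSurface.exists_isBoundaryChart {c : S} (hc : c ∈ puncturedCurve τ w)
    {N : Set S} (hN : N ∈ 𝓝 c) : ∃ φ, IsBoundaryChart τ o φ ∧ c ∈ φ.source ∧ φ.source ⊆ N ∧
      (∀ p ∈ w, p ∉ φ.source) ∧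
      IsArcChart (puncturedCurve τ w) (boundaryCoords τ o) φ.source (fun p => (φ p).re) := by
  have hw : (w : Set S)ᶜ ∈ 𝓝 c := w.finite_toSet.isClosed.isOpen_compl.mem_nhds hc.2
  obtain ⟨φ, r, h1, h2, h3, h4⟩ := RealHF.exists_isBoundaryChart hs.involution hs.orientation hc.1
    (Filter.inter_mem hN hw)
  have h5 (p : S) (hp : p ∈ w) : p ∉ φ.source := fun hp' => (h3 hp').2 hp
  exact ⟨φ, h1, h2, fun p hp => (h3 hp).1, h5, h1.isArcChart (h4 ▸ convex_ball _ _) h5⟩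

theorem IsPointedRealSurface.exists_isArcChart (c : S) (hc : c ∈ puncturedCurve τ w) :
    ∃ U u, IsArcChart (puncturedCurve τ w) (boundaryCoords τ o) U u ∧ c ∈ U := by
  obtain ⟨φ, -, h1, -, -, h2⟩ := hs.exists_isBoundaryChart hc Filter.univ_mem
  exact ⟨_, _, h2, h1⟩

/-- The condition that every component of the fixed curve contains a basepoint enters here. -/
theorem IsPointedRealSurface.precedes_irrefl (c : puncturedCurve τ w) :
    ¬ Precedes τ o w ord c c := by
  rintro (h | h)
  · exact (ord.toPreorder.lt_iff_le_not_ge _ _).1 h |>.2 (ord.le_refl _)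
  · refine not_monoArc_self (C := fixedCurve τ) (fun p hp => hp.1)
      ⟨(w : Set S)ᶜ, w.finite_toSet.isClosed.isOpen_compl, rfl⟩ (fun K => ?_)
      hs.exists_isArcChart _ (positiveArc_iff.1 h)
    obtain ⟨p, hp, hK⟩ := hs.meets K
    exact ⟨p, fun h => h.2 hp, hK⟩

theorem IsPointedRealSurface.precedes_total {c c' : puncturedCurve τ w} (hne : c ≠ c') :
    Precedes τ o w ord c c' ∨ Precedes τ o w ord c' c := by
  by_cases h : ConnectedComponents.mk c = ConnectedComponents.mk c'
  · rcases comparable_of_mk_eq hs.exists_isArcChart h with h1 | h1 | h1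
    · exact .inl (.inr (positiveArc_iff.2 h1))
    · exact absurd (Subtype.ext h1) hne
    · exact .inr (.inr (positiveArc_iff.2 h1))
  · let := ord
    rcases lt_or_gt_of_ne h with h1 | h1
    · exact .inl (.inl h1)
    · exact .inr (.inl h1)

theorem IsPointedRealSurface.eventually_mk_eq (c : puncturedCurve τ w) :
    ∀ᶠ p in 𝓝 (c : S), ∀ hp : p ∈ puncturedCurve τ w,
      ConnectedComponents.mk ⟨p, hp⟩ = ConnectedComponents.mk c := by
  obtain ⟨U, u, hU, hc⟩ := hs.exists_isArcChart c c.2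
  filter_upwards [hU.isOpen.mem_nhds hc] with p hpU hp
  rcases hU.trichotomy ⟨hp, hpU⟩ ⟨c.2, hc⟩ with h | h | h
  · exact MonoArc.mk_eq (c := ⟨p, hp⟩) h
  · exact congrArg _ (Subtype.ext h)
  · exact (MonoArc.mk_eq (c' := ⟨p, hp⟩) h).symm

/-- The order on the punctured fixed curve is an open relation. -/
theorem IsPointedRealSurface.precedes_open {c c' : puncturedCurve τ w}
    (h : Precedes τ o w ord c c') : ∃ U ∈ 𝓝 (c : S), ∃ V ∈ 𝓝 (c' : S),
      ∀ p q : puncturedCurve τ w, (p : S) ∈ U → (q : S) ∈ V → Precedes τ o w ord p q := by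
  rcases h with h | h
  · refine ⟨_, hs.eventually_mk_eq c, _, hs.eventually_mk_eq c', fun p q hp hq => .inl ?_⟩
    have hp' : ConnectedComponents.mk p = ConnectedComponents.mk c := hp p.2
    have hq' : ConnectedComponents.mk q = ConnectedComponents.mk c' := hq q.2
    rw [hp', hq']
    exact h
  · obtain ⟨γ, hγ, h0, h1, hX, hm⟩ := positiveArc_iff.1 h
    -- The arc is cut in the middle, so its two ends can be perturbed independently.
    have hl := MonoArc.restrict hγ hX hm le_rfl (by norm_num : (0 : ℝ) < 1 / 2) (by norm_num)
    have hr := MonoArc.restrict hγ hX hm (by norm_num) (by norm_num : (1 / 2 : ℝ) < 1) le_rfl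
    rw [h0] at hl
    rw [h1] at hr
    obtain ⟨U, u, hU, hc⟩ := hs.exists_isArcChart c c.2
    obtain ⟨U', u', hU', hc'⟩ := hs.exists_isArcChart c' c'.2
    exact ⟨_, hl.eventually_left hU hc, _, hr.eventually_right hU' hc', fun p q hp hq =>
      .inr (positiveArc_iff.2 ((hp p.2).trans (hq q.2)))⟩

omit hs in
/-- `φ` is a boundary chart whose real coordinate increases in the order of the punctured fixed
curve. -/
def IsOrderedChart (τ : S → S) (o : OpenPartialHomeomorph (QuotientSurface τ) ℂ →
    QuotientSurface τ → ℤˣ) (w : Finset S)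
    (ord : LinearOrder (ConnectedComponents (puncturedCurve τ w)))
    (φ : OpenPartialHomeomorph S ℂ) : Prop :=
  IsBoundaryChart τ o φ ∧ ∀ c c' : puncturedCurve τ w, (c : S) ∈ φ.source → (c' : S) ∈ φ.source →
    Precedes τ o w ord c c' → (φ c).re < (φ c').re

omit hs [T2Space S] in
theorem IsOrderedChart.restrOpen {φ : OpenPartialHomeomorph S ℂ}
    (hφ : IsOrderedChart τ o w ord φ) {U : Set S} (hU : IsOpen U) (hτU : ∀ p ∈ U, τ p ∈ U) :
    IsOrderedChart τ o w ord (φ.restrOpen U hU) :=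
  ⟨hφ.1.restrOpen hU hτU, fun c c' hc hc' => hφ.2 c c' hc.1 hc'.1⟩

omit hs [T2Space S] in
/-- Translation of a chart by a real number. -/
theorem IsOrderedChart.add_real {φ : OpenPartialHomeomorph S ℂ}
    (hφ : IsOrderedChart τ o w ord φ) (R : ℝ) :
    IsOrderedChart τ o w ord (φ.transHomeomorph (Homeomorph.addRight (R : ℂ))) := by
  refine ⟨⟨⟨hφ.1.1.1.transHomeomorph _ (fun u _ => analyticAt_id.add analyticAt_const)
    fun u => ?_, fun p hp => ⟨(hφ.1.1.2 p hp).1, ?_⟩⟩, fun p hp => ?_⟩, fun c c' hc hc' h => ?_⟩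
  · have : deriv (fun u : ℂ => u + (R : ℂ)) u = 1 := ((hasDerivAt_id u).add_const _).deriv
    exact this ▸ one_ne_zero
  · change φ (τ p) + (R : ℂ) = conj (φ p + R)
    rw [(hφ.1.1.2 p hp).2, map_add, Complex.conj_ofReal]
  · rw [hφ.1.2 p hp]
    change _ ↔ 0 < (φ p + (R : ℂ)).im
    simp
  · change (φ c + (R : ℂ)).re < (φ c' + (R : ℂ)).re
    simpa using hφ.2 c c' hc hc' h

/-- In a chart with convex image, a wrong order of real coordinates would give an arc back and hence
a cycle. -/
theorem IsPointedRealSurface.exists_isOrderedChart {c : S} (hc : c ∈ puncturedCurve τ w)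
    {N : Set S} (hN : N ∈ 𝓝 c) :
    ∃ φ, IsOrderedChart τ o w ord φ ∧ c ∈ φ.source ∧ φ.source ⊆ N := by
  obtain ⟨φ, h1, h2, h3, h4, h5⟩ := hs.exists_isBoundaryChart hc hN
  refine ⟨φ, ⟨h1, fun a b ha hb hab => ?_⟩, h2, h3⟩
  by_contra hlt
  rcases (not_lt.1 hlt).eq_or_lt with h | h
  · have := h5.injOn ⟨b.2, hb⟩ ⟨a.2, ha⟩ h
    rw [Subtype.ext this] at hab
    exact hs.precedes_irrefl _ hab
  · exact hs.precedes_irrefl _ (hab.trans (.inr (positiveArc_iff.2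
      (h5.monoArc _ ⟨b.2, hb⟩ _ ⟨a.2, ha⟩ h))))

/-- Near a point that is not fixed there is an ordered chart that contains no fixed point. -/
theorem IsPointedRealSurface.exists_isOrderedChart_of_ne {p : S} (hp : τ p ≠ p) :
    ∃ φ, IsOrderedChart τ o w ord φ ∧ p ∈ φ.source := by
  classical
  have hτ := hs.involution
  have ho := hs.orientation
  wlog hpos : p ∈ positivePart τ o generalizing p
  · obtain ⟨φ, hφ, hmem⟩ := this (ne_of_ne hτ.1 hp)
      ((involution_mem_positivePart_iff hτ ho hp).2 hpos)
    exact ⟨φ, hφ, by simpa [hτ.1 p] using (hφ.1.1.2 _ hmem).1⟩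
  -- Translated so that `p` goes to `i`; near `p` the image then lies in the upper half plane.
  let ψ₀ := (chartAt ℂ p).transHomeomorph (Homeomorph.addRight (Complex.I - chartAt ℂ p p))
  have hψ₀ : IsHolChart ψ₀ := by
    refine (isHolChart_chartAt p).transHomeomorph _
      (fun u _ => analyticAt_id.add analyticAt_const) fun u => ?_
    have : deriv (fun u : ℂ => u + (Complex.I - chartAt ℂ p p)) u = 1 :=
      ((hasDerivAt_id u).add_const _).deriv
    exact this ▸ one_ne_zero
  have hpψ₀ : p ∈ ψ₀.source := mem_chart_source ℂ p
  have hψp : ψ₀ p = Complex.I := add_sub_cancel _ _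
  let U := positivePart τ o ∩ (ψ₀.source ∩ ψ₀ ⁻¹' {u | 0 < u.im})
  have hU : IsOpen U := (isOpen_positivePart hτ ho).inter
    (ψ₀.isOpen_inter_preimage (isOpen_lt continuous_const Complex.continuous_im))
  let ψ := ψ₀.restrOpen U hU
  have hψ : IsHolChart ψ := hψ₀.restrOpen hU
  have hpψ : p ∈ ψ.source := ⟨hpψ₀, hpos, hpψ₀, by simp [hψp]⟩
  have him {u : ℂ} (hu : u ∈ ψ.target) : 0 < u.im := by
    have := (ψ.map_target hu).2.2.2
    change 0 < (ψ (ψ.symm u)).im at this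
    rwa [ψ.right_inv hu] at this
  let T : S ≃ₜ S := ⟨⟨τ, τ, hτ.1, hτ.1⟩, hτ.2.1, hτ.2.1⟩
  -- The mirror chart `conj ∘ ψ ∘ τ` around `τ p`, with image in the lower half plane. Its union
  -- with `ψ` is a real chart.
  let χ := (T.transOpenPartialHomeomorph ψ).transHomeomorph
    Complex.conjCLE.toHomeomorph
  have hχs : χ.source = τ ⁻¹' ψ.source := rfl
  have hχ (q : S) : χ q = conj (ψ (τ q)) := rfl
  have hχh : IsHolChart χ := by
    refine isHolChart_of_local χ fun q hq => ?_
    have hq' : q ∈ (chartAt ℂ q).source := mem_chart_source ℂ q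
    refine ⟨chartAt ℂ q, _, isHolChart_chartAt q, hq', ?_,
      analyticAt_antihol hτ (isHolChart_chartAt q) hψ hq' hq,
      deriv_antihol_ne_zero hτ (isHolChart_chartAt q) hψ hq' hq⟩
    filter_upwards [(chartAt ℂ q).open_source.mem_nhds hq'] with r hr
    rw [(chartAt ℂ q).left_inv hr, hχ]
  have hs1 : Disjoint ψ.source χ.source := Set.disjoint_left.2 fun q hq hq' =>
    (involution_mem_positivePart_iff hτ ho hq.2.1.1).1 hq'.2.1 hq.2.1
  have ht1 : Disjoint ψ.target χ.target := Set.disjoint_left.2 fun u hu hu' => by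
    have h1 : 0 < u.im := him hu
    have h2 : 0 < (conj u).im := him hu'
    rw [Complex.conj_im] at h2
    linarith
  let θ := ψ.disjointUnion χ hs1 ht1
  have hθψ {q : S} (hq : q ∈ ψ.source) : θ q = ψ q := if_pos hq
  have hθχ {q : S} (hq : τ q ∈ ψ.source) : θ q = conj (ψ (τ q)) :=
    if_neg (Set.disjoint_right.1 hs1 hq)
  have hθ : IsRealChart τ θ := by
    refine ⟨hψ.disjointUnion hχh hs1 ht1, ?_⟩
    rintro q (hq | hq)
    · have hq' : τ (τ q) ∈ ψ.source := by rwa [hτ.1]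
      exact ⟨.inr hq', by rw [hθχ hq', hθψ hq, hτ.1]⟩
    · have hq : τ q ∈ ψ.source := hq
      exact ⟨.inl hq, by rw [hθψ hq, hθχ hq, Complex.conj_conj]⟩
  have hθb : IsBoundaryChart τ o θ := by
    refine hθ.isBoundaryChart hτ ho ?_
    rintro q (hq | hq) hq'
    · exact hq.2.1
    · have hq : τ q ∈ ψ.source := hq
      rw [hθχ hq, Complex.conj_im] at hq'
      have := him (ψ.map_source hq)
      linarith
  have hfree (q : S) (hq : q ∈ θ.source) : τ q ≠ q := by
    rcases hq with hq | hq
    · exact hq.2.1.1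
    · intro h
      have h1 : τ q ∈ positivePart τ o := hq.2.1
      exact h1.1 (by rw [hτ.1, h])
  exact ⟨θ, ⟨hθb, fun c c' hc => absurd c.2.1 (hfree c hc)⟩, .inl hpψ⟩

/-- An ordered chart can be enlarged by a point that follows the points of a finite subset of its
domain, at the price of shrinking the domain to a neighbourhood of this subset. -/
theorem IsOrderedChart.insert {φ χ : OpenPartialHomeomorph S ℂ} (hφ : IsOrderedChart τ o w ord φ)
    (hχ : IsOrderedChart τ o w ord χ) {F : Finset S} (hF : ∀ f ∈ F, f ∈ φ.source)
    (hFw : ∀ f ∈ F, f ∉ w) {p : S} (hp : p ∈ χ.source) (hpw : p ∉ w) (hpφ : p ∉ φ.source)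
    (hFp : ∀ c c' : puncturedCurve τ w, (c : S) ∈ F → (c' : S) = p → Precedes τ o w ord c c') :
    ∃ θ, IsOrderedChart τ o w ord θ ∧ (∀ f ∈ F, f ∈ θ.source) ∧ p ∈ θ.source := by
  classical
  have hτ := hs.involution
  -- Closing `F` under `τ` allows `τ`-invariant neighbourhoods.
  let F' := F ∪ F.image τ
  have hF' (f : S) (hf : f ∈ F') : f ∈ φ.source := by
    rcases Finset.mem_union.1 hf with h | h
    · exact hF f h
    · obtain ⟨g, hg, rfl⟩ := Finset.mem_image.1 h
      exact (hφ.1.1.2 g (hF g hg)).1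
  -- If `f` or `p` is not fixed, removing the fixed curve from its neighbourhood makes the order
  -- condition vacuous. Otherwise openness of the order is used.
  have hsep (f : S) (hf : f ∈ F') : ∃ U V : Set S, IsOpen U ∧ IsOpen V ∧ f ∈ U ∧ p ∈ V ∧
      Disjoint U V ∧ ∀ c q : puncturedCurve τ w, (c : S) ∈ U → (q : S) ∈ V →
        Precedes τ o w ord c q := by
    obtain ⟨U, V, hU, hV, hfU, hpV, hUV⟩ := t2_separation (fun h => hpφ (h ▸ hF' f hf) : f ≠ p)
    by_cases hff : τ f = f
    · have hfF : f ∈ F := by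
        rcases Finset.mem_union.1 hf with h | h
        · exact h
        · obtain ⟨g, hg, rfl⟩ := Finset.mem_image.1 h
          rw [hτ.1] at hff
          rwa [← hff]
      by_cases hpp : τ p = p
      · obtain ⟨U', hU', V', hV', hprec⟩ := hs.precedes_open
          (hFp ⟨f, hff, hFw f hfF⟩ ⟨p, hpp, hpw⟩ hfF rfl)
        refine ⟨U ∩ interior U', V ∩ interior V', hU.inter isOpen_interior, hV.inter isOpen_interior,
          ⟨hfU, mem_interior_iff_mem_nhds.2 hU'⟩, ⟨hpV, mem_interior_iff_mem_nhds.2 hV'⟩,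
          hUV.mono Set.inter_subset_left Set.inter_subset_left, fun c q hc hq =>
          hprec c q (interior_subset hc.2) (interior_subset hq.2)⟩
      · exact ⟨U, V ∩ {q | τ q ≠ q}, hU, hV.inter (isOpen_ne_fixed hτ.2.1), hfU, ⟨hpV, hpp⟩,
          hUV.mono_right Set.inter_subset_left, fun c q _ hq => absurd q.2.1 hq.2⟩
    · exact ⟨U ∩ {q | τ q ≠ q}, V, hU.inter (isOpen_ne_fixed hτ.2.1), hV, ⟨hfU, hff⟩, hpV,
        hUV.mono_left Set.inter_subset_left, fun c q hc _ => absurd c.2.1 hc.2⟩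
  choose! U V hU hV hfU hpV hUV hprec using hsep
  let U₁ := ⋃ f ∈ F', U f
  let V₁ := ⋂ f ∈ F', V f
  have hU₁ : IsOpen U₁ := isOpen_biUnion hU
  have hV₁ : IsOpen V₁ := isOpen_biInter_finset hV
  have hUV₁ {q : S} (h : q ∈ U₁) (h' : q ∈ V₁) : False := by
    obtain ⟨f, hf, hq⟩ := Set.mem_iUnion₂.1 h
    exact Set.disjoint_left.1 (hUV f hf) hq (Set.mem_iInter₂.1 h' f hf)
  -- The two pieces of the new chart will be separated by the vertical line `Re = R`, which makes
  -- both their images disjoint and the order correct.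
  obtain ⟨R, hR⟩ : ∃ R : ℝ, ∀ f ∈ F, (φ f).re < R := by
    obtain ⟨R, hR⟩ := (F.finite_toSet.image fun f => (φ f).re).bddAbove
    exact ⟨R + 1, fun f hf => by linarith [hR (Set.mem_image_of_mem (fun f => (φ f).re) hf)]⟩
  have hre {φ : OpenPartialHomeomorph S ℂ} (hφ : IsOrderedChart τ o w ord φ) {q : S}
      (hq : q ∈ φ.source) : (φ (τ q)).re = (φ q).re := by
    rw [(hφ.1.1.2 q hq).2, Complex.conj_re]
  let D₁ := (U₁ ∩ τ ⁻¹' U₁) ∩ (φ.source ∩ φ ⁻¹' {u | u.re < R})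
  have hD₁ : IsOpen D₁ := (hU₁.inter (hU₁.preimage hτ.2.1)).inter
    (φ.isOpen_inter_preimage (isOpen_lt Complex.continuous_re continuous_const))
  have hτD₁ (q : S) (hq : q ∈ D₁) : τ q ∈ D₁ := by
    refine ⟨⟨hq.1.2, ?_⟩, (hφ.1.1.2 q hq.2.1).1, ?_⟩
    · rw [Set.mem_preimage, hτ.1]
      exact hq.1.1
    · change (φ (τ q)).re < R
      rw [hre hφ hq.2.1]
      exact hq.2.2
  -- A union here, whereas `D₁` uses an intersection: `τ p` need not lie in `V₁`. Disjointness
  -- survives because points of `D₁` and their images under `τ` all lie in `U₁`.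
  let D₂ := (V₁ ∪ τ ⁻¹' V₁) ∩ (χ.source ∩ χ ⁻¹' {u | (χ p).re - 1 < u.re})
  have hD₂ : IsOpen D₂ := (hV₁.union (hV₁.preimage hτ.2.1)).inter
    (χ.isOpen_inter_preimage (isOpen_lt continuous_const Complex.continuous_re))
  have hτD₂ (q : S) (hq : q ∈ D₂) : τ q ∈ D₂ := by
    refine ⟨hq.1.symm.imp_right fun h => ?_, (hχ.1.1.2 q hq.2.1).1, ?_⟩
    · rwa [Set.mem_preimage, hτ.1]
    · change (χ p).re - 1 < (χ (τ q)).re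
      rw [hre hχ hq.2.1]
      exact hq.2.2
  let φ₁ := φ.restrOpen D₁ hD₁
  have hφ₁ : IsOrderedChart τ o w ord φ₁ := hφ.restrOpen hD₁ hτD₁
  -- The translation moves the line `Re = Re χ(p) - 1`, to the right of which `D₂` lies, onto `Re =
  -- R`.
  let χ₁ := (χ.restrOpen D₂ hD₂).transHomeomorph
    (Homeomorph.addRight ((R - ((χ p).re - 1) : ℝ) : ℂ))
  have hχ₁ : IsOrderedChart τ o w ord χ₁ := (hχ.restrOpen hD₂ hτD₂).add_real _
  have hlt₁ {q : S} (hq : q ∈ φ₁.source) : (φ₁ q).re < R := hq.2.2.2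
  have hlt₂ {q : S} (hq : q ∈ χ₁.source) : R < (χ₁ q).re := by
    have h1 : (χ p).re - 1 < (χ q).re := hq.2.2.2
    change R < (χ q + ((R - ((χ p).re - 1) : ℝ) : ℂ)).re
    rw [Complex.add_re, Complex.ofReal_re]
    linarith
  have hs1 : Disjoint φ₁.source χ₁.source := Set.disjoint_left.2 fun q hq hq' => by
    rcases hq'.2.1 with h | h
    · exact hUV₁ hq.2.1.1 h
    · exact hUV₁ hq.2.1.2 h
  have ht1 : Disjoint φ₁.target χ₁.target := Set.disjoint_left.2 fun u hu hu' => by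
    have h1 := hlt₁ (φ₁.map_target hu)
    have h2 := hlt₂ (χ₁.map_target hu')
    rw [φ₁.right_inv hu] at h1
    rw [χ₁.right_inv hu'] at h2
    linarith
  let θ := φ₁.disjointUnion χ₁ hs1 ht1
  have hθφ {q : S} (hq : q ∈ φ₁.source) : θ q = φ₁ q := if_pos hq
  have hθχ {q : S} (hq : q ∈ χ₁.source) : θ q = χ₁ q := if_neg (Set.disjoint_right.1 hs1 hq)
  have hθ : IsRealChart τ θ := by
    refine ⟨hφ₁.1.1.1.disjointUnion hχ₁.1.1.1 hs1 ht1, ?_⟩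
    rintro q (hq | hq)
    · obtain ⟨h1, h2⟩ := hφ₁.1.1.2 q hq
      exact ⟨.inl h1, by rw [hθφ h1, hθφ hq, h2]⟩
    · obtain ⟨h1, h2⟩ := hχ₁.1.1.2 q hq
      exact ⟨.inr h1, by rw [hθχ h1, hθχ hq, h2]⟩
  have hprec' {c c' : puncturedCurve τ w} (hc : (c : S) ∈ φ₁.source) (hc' : (c' : S) ∈ χ₁.source) :
      Precedes τ o w ord c c' := by
    obtain ⟨f, hf, hcf⟩ := Set.mem_iUnion₂.1 hc.2.1.1
    have h2 : (c' : S) ∈ V₁ := by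
      rcases hc'.2.1 with h | h
      · exact h
      · rwa [Set.mem_preimage, c'.2.1] at h
    exact hprec f hf c c' hcf (Set.mem_iInter₂.1 h2 f hf)
  refine ⟨θ, ⟨⟨hθ, ?_⟩, ?_⟩, fun f hf => .inl ⟨hF f hf, ?_⟩, .inr ⟨hp, .inl ?_, hp, ?_⟩⟩
  · rintro q (hq | hq)
    · rw [hθφ hq, hφ₁.1.2 q hq]
    · rw [hθχ hq, hχ₁.1.2 q hq]
  · rintro c c' (hc | hc) (hc' | hc') h
    · rw [hθφ hc, hθφ hc']
      exact hφ₁.2 c c' hc hc' h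
    · rw [hθφ hc, hθχ hc']
      exact (hlt₁ hc).trans (hlt₂ hc')
    · exact absurd (h.trans (hprec' hc' hc)) (hs.precedes_irrefl c)
    · rw [hθχ hc, hθχ hc']
      exact hχ₁.2 c c' hc hc' h
  · have hmem : f ∈ F' := Finset.mem_union_left _ hf
    have hmem' : τ f ∈ F' := Finset.mem_union_right _ (Finset.mem_image_of_mem τ hf)
    exact ⟨⟨Set.mem_iUnion₂.2 ⟨f, hmem, hfU f hmem⟩, Set.mem_iUnion₂.2 ⟨_, hmem', hfU _ hmem'⟩⟩,
      hF f hf, hR f hf⟩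
  · exact Set.mem_iInter₂.2 hpV
  · change (χ p).re - 1 < (χ p).re
    linarith

/-- Every finite set disjoint from `w` is contained in the domain of an ordered chart. -/
theorem IsPointedRealSurface.exists_isOrderedChart_of_finset [Nonempty S] (F : Finset S)
    (hF : ∀ p ∈ F, p ∉ w) : ∃ φ, IsOrderedChart τ o w ord φ ∧ ∀ p ∈ F, p ∈ φ.source := by
  classical
  have hreal (G : Finset (puncturedCurve τ w)) :
      ∃ φ, IsOrderedChart τ o w ord φ ∧ ∀ c ∈ G, (c : S) ∈ φ.source := by
    -- Points of `Ĉ` are added in increasing order, so the new point always follows the old ones.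
    have hsto : IsStrictTotalOrder (puncturedCurve τ w) (Precedes τ o w ord) :=
      { irrefl := hs.precedes_irrefl
        trans := fun _ _ _ => Precedes.trans
        trichotomous := fun a b h1 h2 => by
          by_contra hne
          rcases hs.precedes_total (ord := ord) hne with h | h
          exacts [h1 h, h2 h] }
    let := linearOrderOfSTO (Precedes τ o w ord)
    induction G using Finset.induction_on_max with
    | empty =>
      refine ⟨(chartAt ℂ (Classical.arbitrary S)).restrOpen ∅ isOpen_empty,
        ⟨⟨⟨(isHolChart_chartAt _).restrOpen _, ?_⟩, ?_⟩, ?_⟩, by simp⟩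
      · exact fun p hp => hp.2.elim
      · exact fun p hp => hp.2.elim
      · exact fun c c' hc => hc.2.elim
    | insert a s hlt ih =>
      obtain ⟨φ, hφ, hsφ⟩ := ih
      by_cases ha : (a : S) ∈ φ.source
      · exact ⟨φ, hφ, by simpa [ha] using hsφ⟩
      obtain ⟨χ, hχ, haχ, -⟩ := hs.exists_isOrderedChart (ord := ord) a.2 Filter.univ_mem
      obtain ⟨θ, h1, h2, h3⟩ := hφ.insert hs hχ (F := s.image (↑)) (by simpa using hsφ)
        (fun f hf => by
          obtain ⟨c, -, rfl⟩ := Finset.mem_image.1 hf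
          exact c.2.2) haχ a.2.2 ha fun c c' hc hc' => by
        obtain ⟨d, hd, hdc⟩ := Finset.mem_image.1 hc
        rw [Subtype.ext hc', ← Subtype.ext hdc]
        exact hlt d hd
      refine ⟨θ, h1, fun c hc => ?_⟩
      rcases Finset.mem_insert.1 hc with rfl | hc
      · exact h3
      · exact h2 _ (Finset.mem_image_of_mem _ hc)
  obtain ⟨φ₀, hφ₀, hmem₀⟩ := hreal (F.subtype _)
  -- Points off the fixed curve have no position in the order and can be added in any sequence. A
  -- point may already be covered, for instance as the mirror image of an earlier one.
  have hall (T : Finset S) (hT : T ⊆ F) : ∃ φ, IsOrderedChart τ o w ord φ ∧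
      ∀ p ∈ F, τ p = p ∨ p ∈ T → p ∈ φ.source := by
    induction T using Finset.induction_on with
    | empty =>
      refine ⟨φ₀, hφ₀, fun p hp hfix => ?_⟩
      rw [or_iff_left (Finset.notMem_empty p)] at hfix
      exact hmem₀ ⟨p, hfix, hF p hp⟩ (Finset.mem_subtype.2 hp)
    | insert a s has ih =>
      obtain ⟨φ, hφ, hsφ⟩ := ih ((Finset.subset_insert a s).trans hT)
      have haF : a ∈ F := hT (Finset.mem_insert_self a s)
      by_cases ha : a ∈ φ.source
      · refine ⟨φ, hφ, fun p hp h => ?_⟩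
        rw [Finset.mem_insert] at h
        rcases h with h | rfl | h
        exacts [hsφ p hp (.inl h), ha, hsφ p hp (.inr h)]
      have hafix : τ a ≠ a := fun h => ha (hsφ a haF (.inl h))
      obtain ⟨χ, hχ, haχ⟩ := hs.exists_isOrderedChart_of_ne (ord := ord) hafix
      obtain ⟨θ, h1, h2, h3⟩ := hφ.insert hs hχ (F := F.filter fun p => τ p = p ∨ p ∈ s)
        (fun f hf => hsφ f (Finset.mem_filter.1 hf).1 (Finset.mem_filter.1 hf).2)
        (fun f hf => hF f (Finset.mem_filter.1 hf).1) haχ (hF a haF) ha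
        fun c c' _ hc' => absurd (hc' ▸ c'.2.1) hafix
      refine ⟨θ, h1, fun p hp h => ?_⟩
      rw [Finset.mem_insert] at h
      rcases h with h | rfl | h
      · exact h2 p (Finset.mem_filter.2 ⟨hp, .inl h⟩)
      · exact h3
      · exact h2 p (Finset.mem_filter.2 ⟨hp, .inr h⟩)
  obtain ⟨φ, hφ, h⟩ := hall F subset_rfl
  exact ⟨φ, hφ, fun p hp => h p hp (.inr hp)⟩

end Order


/-! ### Charts of the fixed locus -/

section SymmetricProduct

variable {S : Type*} [TopologicalSpace S] {m : ℕ}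

/-- The projection `S^m → Sym^m(S)`. -/
def symMk (y : Fin m → S) : Sym S m := ⟨Finset.univ.val.map y, by simp⟩

theorem continuous_symMk : Continuous (symMk (S := S) (m := m)) := continuous_coinduced_rng

theorem isOpenMap_symMk : IsOpenMap (symMk (S := S) (m := m)) := by
  intro U hU
  refine isOpen_coinduced.2 (isOpen_preimage_image_of_perm (q := symMk (S := S) (m := m))
    (fun x y => ⟨fun h => exists_perm_of_map_univ_eq (congrArg Subtype.val h), ?_⟩) hU)
  rintro ⟨σ, rfl⟩
  exact Subtype.ext (map_univ_comp_perm y σ)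

theorem tendsto_nhds_symMk {β : Type*} {f : Sym S m → β} {l : Filter β} {y : Fin m → S}
    (h : Filter.Tendsto (f ∘ symMk) (𝓝 y) l) : Filter.Tendsto f (𝓝 (symMk y)) l :=
  (Filter.Tendsto.mono_left (Filter.tendsto_map'_iff.2 h)) (isOpenMap_symMk.nhds_le y)

theorem isOpen_setOf_forall_mem {U : Set S} (hU : IsOpen U) :
    IsOpen {x : Sym S m | ∀ p ∈ x.1, p ∈ U} := by
  refine isOpen_coinduced.2 ?_
  have : (symMk (S := S) (m := m)) ⁻¹' {x : Sym S m | ∀ p ∈ x.1, p ∈ U} =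
      Set.univ.pi fun _ => U := by
    ext y
    simp [symMk, -Fin.univ_val_map]
  exact this ▸ isOpen_set_pi Set.finite_univ fun _ _ => hU

end SymmetricProduct

section FixedLocus

variable {S : Type*} [TopologicalSpace S] {τ : S → S} {w : Finset S} {m : ℕ}

omit [TopologicalSpace S] in
theorem FixedLocus.card_points (x : FixedLocus τ w m) : x.points.card = m := x.1.2

omit [TopologicalSpace S] in
theorem FixedLocus.map_points (x : FixedLocus τ w m) : x.points.map τ = x.points :=
  congrArg Subtype.val x.2.1

omit [TopologicalSpace S] in
theorem FixedLocus.notMem_of_mem_points (x : FixedLocus τ w m) {p : S} (hp : p ∈ x.points) :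
    p ∉ w := fun h => x.2.2 p h hp

omit [TopologicalSpace S] in
theorem FixedLocus.points_injective :
    Function.Injective (FixedLocus.points : FixedLocus τ w m → Multiset S) :=
  fun _ _ h => Subtype.ext (Subtype.ext h)

omit [TopologicalSpace S] in
theorem FixedLocus.exists_points_eq {M : Multiset S} (hM : M.card = m) (hτ : M.map τ = M)
    (hw : ∀ p ∈ M, p ∉ w) : ∃ x : FixedLocus τ w m, x.points = M :=
  ⟨⟨⟨M, hM⟩, Subtype.ext hτ, fun p hp hp' => hw p hp' hp⟩, rfl⟩

omit [TopologicalSpace S] in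
theorem FixedLocus.exists_symMk_eq (x : FixedLocus τ w m) : ∃ y : Fin m → S, symMk y = x.1 := by
  obtain ⟨y, hy⟩ := exists_map_univ_eq _ x.card_points
  exact ⟨y, Subtype.ext hy⟩

/-- The tuples of points in the domain of `φ`. -/
def fixedDomain (τ : S → S) (w : Finset S) (m : ℕ) (φ : OpenPartialHomeomorph S ℂ) :
    Set (FixedLocus τ w m) := {x | ∀ p ∈ x.points, p ∈ φ.source}

/-- The real elementary symmetric functions of the coordinates of the points of a tuple. -/
noncomputable def fixedCoord (φ : OpenPartialHomeomorph S ℂ) (x : FixedLocus τ w m) :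
    Fin m → ℝ := fun i => (coeffVec m (x.points.map φ) i).re

theorem isOpen_fixedDomain (φ : OpenPartialHomeomorph S ℂ) : IsOpen (fixedDomain τ w m φ) :=
  (isOpen_setOf_forall_mem φ.open_source).preimage continuous_subtype_val

theorem continuousAt_fixedCoord {φ : OpenPartialHomeomorph S ℂ} {x : FixedLocus τ w m}
    (hx : x ∈ fixedDomain τ w m φ) : ContinuousAt (fixedCoord φ) x := by
  obtain ⟨y, hy⟩ := x.exists_symMk_eq
  have hmem (i : Fin m) : y i ∈ φ.source := by
    refine hx _ ?_
    change y i ∈ x.1.1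
    rw [← hy]
    exact Multiset.mem_map_of_mem _ (Finset.mem_univ_val i)
  let f : Sym S m → Fin m → ℝ := fun x i => (coeffVec m (x.1.map φ) i).re
  have hf : Filter.Tendsto f (𝓝 x.1) (𝓝 (f x.1)) := by
    rw [← hy]
    refine tendsto_nhds_symMk ?_
    have h1 : ContinuousAt (fun y : Fin m → S => fun i => φ (y i)) y :=
      continuousAt_pi.2 fun i => ContinuousAt.comp (f := fun y : Fin m → S => y i)
        (φ.continuousAt (hmem i)) (continuous_apply i).continuousAt
    have h2 : f ∘ symMk = (fun a : Fin m → ℂ => fun i => (a i).re) ∘ rootMap m ∘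
        (fun y : Fin m → S => fun i => φ (y i)) := by
      funext y i
      simp only [f, Function.comp_apply, symMk, rootMap, Multiset.map_map, Function.comp_def]
    have h3 : Continuous fun a : Fin m → ℂ => fun i => (a i).re :=
      continuous_pi fun i => Complex.continuous_re.comp (continuous_apply i)
    have h4 := (h3.comp (continuous_rootMap m)).continuousAt.comp h1
    rw [← Function.comp_assoc] at h2
    have h5 : f (symMk y) = (f ∘ symMk) y := rfl
    rw [h5, h2]
    rw [Function.comp_assoc] at h2 ⊢
    exact h4
  exact hf.comp continuous_subtype_val.continuousAt

variable [ChartedSpace ℂ S]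

theorem IsRealChart.map_conj_points {φ : OpenPartialHomeomorph S ℂ} (hφ : IsRealChart τ φ)
    {M : Multiset S} (hM : M.map τ = M) (hx : ∀ p ∈ M, p ∈ φ.source) :
    (M.map φ).map conj = M.map φ := by
  conv_rhs => rw [← hM]
  rw [Multiset.map_map, Multiset.map_map]
  exact Multiset.map_congr rfl fun p hp => (hφ.2 p (hx p hp)).2.symm

theorem IsRealChart.ofReal_fixedCoord {φ : OpenPartialHomeomorph S ℂ} (hφ : IsRealChart τ φ)
    {x : FixedLocus τ w m} (hx : x ∈ fixedDomain τ w m φ) (i : Fin m) :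
    ((fixedCoord φ x i : ℝ) : ℂ) = coeffVec m (x.points.map φ) i :=
  ofReal_re_coeffVec (hφ.map_conj_points x.map_points hx) i

omit [ChartedSpace ℂ S] in
theorem map_symm_map {φ : OpenPartialHomeomorph S ℂ} {M : Multiset S}
    (hM : ∀ p ∈ M, p ∈ φ.source) : (M.map φ).map φ.symm = M := by
  rw [Multiset.map_map]
  conv_rhs => rw [← Multiset.map_id M]
  exact Multiset.map_congr rfl fun p hp => φ.left_inv (hM p hp)

theorem IsRealChart.injOn_fixedCoord {φ : OpenPartialHomeomorph S ℂ} (hφ : IsRealChart τ φ) :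
    Set.InjOn (fixedCoord φ) (fixedDomain τ w m φ) := by
  intro x hx y hy hxy
  have h1 : coeffVec m (x.points.map φ) = coeffVec m (y.points.map φ) := by
    funext i
    rw [← hφ.ofReal_fixedCoord hx, hxy, hφ.ofReal_fixedCoord hy]
  have h2 := coeffVec_injective (by simp [x.card_points]) (by simp [y.card_points]) h1
  apply FixedLocus.points_injective
  rw [← map_symm_map hx, h2, map_symm_map hy]

/-- Every vector close to the coordinates of `x` is the vector of coordinates of a point close
to `x`. -/
theorem IsRealChart.eventually_exists_fixedCoord [T2Space S] {φ : OpenPartialHomeomorph S ℂ}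
    (hφ : IsRealChart τ φ) {x : FixedLocus τ w m} (hx : x ∈ fixedDomain τ w m φ)
    {N : Set (FixedLocus τ w m)} (hN : N ∈ 𝓝 x) :
    ∀ᶠ a in 𝓝 (fixedCoord φ x), ∃ x' ∈ N ∩ fixedDomain τ w m φ, fixedCoord φ x' = a := by
  obtain ⟨y, hy⟩ := x.exists_symMk_eq
  have hmap : Finset.univ.val.map y = x.points := congrArg Subtype.val hy
  have hmem (i : Fin m) : y i ∈ x.points := by
    rw [← hmap]
    exact Multiset.mem_map_of_mem _ (Finset.mem_univ_val i)
  obtain ⟨N', hN', hNN'⟩ := mem_nhds_induced _ _ _ |>.1 hN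
  let r : Fin m → ℂ := fun i => φ (y i)
  have hr : rootMap m r = fun i => ((fixedCoord φ x i : ℝ) : ℂ) := by
    funext i
    rw [hφ.ofReal_fixedCoord hx, rootMap, ← hmap, Multiset.map_map]
    rfl
  have hsymm : ContinuousAt (fun s : Fin m → ℂ => fun i => φ.symm (s i)) r :=
    continuousAt_pi.2 fun i => ContinuousAt.comp (f := fun s : Fin m → ℂ => s i)
      (φ.symm.continuousAt (φ.map_source (hx _ (hmem i)))) (continuous_apply i).continuousAt
  have hry : (fun i => φ.symm (r i)) = y := funext fun i => φ.left_inv (hx _ (hmem i))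
  have h1 : ∀ᶠ s in 𝓝 r, symMk (fun i => φ.symm (s i)) ∈ N' := by
    have := (continuous_symMk.continuousAt (x := y))
    rw [← hry] at this
    have h2 := this.tendsto.comp hsymm.tendsto
    rw [hry, hy] at h2
    exact h2.eventually hN'
  have h2 : ∀ᶠ s in 𝓝 r, ∀ i, s i ∈ φ.target ∧ φ.symm (s i) ∉ w := by
    refine Filter.eventually_all.2 fun i => ?_
    have h3 : ∀ᶠ u in 𝓝 (r i), u ∈ φ.target ∧ φ.symm u ∉ w :=
      .and (φ.open_target.mem_nhds (φ.map_source (hx _ (hmem i))))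
        (eventually_leftInverse (P := fun q => q ∉ w) (hx _ (hmem i))
          (w.finite_toSet.isClosed.isOpen_compl.mem_nhds (x.notMem_of_mem_points (hmem i))))
    exact ((continuous_apply i).tendsto r).eventually h3
  have h3 := eventually_exists_rootMap r (h1.and h2)
  rw [hr] at h3
  have hcont : Continuous fun a : Fin m → ℝ => fun i => ((a i : ℝ) : ℂ) :=
    continuous_pi fun i => Complex.continuous_ofReal.comp (continuous_apply i)
  filter_upwards [(hcont.tendsto (fixedCoord φ x)).eventually h3] with a ⟨s, ⟨hs1, hs2⟩, hs3⟩
  -- Real coefficients make the multiset of roots invariant under conjugation, so its preimage is a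
  -- `τ`-invariant tuple.
  have hconj : (Finset.univ.val.map s).map conj = Finset.univ.val.map s := by
    refine map_conj_eq_of_coeffVec (m := m) (by simp) fun i => ?_
    have := congrFun hs3 i
    rw [rootMap] at this
    rw [this, Complex.ofReal_im]
  have hMτ : ((Finset.univ.val.map s).map φ.symm).map τ = (Finset.univ.val.map s).map φ.symm := by
    conv_rhs => rw [← hconj]
    refine (Multiset.map_map _ _ _).trans (.trans ?_ (Multiset.map_map _ _ _).symm)
    refine Multiset.map_congr rfl fun u hu => ?_
    obtain ⟨i, -, rfl⟩ := Multiset.mem_map.1 hu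
    have h4 := φ.map_target (hs2 i).1
    have h5 := hφ.2 _ h4
    rw [φ.right_inv (hs2 i).1] at h5
    rw [Function.comp_apply, Function.comp_apply, ← h5.2, φ.left_inv h5.1]
  have hmem' {p : S} (hp : p ∈ (Finset.univ.val.map s).map φ.symm) : p ∈ φ.source ∧ p ∉ w := by
    rw [Multiset.map_map] at hp
    obtain ⟨i, -, rfl⟩ := Multiset.mem_map.1 hp
    exact ⟨φ.map_target (hs2 i).1, (hs2 i).2⟩
  obtain ⟨x', hx'⟩ := FixedLocus.exists_points_eq (τ := τ) (w := w) (m := m)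
    (M := (Finset.univ.val.map s).map φ.symm) (by simp) hMτ fun p hp => (hmem' hp).2
  refine ⟨x', ⟨hNN' ?_, fun p hp => (hmem' (hx' ▸ hp)).1⟩, ?_⟩
  · have : x'.1 = symMk fun i => φ.symm (s i) := by
      refine Subtype.ext (hx'.trans ?_)
      rw [Multiset.map_map]
      rfl
    change x'.1 ∈ N'
    rwa [this]
  · funext i
    have h4 : ((Finset.univ.val.map s).map φ.symm).map φ = Finset.univ.val.map s := by
      rw [Multiset.map_map]
      conv_rhs => rw [← Multiset.map_id (Finset.univ.val.map s)]
      refine Multiset.map_congr rfl fun u hu => ?_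
      obtain ⟨i, -, rfl⟩ := Multiset.mem_map.1 hu
      exact φ.right_inv (hs2 i).1
    have h5 := congrFun hs3 i
    rw [rootMap] at h5
    rw [fixedCoord, hx', h4, h5, Complex.ofReal_re]

theorem IsRealChart.exists_mem_fixedLocusAtlas [T2Space S] {φ : OpenPartialHomeomorph S ℂ}
    (hφ : IsRealChart τ φ) [Nonempty (FixedLocus τ w m)] :
    ∃ e ∈ fixedLocusAtlas τ w m, e.source = fixedDomain τ w m φ ∧ ∀ x, e x = fixedCoord φ x := by
  let f : FixedLocus τ w m → Fin m → ℝ := fixedCoord φ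
  have hopen : IsOpenMap ((fixedDomain τ w m φ).domRestrict f) := by
    refine isOpenMap_iff_nhds_le.2 fun x N hN => ?_
    obtain ⟨N', hN', hsub⟩ := mem_nhds_induced _ _ _ |>.1 (Filter.mem_map.1 hN)
    filter_upwards [hφ.eventually_exists_fixedCoord x.2 hN'] with a ⟨x', hx', ha⟩
    have : (⟨x', hx'.2⟩ : fixedDomain τ w m φ) ∈
        (fixedDomain τ w m φ).domRestrict f ⁻¹' N := hsub hx'.1
    exact ha ▸ this
  let e := OpenPartialHomeomorph.ofContinuousOpenRestrict
    ((hφ.injOn_fixedCoord (w := w) (m := m)).bijOn_image.toPartialEquiv f _ _)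
    (fun x hx => (continuousAt_fixedCoord hx).continuousWithinAt) hopen (isOpen_fixedDomain φ)
  exact ⟨e, ⟨φ, hφ, rfl, fun x _ i => rfl⟩, rfl, fun x => rfl⟩

/-- The coordinate change between the charts of two real charts of the surface. -/
theorem eventually_fixedLocus_transition {φ φ' : OpenPartialHomeomorph S ℂ}
    (hφ : IsRealChart τ φ) {e e' : OpenPartialHomeomorph (FixedLocus τ w m) (Fin m → ℝ)}
    (he : e.source = fixedDomain τ w m φ)
    (heφ : ∀ x ∈ e.source, e x = fixedCoord φ x) (heφ' : ∀ x ∈ e'.source, e' x = fixedCoord φ' x)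
    {x : FixedLocus τ w m} (hx : x ∈ e.source) (hx' : x ∈ e'.source) :
    ∀ᶠ a in 𝓝 (e x), (e' ∘ e.symm) a =
      fun i => (transfer m (φ' ∘ φ.symm) (fun j => ((a j : ℝ) : ℂ)) i).re := by
  have h1 : ∀ᶠ a in 𝓝 (e x), e.symm a ∈ e'.source := by
    have := e.symm.continuousAt (e.map_source hx)
    rw [ContinuousAt, e.left_inv hx] at this
    exact this.eventually (e'.open_source.mem_nhds hx')
  filter_upwards [h1, e.open_target.mem_nhds (e.map_source hx)] with a ha ha'
  have h2 := e.map_target ha'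
  have h3 : (fun j => ((a j : ℝ) : ℂ)) = coeffVec m ((e.symm a).points.map φ) := by
    funext j
    rw [← hφ.ofReal_fixedCoord (he ▸ h2), ← heφ _ h2, e.right_inv ha']
  rw [Function.comp_apply, heφ' _ ha, h3,
    transfer_coeffVec _ (by simp [FixedLocus.card_points]), Multiset.map_map]
  funext i
  refine congrArg (fun M => (coeffVec m M i).re) (Multiset.map_congr rfl fun p hp => ?_)
  have hp' : p ∈ φ.source := by
    rw [he] at h2
    exact h2 p hp
  rw [Function.comp_apply, Function.comp_apply, φ.left_inv hp']

/-- The coordinate change is the restriction to real vectors of `transfer`, which is complex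
analytic even where points of the tuple coincide. -/
theorem contDiffAt_fixedLocus_transition [IsManifold 𝓘(ℂ) ω S]
    {e e' : OpenPartialHomeomorph (FixedLocus τ w m) (Fin m → ℝ)}
    (he : e ∈ fixedLocusAtlas τ w m) (he' : e' ∈ fixedLocusAtlas τ w m)
    {x : FixedLocus τ w m} (hx : x ∈ e.source) (hx' : x ∈ e'.source) :
    ContDiffAt ℝ ω (e' ∘ e.symm) (e x) := by
  obtain ⟨φ, hφ, hes, heφ⟩ := he
  obtain ⟨φ', hφ', hes', heφ'⟩ := he'
  have h1 := eventually_fixedLocus_transition hφ hes (fun x hx => funext (heφ x hx))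
    (fun x hx => funext (heφ' x hx)) hx hx'
  refine ContDiffAt.congr_of_eventuallyEq ?_ h1
  have hV : DifferentiableOn ℂ (φ' ∘ φ.symm) (φ.symm.trans φ').source :=
    (hφ.1.contDiffOn hφ'.1).differentiableOn (by simp)
  have h2 : (fun j => ((e x j : ℝ) : ℂ)) = coeffVec m (x.points.map φ) := by
    funext j
    rw [← hφ.ofReal_fixedCoord (by rw [hes] at hx; exact hx), heφ x hx]
    rfl
  have h3 : ContDiffAt ℂ ω (transfer m (φ' ∘ φ.symm)) (fun j => ((e x j : ℝ) : ℂ)) := by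
    refine contDiffAt_transfer (φ.symm.trans φ').open_source hV ?_
    rw [h2, roots_monicPoly_coeffVec (by simp [x.card_points])]
    intro u hu
    obtain ⟨p, hp, rfl⟩ := Multiset.mem_map.1 hu
    rw [hes] at hx
    rw [hes'] at hx'
    simp [hx p hp, hx' p hp]
  have h4 : ContDiff ℝ ω (fun a : Fin m → ℝ => fun j => ((a j : ℝ) : ℂ)) :=
    contDiff_pi.2 fun j => Complex.ofRealCLM.contDiff.comp (contDiff_apply ℝ ℝ j)
  have h5 : ContDiff ℝ ω (fun a : Fin m → ℂ => fun j => (a j).re) :=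
    contDiff_pi.2 fun j => Complex.reCLM.contDiff.comp (contDiff_apply ℝ ℂ j)
  have h6 := ContDiffAt.comp (g := transfer m (φ' ∘ φ.symm)) (e x) (h3.restrict_scalars ℝ)
    h4.contDiffAt
  exact ContDiffAt.comp (g := fun a : Fin m → ℂ => fun j => (a j).re) (e x) h5.contDiffAt h6

end FixedLocus

/-! ### Jacobian determinants of coordinate changes -/

section Jacobian

variable {X E : Type*} [TopologicalSpace X] [NormedAddCommGroup E] [NormedSpace ℝ E]

omit [NormedSpace ℝ E] in
theorem eventually_symm_mem {e e' : OpenPartialHomeomorph X E} {x : X} (hx : x ∈ e.source)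
    (hx' : x ∈ e'.source) : ∀ᶠ a in 𝓝 (e x), e.symm a ∈ e'.source := by
  have := e.symm.continuousAt (e.map_source hx)
  rw [ContinuousAt, e.left_inv hx] at this
  exact this.eventually (e'.open_source.mem_nhds hx')

theorem det_fderiv_trans {e e' e'' : OpenPartialHomeomorph X E} {x : X} (hx : x ∈ e.source)
    (hx' : x ∈ e'.source) (h : DifferentiableAt ℝ (e' ∘ e.symm) (e x))
    (h' : DifferentiableAt ℝ (e'' ∘ e'.symm) (e' x)) :
    (fderiv ℝ (e'' ∘ e.symm) (e x)).det =
      (fderiv ℝ (e'' ∘ e'.symm) (e' x)).det * (fderiv ℝ (e' ∘ e.symm) (e x)).det := by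
  have h1 : (e' ∘ e.symm) (e x) = e' x := by simp [hx]
  have h2 : (e'' ∘ e.symm) =ᶠ[𝓝 (e x)] (e'' ∘ e'.symm) ∘ (e' ∘ e.symm) := by
    filter_upwards [eventually_symm_mem hx hx'] with a ha
    simp [ha]
  rw [h2.fderiv_eq, fderiv_comp _ (by rwa [h1]) h, h1]
  exact LinearMap.det_comp _ _

theorem det_fderiv_self {e : OpenPartialHomeomorph X E} {x : X} (hx : x ∈ e.source) :
    (fderiv ℝ (e ∘ e.symm) (e x)).det = 1 := by
  have h : (e ∘ e.symm) =ᶠ[𝓝 (e x)] id := by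
    filter_upwards [e.open_target.mem_nhds (e.map_source hx)] with a ha
    exact e.right_inv ha
  rw [h.fderiv_eq, fderiv_id]
  exact LinearMap.det_id

theorem det_fderiv_mul_symm {e e' : OpenPartialHomeomorph X E} {x : X} (hx : x ∈ e.source)
    (hx' : x ∈ e'.source) (h : DifferentiableAt ℝ (e' ∘ e.symm) (e x))
    (h' : DifferentiableAt ℝ (e ∘ e'.symm) (e' x)) :
    (fderiv ℝ (e ∘ e'.symm) (e' x)).det * (fderiv ℝ (e' ∘ e.symm) (e x)).det = 1 := by
  rw [← det_fderiv_trans hx hx' h h', det_fderiv_self hx]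

end Jacobian


/-! ### Strata -/

/-- `transfer` is functorial, so an inverse of `f` induces a local inverse of `transfer m f`. -/
theorem det_fderiv_transfer_ne_zero {m : ℕ} {V V' : Set ℂ} (hV : IsOpen V) (hV' : IsOpen V')
    {f g : ℂ → ℂ} (hf : DifferentiableOn ℂ f V) (hg : DifferentiableOn ℂ g V')
    (hfV : Set.MapsTo f V V') (hgf : ∀ z ∈ V, g (f z) = z) {a : Fin m → ℂ}
    (ha : ∀ z ∈ (monicPoly a).roots, z ∈ V) : (fderiv ℂ (transfer m f) a).det ≠ 0 := by
  have h1 := (contDiffAt_transfer hV hf ha).differentiableAt (by simp)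
  have h2 : ∀ z ∈ (monicPoly (transfer m f a)).roots, z ∈ V' := by
    rw [transfer, roots_monicPoly_coeffVec (by simp [monicPoly_roots_card])]
    intro z hz
    obtain ⟨u, hu, rfl⟩ := Multiset.mem_map.1 hz
    exact hfV (ha u hu)
  have h3 := (contDiffAt_transfer hV' hg h2).differentiableAt (by simp)
  have h4 : transfer m g ∘ transfer m f =ᶠ[𝓝 a] id := by
    filter_upwards [eventually_roots_mem hV ha] with b hb
    rw [Function.comp_apply, transfer, transfer,
      roots_monicPoly_coeffVec (by simp [monicPoly_roots_card]), Multiset.map_map]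
    refine .trans ?_ (coeffVec_roots b)
    congr 1
    conv_rhs => rw [← Multiset.map_id (monicPoly b).roots]
    exact Multiset.map_congr rfl fun z hz => hgf z (hb z hz)
  have h5 := h4.fderiv_eq (𝕜 := ℂ)
  rw [fderiv_comp a h3 h1, fderiv_id] at h5
  have h6 := congrArg ContinuousLinearMap.det h5
  have h7 : ((fderiv ℂ (transfer m g) (transfer m f a)).comp (fderiv ℂ (transfer m f) a)).det =
      (fderiv ℂ (transfer m g) (transfer m f a)).det * (fderiv ℂ (transfer m f) a).det :=
    LinearMap.det_comp _ _
  rw [h7] at h6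
  have h8 : (ContinuousLinearMap.id ℂ (Fin m → ℂ)).det = 1 := LinearMap.det_id
  rw [h8] at h6
  exact right_ne_zero_of_mul (h6 ▸ one_ne_zero)

/-- A product of real functions has a diagonal derivative. -/
theorem exists_hasFDerivAt_pi {n : ℕ} {g : Fin n → ℝ → ℝ} {t d : Fin n → ℝ}
    (h : ∀ j, HasDerivAt (g j) (d j) (t j)) : ∃ B : (Fin n → ℝ) →L[ℝ] (Fin n → ℝ),
      HasFDerivAt (fun t j => g j (t j)) B t ∧ B.det = ∏ j, d j := by
  refine ⟨ContinuousLinearMap.pi fun j => d j • ContinuousLinearMap.proj j,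
    hasFDerivAt_pi.2 fun j => ?_, ?_⟩
  · exact (h j).comp_hasFDerivAt t (hasFDerivAt_apply j t)
  · rw [← Matrix.det_diagonal, ← LinearMap.det_toLin']
    rw [ContinuousLinearMap.det]
    congr 1
    ext t j
    simp [Matrix.mulVec_diagonal]

theorem map_stratumRoots {α : Type*} {k m : ℕ} {z : Fin k → α} {c : Fin (m - 2 * k) → α}
    {φ : α → ℂ} {τ : α → α} (hz : ∀ i, φ (τ (z i)) = conj (φ (z i)))
    (hc : ∀ j, (((φ (c j)).re : ℝ) : ℂ) = φ (c j)) :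
    stratumRoots (m := m) (coeffVec k (Finset.univ.val.map fun i => φ (z i)), fun j => (φ (c j)).re) =
      (Finset.univ.val.map z + Finset.univ.val.map (fun i => τ (z i)) +
        Finset.univ.val.map c).map φ := by
  simp only [stratumRoots, Multiset.map_add, Multiset.map_map]
  rw [roots_monicPoly_coeffVec (by simp), Multiset.map_map]
  simp only [Function.comp_def, hz, hc]

section Stratum

variable {S : Type*} [TopologicalSpace S] [ChartedSpace ℂ S] [IsManifold 𝓘(ℂ) ω S]
  {τ : S → S} {o : OpenPartialHomeomorph (QuotientSurface τ) ℂ → QuotientSurface τ → ℤˣ}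
  {w : Finset S} {ord : LinearOrder (ConnectedComponents (puncturedCurve τ w))} {m k : ℕ}

/-- The coordinate change first passes from the stratum charts to the single chart `φ` and then
multiplies polynomials. The first map is holomorphic in the coefficients of `Q` and increasing in
each `t_j`, so its determinant is positive. Hence the sign depends only on `m - 2k`. -/
theorem IsStratumChart.fderiv_det (hk : 2 * k ≤ m)
    {s e : OpenPartialHomeomorph (FixedLocus τ w m) (Fin m → ℝ)}
    (hsc : IsStratumChart τ o w ord m k s) {φ : OpenPartialHomeomorph S ℂ}
    (hφ : IsOrderedChart τ o w ord φ) (he : e.source = fixedDomain τ w m φ)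
    (heφ : ∀ x, e x = fixedCoord φ x) {x : FixedLocus τ w m} (hx : x ∈ s.source)
    (hx' : x ∈ e.source) : DifferentiableAt ℝ (e ∘ s.symm) (s x) ∧
      0 < (-1) ^ ((m - 2 * k) * (m - 2 * k - 1) / 2) * (fderiv ℝ (e ∘ s.symm) (s x)).det := by
  obtain ⟨ψ, Φ, hψ, hψpos, hΦ, hs⟩ := hsc
  let T := transfer k (φ ∘ ψ.symm)
  let g : Fin (m - 2 * k) → ℝ → ℝ := fun j y => (φ ((Φ j).symm y)).re
  let Λ := interleaveEquiv hk
  have key (y : FixedLocus τ w m) (hy : y ∈ s.source) (hy' : y ∈ e.source) :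
      ∃ (z : Fin k → S) (c : Fin (m - 2 * k) → puncturedCurve τ w),
      (∀ i, z i ∈ ψ.source) ∧ (∀ j, (c j : S) ∈ (Φ j).source) ∧
      (∀ i, z i ∈ φ.source) ∧ (∀ j, (c j : S) ∈ φ.source) ∧
      (∀ i j, i < j → Precedes τ o w ord (c i) (c j)) ∧
      Λ.symm (s y) = (coeffVec k (Finset.univ.val.map fun i => ψ (z i)),
        fun j => (Φ j (c j)).re) ∧
      T (Λ.symm (s y)).1 = coeffVec k (Finset.univ.val.map fun i => φ (z i)) ∧
      (fun j => g j ((Λ.symm (s y)).2 j)) = (fun j => (φ (c j)).re) ∧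
      e y = stratumMap m k (coeffVec k (Finset.univ.val.map fun i => φ (z i)),
        fun j => (φ (c j)).re) := by
    obtain ⟨z, c, h1, h2, h3, h4, h5⟩ := hs y hy
    have hmem : ∀ p ∈ y.points, p ∈ φ.source := by
      rw [he] at hy'
      exact hy'
    have hz (i) : z i ∈ φ.source := hmem _ (by rw [h4]; simp [-Fin.univ_val_map])
    have hc (j) : (c j : S) ∈ φ.source := hmem _ (by rw [h4]; simp [-Fin.univ_val_map])
    have h6 : Λ.symm (s y) = (coeffVec k (Finset.univ.val.map fun i => ψ (z i)),
        fun j => (Φ j (c j)).re) := by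
      rw [ContinuousLinearEquiv.symm_apply_eq, interleaveEquiv_apply, h5]
      simp only [Multiset.map_map]
      rfl
    refine ⟨z, c, h1, h2, hz, hc, h3, h6, ?_, ?_, ?_⟩
    · rw [h6]
      simp only [T]
      rw [transfer_coeffVec _ (by simp), Multiset.map_map]
      simp only [Function.comp_def, ψ.left_inv (h1 _)]
    · funext j
      rw [h6]
      simp only [g]
      rw [(hΦ j).1.ofReal_re (h2 j) (c j).2.1, (Φ j).left_inv (h2 j)]
    · rw [heφ]
      funext i
      rw [stratumMap, map_stratumRoots (τ := τ) (fun i => (hφ.1.1.2 _ (hz i)).2)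
        (fun j => hφ.1.1.ofReal_re (hc j) (c j).2.1), ← h4]
      rfl
  -- Only a factorisation of germs: the representatives `z` and `c` of a point may vary without any
  -- continuity, since only symmetric functions of `z` and the coordinates of `c` enter.
  have hev : e ∘ s.symm =ᶠ[𝓝 (s x)] (stratumMap m k ∘ Λ.symm) ∘
      (Λ ∘ Prod.map T (fun t j => g j (t j)) ∘ Λ.symm) := by
    filter_upwards [eventually_symm_mem hx hx', s.open_target.mem_nhds (s.map_source hx)] with b hb hb'
    obtain ⟨z, c, -, -, -, -, -, -, h1, h2, h3⟩ := key _ (s.map_target hb') hb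
    rw [s.right_inv hb'] at h1 h2
    simp only [Function.comp_apply, Λ.symm_apply_apply, Prod.map]
    rw [h3, h1, h2]
  obtain ⟨z, c, hzψ, hcΦ, hzφ, hcφ, hprec, hΛ, hT, hg, -⟩ := key x hx hx'
  have hroots : ∀ u ∈ (monicPoly (Λ.symm (s x)).1).roots, u ∈ (ψ.symm.trans φ).source := by
    rw [hΛ, roots_monicPoly_coeffVec (by simp)]
    intro u hu
    obtain ⟨i, -, rfl⟩ := Multiset.mem_map.1 hu
    simp [hzψ i, hzφ i]
  have hd1 : DifferentiableOn ℂ (φ ∘ ψ.symm) (ψ.symm.trans φ).source :=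
    (hψ.contDiffOn hφ.1.1.1).differentiableOn (by simp)
  have hd2 : DifferentiableOn ℂ (ψ ∘ φ.symm) (φ.symm.trans ψ).source :=
    (hφ.1.1.1.contDiffOn hψ).differentiableOn (by simp)
  have hA0 : (fderiv ℂ T (Λ.symm (s x)).1).det ≠ 0 := by
    refine det_fderiv_transfer_ne_zero (ψ.symm.trans φ).open_source (φ.symm.trans ψ).open_source
      hd1 hd2 ?_ ?_ hroots
    · rintro u ⟨hu, hu'⟩
      have hu' : ψ.symm u ∈ φ.source := hu'
      have hu : u ∈ ψ.target := hu
      exact ⟨φ.map_source hu', by simp [hu', hu]⟩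
    · rintro u ⟨hu, hu'⟩
      have hu' : ψ.symm u ∈ φ.source := hu'
      have hu : u ∈ ψ.target := hu
      simp [hu', hu]
  have hA := ((contDiffAt_transfer (ψ.symm.trans φ).open_source hd1 hroots).differentiableAt
    (by simp)).hasFDerivAt.restrictScalars ℝ
  have hd (j) := (hΦ j).hasDerivAt_re hφ.1 (c j).2.1 (hcΦ j) (hcφ j)
  choose d hd0 hd using hd
  have ht : (Λ.symm (s x)).2 = fun j => (Φ j (c j)).re := by rw [hΛ]
  obtain ⟨B, hB, hBdet⟩ := exists_hasFDerivAt_pi (g := g) (t := (Λ.symm (s x)).2) (d := d)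
    fun j => by
      rw [ht]
      exact hd j
  have hM := (Λ.hasFDerivAt (x := _)).comp (s x)
    ((hA.prodMap (Λ.symm (s x)) hB).comp (s x) (Λ.symm.hasFDerivAt (x := s x)))
  have hval : (Λ ∘ Prod.map T (fun t j => g j (t j)) ∘ Λ.symm) (s x) =
      Λ (coeffVec k (Finset.univ.val.map fun i => φ (z i)), fun j => (φ (c j)).re) := by
    simp only [Function.comp_apply, Prod.map]
    rw [hT, hg]
  have hG : DifferentiableAt ℝ (stratumMap m k ∘ Λ.symm)
      ((Λ ∘ Prod.map T (fun t j => g j (t j)) ∘ Λ.symm) (s x)) :=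
    ((contDiff_stratumMap m k).comp Λ.symm.contDiff).contDiffAt.differentiableAt (by simp)
  have hcomp := hG.hasFDerivAt.comp (s x) hM
  have hfin := hcomp.congr_of_eventuallyEq hev
  refine ⟨hfin.differentiableAt, ?_⟩
  rw [hfin.fderiv]
  have hdet : ∀ A B : (Fin m → ℝ) →L[ℝ] (Fin m → ℝ), (A ∘L B).det = A.det * B.det :=
    fun A B => LinearMap.det_comp _ _
  rw [hdet]
  have hpos := det_interleaveEquiv_conj hk (fderiv ℂ T (Λ.symm (s x)).1) B
  have hlast := det_fderiv_stratumMap_sign hk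
    (a := coeffVec k (Finset.univ.val.map fun i => φ (z i))) (t := fun j => (φ (c j)).re) ?_ ?_
  · rw [← mul_assoc]
    refine mul_pos ?_ ?_
    · rw [hval]
      exact hlast
    · refine lt_of_lt_of_eq ?_ hpos.symm
      rw [hBdet]
      exact mul_pos (Complex.normSq_pos.2 hA0) (Finset.prod_pos fun j _ => hd0 j)
  · rw [roots_monicPoly_coeffVec (by simp)]
    intro u hu
    obtain ⟨i, -, rfl⟩ := Multiset.mem_map.1 hu
    exact (hφ.1.2 _ (hzφ i)).1 (hψpos (hzψ i))
  · intro i j hij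
    exact hφ.2 _ _ (hcφ i) (hcφ j) (hprec i j hij)

end Stratum


/-! ### Tuples with distinct points -/

section Distinct

open Polynomial in
theorem monicPoly_add_single {n : ℕ} (a : Fin (n + 1) → ℂ) (b : ℂ) :
    monicPoly (a + Pi.single (Fin.last n) b) = monicPoly a + C ((-1) ^ (n + 1) * b) := by
  refine Polynomial.funext fun x => ?_
  rw [eval_add, eval_C, eval_monicPoly, eval_monicPoly, Fin.sum_univ_castSucc,
    Fin.sum_univ_castSucc]
  have h (i : Fin n) : (Pi.single (Fin.last n) b : Fin (n + 1) → ℂ) i.castSucc = 0 := by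
    rw [Pi.single_apply, if_neg (Fin.castSucc_lt_last i).ne]
  simp only [Pi.add_apply, h, add_zero, Pi.single_eq_same, Fin.val_last, Nat.add_sub_cancel,
    Nat.sub_self, pow_zero, mul_one]
  ring

/-- Adding a constant to `P` creates a multiple root only if the constant is minus a critical value,
and a non-constant polynomial has finitely many of these. -/
theorem frequently_nodup_roots {m : ℕ} (a₀ : Fin m → ℝ) :
    ∃ᶠ a in 𝓝 a₀, (monicPoly fun i => ((a i : ℝ) : ℂ)).roots.Nodup := by
  classical
  match m, a₀ with
  | 0, a₀ =>
    refine (Filter.Eventually.of_forall fun a => ?_).frequently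
    rw [Multiset.card_eq_zero.1 (monicPoly_roots_card _)]
    exact Multiset.nodup_zero
  | n + 1, a₀ =>
    set P := monicPoly fun i => ((a₀ i : ℝ) : ℂ) with hP
    -- At a multiple root `r` of the perturbed polynomial, `P'(r) = 0` and `(-1)^(n+1) P(r) = -ε`.
    let B : Set ℝ := (fun r => -((-1) ^ (n + 1) * P.eval r).re) '' (P.derivative.roots.toFinset : Set ℂ)
    have hB : B.Finite := (Finset.finite_toSet _).image _
    have hfreq : ∃ᶠ ε in 𝓝 (0 : ℝ), ε ∈ Bᶜ :=
      mem_closure_iff_frequently.1 (hB.countable.dense_compl ℝ 0)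
    have htend : Filter.Tendsto (fun ε : ℝ => a₀ + Pi.single (Fin.last n) ε) (𝓝 0) (𝓝 a₀) := by
      have : Continuous fun ε : ℝ => a₀ + (Pi.single (Fin.last n) ε : Fin (n + 1) → ℝ) :=
        continuous_const.add (continuous_single (A := fun _ => ℝ) (Fin.last n))
      simpa using this.tendsto 0
    refine htend.frequently (hfreq.mono fun ε hε => ?_)
    have h1 : (fun i => (((a₀ + Pi.single (Fin.last n) ε : Fin (n + 1) → ℝ) i : ℝ) : ℂ)) =
        (fun i => ((a₀ i : ℝ) : ℂ)) + Pi.single (Fin.last n) (ε : ℂ) := by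
      funext i
      by_cases hi : i = Fin.last n
      · subst hi
        simp
      · simp [Pi.single_eq_of_ne hi]
    rw [h1, monicPoly_add_single, ← hP, Multiset.nodup_iff_count_le_one]
    intro r
    rw [Polynomial.count_roots]
    by_contra hlt
    have hne : P + Polynomial.C ((-1) ^ (n + 1) * (ε : ℂ)) ≠ 0 := by
      rw [hP, ← monicPoly_add_single]
      exact (monicPoly_monic _).ne_zero
    obtain ⟨h3, h2⟩ := (Polynomial.one_lt_rootMultiplicity_iff_isRoot hne).1 (not_le.1 hlt)
    rw [Polynomial.derivative_add, Polynomial.derivative_C, add_zero] at h2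
    have hne' : P.derivative ≠ 0 := fun h => by
      have := Polynomial.derivative_eq_zero.1 h
      rw [hP, monicPoly_natDegree] at this
      omega
    refine hε ⟨r, by simpa [hne'] using h2, ?_⟩
    rw [Polynomial.IsRoot, Polynomial.eval_add, Polynomial.eval_C] at h3
    have h4 : (-1 : ℂ) ^ (n + 1) * P.eval r = -ε := by
      have h5 : ((-1 : ℂ) ^ (n + 1)) * (-1) ^ (n + 1) = 1 := by
        rw [← mul_pow]
        simp
      linear_combination (-1 : ℂ) ^ (n + 1) * h3 - ε * h5
    simp only [h4, Complex.neg_re, Complex.ofReal_re, neg_neg]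

end Distinct

/-! ### Points in the interiors of the strata -/

section Strata

variable {S : Type*} [TopologicalSpace S] [ChartedSpace ℂ S] [IsManifold 𝓘(ℂ) ω S] [T2Space S]
  {τ : S → S} {o : OpenPartialHomeomorph (QuotientSurface τ) ℂ → QuotientSurface τ → ℤˣ}
  {w : Finset S} {ord : LinearOrder (ConnectedComponents (puncturedCurve τ w))} {m : ℕ}

/-- A tuple of distinct points lies in the interior of a stratum. -/
theorem exists_mem_stratumInterior_of_nodup (hτ : IsAntiholInvolution τ)
    (ho : IsOrientation (quotientAtlas τ) o) {x : FixedLocus τ w m} (hx : x.points.Nodup) :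
    ∃ k, 2 * k ≤ m ∧ x ∈ stratumInterior τ w m k := by
  classical
  let A := x.points.filter (· ∈ positivePart τ o)
  let B := x.points.filter fun p => τ p = p
  have hA : A.map τ = x.points.filter fun p => τ p ∈ positivePart τ o := by
    conv_rhs => rw [← x.map_points, Multiset.filter_map]
    simp only [A, Function.comp_def, hτ.1 _]
  have hsplit : x.points = A + A.map τ + B := by
    have h1 := Multiset.filter_add_not (· ∈ positivePart τ o) x.points
    have h2 := Multiset.filter_add_not (fun p => τ p ∈ positivePart τ o)
      (x.points.filter fun p => p ∉ positivePart τ o)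
    rw [Multiset.filter_filter, Multiset.filter_filter] at h2
    rw [hA, add_assoc]
    refine h1.symm.trans (congrArg _ (h2.symm.trans (congrArg₂ _ ?_ ?_)))
    · refine Multiset.filter_congr fun p _ => ⟨fun h => h.1, fun h => ⟨h, fun h' => ?_⟩⟩
      exact (involution_mem_positivePart_iff hτ ho h'.1).1 h h'
    · refine Multiset.filter_congr fun p _ => ⟨fun h => ?_, fun h => ⟨?_, fun h' => h'.1 h⟩⟩
      · by_contra hne
        exact h.1 ((involution_mem_positivePart_iff hτ ho hne).2 h.2)
      · rw [h]
        exact fun h' => h'.1 h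
  have hcard : A.card + A.card + B.card = m := by
    rw [← x.card_points, hsplit]
    simp
  obtain ⟨k, hk⟩ : ∃ k, A.card = k := ⟨_, rfl⟩
  obtain ⟨z, hz⟩ := exists_map_univ_eq A hk
  obtain ⟨c, hc⟩ := exists_map_univ_eq (n := m - 2 * k) B (by omega)
  have hzA (i) : z i ∈ A := by
    rw [← hz]
    exact Multiset.mem_map_of_mem _ (Finset.mem_univ_val i)
  have hcB (j) : c j ∈ B := by
    rw [← hc]
    exact Multiset.mem_map_of_mem _ (Finset.mem_univ_val j)
  refine ⟨k, by omega, z, c, fun i => ?_, fun j => ?_, ?_, ?_⟩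
  · exact (Multiset.mem_filter.1 (hzA i)).2.1
  · obtain ⟨h1, h2⟩ := Multiset.mem_filter.1 (hcB j)
    exact ⟨h2, x.notMem_of_mem_points h1⟩
  · have h1 : (Finset.univ.val.map c).Nodup := hc ▸ hx.filter _
    intro i j hij
    exact Multiset.inj_on_of_nodup_map h1 i (Finset.mem_univ_val i) j (Finset.mem_univ_val j) hij
  · have h1 : Finset.univ.val.map (fun i => τ (z i)) = A.map τ := by
      rw [← hz, Multiset.map_map]
      rfl
    rw [h1, hc, hz]
    exact hsplit

/-- A point in the interior of a stratum has representatives in the positive part and on the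
punctured curve, the latter in increasing order. -/
theorem exists_ordered_representatives (hs : IsPointedRealSurface τ o w) {k : ℕ}
    {x : FixedLocus τ w m} (hx : x ∈ stratumInterior τ w m k) {φ : OpenPartialHomeomorph S ℂ}
    (hφ : IsOrderedChart τ o w ord φ) (hxφ : ∀ p ∈ x.points, p ∈ φ.source) :
    ∃ (z : Fin k → S) (c : Fin (m - 2 * k) → S), (∀ i, z i ∈ positivePart τ o) ∧
      (∀ j, c j ∈ puncturedCurve τ w) ∧ StrictMono (fun j => (φ (c j)).re) ∧
      x.points = Finset.univ.val.map z + Finset.univ.val.map (fun i => τ (z i)) +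
        Finset.univ.val.map c := by
  classical
  have hτ := hs.involution
  obtain ⟨z, c, hz, hc, hinj, hpts⟩ := hx
  have hcφ (j) : c j ∈ φ.source := hxφ _ (by rw [hpts]; simp [-Fin.univ_val_map])
  -- From each pair `z i`, `τ (z i)` the member in `Σ⁺` is chosen, and the `c j` are sorted by their
  -- real coordinates.
  let z' : Fin k → S := fun i => if z i ∈ positivePart τ o then z i else τ (z i)
  let σ := Tuple.sort fun j => (φ (c j)).re
  refine ⟨z', c ∘ σ, fun i => ?_, fun j => hc _, ?_, ?_⟩
  · by_cases h : z i ∈ positivePart τ o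
    · simp [z', h]
    · simpa [z', h] using (involution_mem_positivePart_iff hτ hs.orientation (hz i)).2 h
  · refine (Tuple.monotone_sort fun j => (φ (c j)).re).strictMono_of_injective ?_
    intro i j hij
    apply σ.injective
    apply hinj
    refine φ.injOn (hcφ _) (hcφ _) ?_
    have h1 := hφ.1.1.ofReal_re (hcφ (σ i)) (hc (σ i)).1
    have h2 := hφ.1.1.ofReal_re (hcφ (σ j)) (hc (σ j)).1
    exact h1.symm.trans ((congrArg (fun r : ℝ => (r : ℂ)) hij).trans h2)
  · rw [map_univ_comp_perm, hpts]
    congr 1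
    have h1 (f : Fin k → S) : Finset.univ.val.map f = ∑ i, {f i} := by
      rw [Finset.sum, ← Function.comp_def (fun x => ({x} : Multiset S)) f, ← Multiset.map_map,
        Multiset.sum_map_singleton]
    rw [h1, h1, h1, h1, ← Finset.sum_add_distrib, ← Finset.sum_add_distrib]
    refine Finset.sum_congr rfl fun i _ => ?_
    by_cases h : z i ∈ positivePart τ o
    · simp [z', h]
    · simp only [z', h, if_false, hτ.1 _]
      exact add_comm _ _

end Strata


/-! ### Existence of stratum charts -/

section Strata

variable {S : Type*} [TopologicalSpace S] [ChartedSpace ℂ S] [IsManifold 𝓘(ℂ) ω S] [T2Space S]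
  {τ : S → S} {o : OpenPartialHomeomorph (QuotientSurface τ) ℂ → QuotientSurface τ → ℤˣ}
  {w : Finset S} {ord : LinearOrder (ConnectedComponents (puncturedCurve τ w))} {m k : ℕ}

/-- Every point in the interior of a stratum lies in the domain of a stratum chart. -/
theorem IsPointedRealSurface.exists_isStratumChart (hs : IsPointedRealSurface τ o w)
    (hk : 2 * k ≤ m) {x : FixedLocus τ w m} (hx : x ∈ stratumInterior τ w m k)
    {φ : OpenPartialHomeomorph S ℂ} (hφ : IsOrderedChart τ o w ord φ)
    (hxφ : ∀ p ∈ x.points, p ∈ φ.source) :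
    ∃ s, IsStratumChart τ o w ord m k s ∧ x ∈ s.source := by
  have hτ := hs.involution
  have hne : Nonempty (FixedLocus τ w m) := ⟨x⟩
  obtain ⟨e, -, hes, heφ⟩ := hφ.1.1.exists_mem_fixedLocusAtlas (w := w) (m := m)
  obtain ⟨z, c, hz, hc, hmono, hpts⟩ := exists_ordered_representatives hs hx hφ hxφ
  have hzφ (i) : z i ∈ φ.source := hxφ _ (by rw [hpts]; simp [-Fin.univ_val_map])
  have hcφ (j) : c j ∈ φ.source := hxφ _ (by rw [hpts]; simp [-Fin.univ_val_map])
  let Λ := interleaveEquiv hk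
  let a₀ : Fin k → ℂ := coeffVec k (Finset.univ.val.map fun i => φ (z i))
  let t₀ : Fin (m - 2 * k) → ℝ := fun j => (φ (c j)).re
  let G := stratumMap m k ∘ Λ.symm
  let V : Set ℂ := φ.target ∩ {u | 0 < u.im}
  have hV : IsOpen V := φ.open_target.inter (isOpen_lt continuous_const Complex.continuous_im)
  have ha₀ : ∀ u ∈ (monicPoly a₀).roots, u ∈ V := by
    rw [roots_monicPoly_coeffVec (by simp)]
    intro u hu
    obtain ⟨i, -, rfl⟩ := Multiset.mem_map.1 hu
    exact ⟨φ.map_source (hzφ i), (hφ.1.2 _ (hzφ i)).1 (hz i)⟩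
  have hGsmooth : ContDiff ℝ ω G := (contDiff_stratumMap m k).comp Λ.symm.contDiff
  have hdet : (fderiv ℝ G (Λ (a₀, t₀))).det ≠ 0 := fun h => by
    have := det_fderiv_stratumMap_sign hk (fun u hu => (ha₀ u hu).2) hmono
    rw [h, mul_zero] at this
    exact this.false
  have hGder : HasFDerivAt G (((fderiv ℝ G (Λ (a₀, t₀))).toContinuousLinearEquivOfDetNeZero hdet :
      (Fin m → ℝ) ≃L[ℝ] (Fin m → ℝ)) : (Fin m → ℝ) →L[ℝ] (Fin m → ℝ)) (Λ (a₀, t₀)) := by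
    rw [ContinuousLinearMap.coe_toContinuousLinearEquivOfDetNeZero]
    exact (hGsmooth.contDiffAt.differentiableAt (by simp)).hasFDerivAt
  -- By the inverse function theorem a real polynomial near that of `x` factors uniquely as `Q ·
  -- conj Q · ∏ (X - t_j)` with `Q` and `t` near the given ones; these factors are the stratum
  -- coordinates.
  let Θ := hGsmooth.contDiffAt.toOpenPartialHomeomorph G hGder (by simp)
  have hΘ : (Θ : (Fin m → ℝ) → (Fin m → ℝ)) = G := rfl
  have hmemΘ : Λ (a₀, t₀) ∈ Θ.source :=
    hGsmooth.contDiffAt.mem_toOpenPartialHomeomorph_source hGder (by simp)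
  -- Open conditions under which the factors come from points of the surface: roots of `Q` in the
  -- upper part of the chart, real roots in the chart and in increasing order.
  let P (p : (Fin k → ℂ) × (Fin (m - 2 * k) → ℝ)) : Prop :=
    (∀ u ∈ (monicPoly p.1).roots, u ∈ V) ∧ (∀ j, (p.2 j : ℂ) ∈ φ.target) ∧ StrictMono p.2
  have hP : ∀ᶠ b in 𝓝 (Λ (a₀, t₀)), P (Λ.symm b) := by
    have h0 : Filter.Tendsto Λ.symm (𝓝 (Λ (a₀, t₀))) (𝓝 (a₀, t₀)) := by
      simpa using Λ.symm.continuous.tendsto (Λ (a₀, t₀))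
    have h1 : Filter.Tendsto (fun b => (Λ.symm b).1) (𝓝 (Λ (a₀, t₀))) (𝓝 a₀) :=
      (continuous_fst.tendsto _).comp h0
    have h2 (j) : Filter.Tendsto (fun b => (Λ.symm b).2 j) (𝓝 (Λ (a₀, t₀))) (𝓝 (t₀ j)) :=
      (((continuous_apply j).comp continuous_snd).tendsto _).comp h0
    refine (h1.eventually (eventually_roots_mem hV ha₀)).and (.and ?_ ?_)
    · refine Filter.eventually_all.2 fun j => ?_
      refine ((Complex.continuous_ofReal.tendsto (t₀ j)).comp (h2 j)).eventually
        (φ.open_target.mem_nhds ?_)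
      rw [hφ.1.1.ofReal_re (hcφ j) (hc j).1]
      exact φ.map_source (hcφ j)
    · have h3 : ∀ᶠ b in 𝓝 (Λ (a₀, t₀)), ∀ i j, i < j → (Λ.symm b).2 i < (Λ.symm b).2 j := by
        refine Filter.eventually_all.2 fun i => Filter.eventually_all.2 fun j => ?_
        by_cases hij : i < j
        · filter_upwards [(h2 i).eventually_lt (h2 j) (hmono hij)] with b hb _ using hb
        · exact .of_forall fun b h => absurd h hij
      filter_upwards [h3] with b hb i j hij using hb i j hij
  obtain ⟨W, hWsub, hWo, hmemW⟩ := mem_nhds_iff.1 hP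
  have hGx : G (Λ (a₀, t₀)) = e x := by
    rw [heφ]
    funext i
    simp only [G, Function.comp_apply, Λ.symm_apply_apply]
    rw [stratumMap, map_stratumRoots (τ := τ) (fun i => (hφ.1.1.2 _ (hzφ i)).2)
      (fun j => hφ.1.1.ofReal_re (hcφ j) (hc j).1), ← hpts]
    rfl
  let s := (e.trans Θ.symm).trans (OpenPartialHomeomorph.ofSet W hWo)
  have hxe : x ∈ e.source := by
    rw [hes]
    exact hxφ
  have hsymm : Θ.symm (e x) = Λ (a₀, t₀) := by
    rw [← hGx, ← hΘ, Θ.left_inv hmemΘ]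
  refine ⟨s, ?_, ⟨⟨hxe, ?_⟩, ?_⟩⟩
  · refine ⟨φ.restrOpen _ (isOpen_positivePart hτ hs.orientation), fun _ => φ,
      hφ.1.1.1.restrOpen _, fun p hp => hp.2, fun _ => hφ.1, fun y hy => ?_⟩
    obtain ⟨⟨hye, hyΘ⟩, hyW⟩ := hy
    have hyφ : y ∈ fixedDomain τ w m φ := hes ▸ (hye : y ∈ e.source)
    have hyΘ : e y ∈ Θ.target := hyΘ
    have hyW : Θ.symm (e y) ∈ W := hyW
    obtain ⟨⟨a, t⟩, hp⟩ : ∃ p, Λ.symm (Θ.symm (e y)) = p := ⟨_, rfl⟩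
    obtain ⟨h1, h2, h3⟩ := hWsub hyW
    rw [hp] at h1 h2 h3
    have hsy : s y = interleave a t := by
      change Θ.symm (e y) = Λ (a, t)
      rw [← hp, Λ.apply_symm_apply]
    obtain ⟨r, hr⟩ := exists_map_univ_eq _ (monicPoly_roots_card a)
    have hrV (i) : r i ∈ V := h1 _ (hr ▸ Multiset.mem_map_of_mem _ (Finset.mem_univ_val i))
    have har : a = coeffVec k (Finset.univ.val.map r) := by rw [hr, coeffVec_roots]
    have hmap : y.points.map φ = stratumRoots (m := m) (a, t) := by
      refine coeffVec_injective (m := m) (by simp [y.card_points]) (stratumRoots_card hk _) ?_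
      funext i
      rw [← hφ.1.1.ofReal_fixedCoord hyφ, ← heφ, ← ofReal_stratumMap]
      have : e y = stratumMap m k (a, t) := by
        rw [← hp]
        exact (Θ.right_inv hyΘ).symm
      rw [this]
    have hroot (i) : φ (φ.symm (r i)) = r i := φ.right_inv (hrV i).1
    have hreal (j) : φ (φ.symm (t j : ℂ)) = t j := φ.right_inv (h2 j)
    have hrs (i) : φ.symm (r i) ∈ φ.source := φ.map_target (hrV i).1
    have hts (j) : φ.symm (t j : ℂ) ∈ φ.source := φ.map_target (h2 j)
    have hpts' : y.points = Finset.univ.val.map (fun i => φ.symm (r i)) +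
        Finset.univ.val.map (fun i => τ (φ.symm (r i))) +
        Finset.univ.val.map (fun j => φ.symm (t j : ℂ)) := by
      have h4 : stratumRoots (m := m) (a, t) = (Finset.univ.val.map (fun i => φ.symm (r i)) +
        Finset.univ.val.map (fun i => τ (φ.symm (r i))) +
        Finset.univ.val.map (fun j => φ.symm (t j : ℂ))).map φ := by
        rw [← map_stratumRoots (m := m) (fun i => (hφ.1.1.2 _ (hrs i)).2)
          (fun j => by rw [hreal, Complex.ofReal_re])]
        simp only [hroot, hreal, Complex.ofReal_re]
        rw [har]
      rw [← map_symm_map hyφ, hmap, h4, map_symm_map]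
      intro p hp
      simp only [Multiset.mem_add] at hp
      rcases hp with (hp | hp) | hp <;> obtain ⟨i, -, rfl⟩ := Multiset.mem_map.1 hp
      exacts [hrs i, (hφ.1.1.2 _ (hrs i)).1, hts i]
    have htX (j) : φ.symm (t j : ℂ) ∈ puncturedCurve τ w := by
      refine ⟨hφ.1.1.fixed_of_im_eq_zero (hts j) (by rw [hreal, Complex.ofReal_im]), ?_⟩
      refine y.notMem_of_mem_points ?_
      rw [hpts']
      exact Multiset.mem_add.2 (.inr (Multiset.mem_map_of_mem _ (Finset.mem_univ_val j)))
    refine ⟨fun i => φ.symm (r i), fun j => ⟨φ.symm (t j : ℂ), htX j⟩, fun i => ⟨hrs i, ?_⟩,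
      fun j => hts j, fun i j hij => ?_, hpts', ?_⟩
    · refine (hφ.1.2 _ (hrs i)).2 ?_
      rw [hroot]
      exact (hrV i).2
    · have hlt := h3 hij
      have hne : (⟨φ.symm (t i : ℂ), htX i⟩ : puncturedCurve τ w) ≠ ⟨φ.symm (t j : ℂ), htX j⟩ := by
        intro h
        have h5 := congrArg (fun q : puncturedCurve τ w => φ q) h
        simp only [hreal, Complex.ofReal_inj] at h5
        exact hlt.ne h5
      -- The opposite order would contradict the monotonicity of `Re φ`.
      refine (hs.precedes_total hne).resolve_right fun h => ?_
      have h5 := hφ.2 _ _ (hts j) (hts i) h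
      simp only [hreal, Complex.ofReal_re] at h5
      exact absurd hlt h5.not_gt
    · rw [hsy]
      congr 1
      · funext i
        rw [Multiset.map_map, har]
        change _ = Multiset.esymm (Finset.univ.val.map fun i => φ (φ.symm (r i))) (i + 1)
        simp only [hroot]
        rfl
      · funext j
        simp only [hreal, Complex.ofReal_re]
  · change e x ∈ Θ.target
    rw [← hGx]
    exact Θ.map_source hmemΘ
  · change Θ.symm (e x) ∈ W
    rwa [hsymm]

end Strata


/-! ### The orientation of the fixed locus -/

section Orientation

variable {S : Type*} [TopologicalSpace S] [ChartedSpace ℂ S] [IsManifold 𝓘(ℂ) ω S] [T2Space S]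
  {τ : S → S} {o : OpenPartialHomeomorph (QuotientSurface τ) ℂ → QuotientSurface τ → ℤˣ}
  {w : Finset S} {ord : LinearOrder (ConnectedComponents (puncturedCurve τ w))} {m : ℕ}

/-- The chart of the fixed locus given by an ordered chart. -/
def IsOrderedFixedChart (τ : S → S) (o : OpenPartialHomeomorph (QuotientSurface τ) ℂ →
    QuotientSurface τ → ℤˣ) (w : Finset S)
    (ord : LinearOrder (ConnectedComponents (puncturedCurve τ w))) (m : ℕ)
    (e : OpenPartialHomeomorph (FixedLocus τ w m) (Fin m → ℝ)) : Prop :=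
  e ∈ fixedLocusAtlas τ w m ∧ ∃ φ, IsOrderedChart τ o w ord φ ∧
    e.source = fixedDomain τ w m φ ∧ ∀ x, e x = fixedCoord φ x

omit [T2Space S] in
theorem differentiableAt_fixedLocus_transition
    {e e' : OpenPartialHomeomorph (FixedLocus τ w m) (Fin m → ℝ)}
    (he : e ∈ fixedLocusAtlas τ w m) (he' : e' ∈ fixedLocusAtlas τ w m) {x : FixedLocus τ w m}
    (hx : x ∈ e.source) (hx' : x ∈ e'.source) : DifferentiableAt ℝ (e' ∘ e.symm) (e x) :=
  (contDiffAt_fixedLocus_transition he he' hx hx').differentiableAt (by simp)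

omit [T2Space S] in
theorem det_fderiv_fixedLocus_ne_zero
    {e e' : OpenPartialHomeomorph (FixedLocus τ w m) (Fin m → ℝ)}
    (he : e ∈ fixedLocusAtlas τ w m) (he' : e' ∈ fixedLocusAtlas τ w m) {x : FixedLocus τ w m}
    (hx : x ∈ e.source) (hx' : x ∈ e'.source) : (fderiv ℝ (e' ∘ e.symm) (e x)).det ≠ 0 :=
  right_ne_zero_of_mul (det_fderiv_mul_symm hx hx'
    (differentiableAt_fixedLocus_transition he he' hx hx')
    (differentiableAt_fixedLocus_transition he' he hx' hx) ▸ one_ne_zero)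

omit [T2Space S] in
theorem continuousAt_det_fderiv_fixedLocus
    {e e' : OpenPartialHomeomorph (FixedLocus τ w m) (Fin m → ℝ)}
    (he : e ∈ fixedLocusAtlas τ w m) (he' : e' ∈ fixedLocusAtlas τ w m) {x : FixedLocus τ w m}
    (hx : x ∈ e.source) (hx' : x ∈ e'.source) :
    ContinuousAt (fun a => (fderiv ℝ (e' ∘ e.symm) a).det) (e x) :=
  ContinuousLinearMap.continuous_det.continuousAt.comp
    ((contDiffAt_fixedLocus_transition he he' hx hx').fderiv_right
      (m := 0) (by simp)).continuousAt

variable (hs : IsPointedRealSurface τ o w)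
include hs

theorem IsPointedRealSurface.exists_isOrderedFixedChart [Nonempty S]
    (x : FixedLocus τ w m) : ∃ e, IsOrderedFixedChart τ o w ord m e ∧ x ∈ e.source := by
  classical
  obtain ⟨φ, hφ, hmem⟩ := hs.exists_isOrderedChart_of_finset (ord := ord) x.points.toFinset
    fun p hp => x.notMem_of_mem_points (Multiset.mem_toFinset.1 hp)
  have : Nonempty (FixedLocus τ w m) := ⟨x⟩
  obtain ⟨e, he, hes, heφ⟩ := hφ.1.1.exists_mem_fixedLocusAtlas (w := w) (m := m)
  refine ⟨e, ⟨he, φ, hφ, hes, heφ⟩, ?_⟩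
  rw [hes]
  exact fun p hp => hmem p (Multiset.mem_toFinset.2 hp)

/-- The coordinate change between charts given by ordered charts preserves the orientation. -/
theorem IsOrderedFixedChart.det_pos
    {e e' : OpenPartialHomeomorph (FixedLocus τ w m) (Fin m → ℝ)}
    (he : IsOrderedFixedChart τ o w ord m e) (he' : IsOrderedFixedChart τ o w ord m e')
    {x : FixedLocus τ w m} (hx : x ∈ e.source) (hx' : x ∈ e'.source) :
    0 < (fderiv ℝ (e' ∘ e.symm) (e x)).det := by
  obtain ⟨heA, φ, hφ, hes, heφ⟩ := he
  obtain ⟨heA', φ', hφ', hes', heφ'⟩ := he'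
  -- Relative to one stratum chart both determinants have the same sign, so the determinant of the
  -- coordinate change is positive.
  have hsimple (y : FixedLocus τ w m) (hy : y ∈ e.source) (hy' : y ∈ e'.source)
      (hnodup : y.points.Nodup) : 0 < (fderiv ℝ (e' ∘ e.symm) (e y)).det := by
    obtain ⟨k, hk, hyk⟩ := exists_mem_stratumInterior_of_nodup hs.involution hs.orientation hnodup
    obtain ⟨s, hsc, hys⟩ := hs.exists_isStratumChart (ord := ord) hk hyk hφ (by
      rw [hes] at hy
      exact hy)
    obtain ⟨h1, h2⟩ := hsc.fderiv_det hk hφ hes heφ hys hy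
    obtain ⟨-, h3⟩ := hsc.fderiv_det hk hφ' hes' heφ' hys hy'
    rw [det_fderiv_trans hys hy h1
      (differentiableAt_fixedLocus_transition heA heA' hy hy'), mul_left_comm] at h3
    exact pos_of_mul_pos_left h3 h2.le
  by_contra hneg
  have hlt := lt_of_le_of_ne (not_lt.1 hneg) (det_fderiv_fixedLocus_ne_zero heA heA' hx hx')
  have h1 : ∀ᶠ a in 𝓝 (e x), (fderiv ℝ (e' ∘ e.symm) a).det < 0 :=
    (continuousAt_det_fderiv_fixedLocus heA heA' hx hx').eventually (gt_mem_nhds hlt)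
  -- A negative determinant would stay negative nearby, hence at some tuple of distinct points.
  obtain ⟨a, ha, h2, h3, h4⟩ := ((frequently_nodup_roots (e x)).and_eventually
    (h1.and ((eventually_symm_mem hx hx').and
      (e.open_target.mem_nhds (e.map_source hx))))).exists
  have h5 := e.map_target h4
  have h6 := hsimple (e.symm a) h5 h3 ?_
  · rw [e.right_inv h4] at h6
    exact absurd h2 h6.not_gt
  · have h7 : e.symm a ∈ fixedDomain τ w m φ := hes ▸ h5
    have h8 : (fun i => ((a i : ℝ) : ℂ)) = coeffVec m ((e.symm a).points.map φ) := by
      funext i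
      rw [← hφ.1.1.ofReal_fixedCoord h7, ← heφ, e.right_inv h4]
    rw [h8, roots_monicPoly_coeffVec (by simp [FixedLocus.card_points])] at ha
    exact Multiset.Nodup.of_map _ ha

omit hs [T2Space S] [IsManifold 𝓘(ℂ) ω S] in
theorem units_mul_pos_iff {u : ℤˣ} {r : ℝ} (hr : r ≠ 0) :
    0 < ((u : ℤ) : ℝ) * r ↔ u = if 0 < r then 1 else -1 := by
  rcases Int.units_eq_one_or u with rfl | rfl
  · by_cases h : 0 < r
    · simp [h]
    · simp [h]
  · by_cases h : 0 < r
    · simp [h, h.le]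
    · simp [h, lt_of_le_of_ne (not_lt.1 h) hr]

/-- The orientation of the fixed locus which differs by the sign `u` from the one given by the
ordered charts. -/
theorem IsPointedRealSurface.exists_orientation [Nonempty S]
    (ord : LinearOrder (ConnectedComponents (puncturedCurve τ w))) (m : ℕ) (u : ℤˣ) :
    ∃ O, IsOrientation (fixedLocusAtlas τ w m) O ∧
      ∀ e₀, IsOrderedFixedChart τ o w ord m e₀ → ∀ e ∈ fixedLocusAtlas τ w m,
        ∀ x ∈ e₀.source ∩ e.source,
          0 < (((O e x * u : ℤˣ) : ℤ) : ℝ) * (fderiv ℝ (e ∘ e₀.symm) (e₀ x)).det := by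
  classical
  choose E hE hxE using hs.exists_isOrderedFixedChart (ord := ord) (m := m)
  -- The sign of `e` relative to an ordered chart around `x`, times `u`; by `key` any other ordered
  -- chart gives the same sign.
  let O : OpenPartialHomeomorph (FixedLocus τ w m) (Fin m → ℝ) → FixedLocus τ w m → ℤˣ :=
    fun e x => (if 0 < (fderiv ℝ (e ∘ (E x).symm) (E x x)).det then 1 else -1) * u
  have huu : u * u = 1 := Int.units_mul_self u
  have key (e₀) (he₀ : IsOrderedFixedChart τ o w ord m e₀) (e) (he : e ∈ fixedLocusAtlas τ w m)
      (x) (hx : x ∈ e₀.source ∩ e.source) :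
      0 < (((O e x * u : ℤˣ) : ℤ) : ℝ) * (fderiv ℝ (e ∘ e₀.symm) (e₀ x)).det := by
    have h1 := (hE x).det_pos hs he₀ (hxE x) hx.1
    have h2 : O e x * u = if 0 < (fderiv ℝ (e ∘ (E x).symm) (E x x)).det then 1 else -1 := by
      rw [mul_assoc, huu, mul_one]
    rw [← units_mul_pos_iff (det_fderiv_fixedLocus_ne_zero (hE x).1 he (hxE x) hx.2),
      det_fderiv_trans (hxE x) hx.1
      (differentiableAt_fixedLocus_transition (hE x).1 he₀.1 (hxE x) hx.1)
      (differentiableAt_fixedLocus_transition he₀.1 he hx.1 hx.2), ← mul_assoc] at h2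
    exact pos_of_mul_pos_left h2 h1.le
  refine ⟨O, ⟨fun e he x hx => ?_, fun e he e' he' x hx => ?_⟩, key⟩
  -- The reference chart `E x` is kept for all `y` near `x`, although `O e y` is defined through `E
  -- y`.
  · have h1 := (continuousAt_det_fderiv_fixedLocus (hE x).1 he (hxE x) hx).comp
      ((E x).continuousAt (hxE x))
    have h2 := key _ (hE x) e he x ⟨hxE x, hx⟩
    have h3 := (continuousAt_const (y := (((O e x * u : ℤˣ) : ℤ) : ℝ))).mul h1
    filter_upwards [h3.eventually (lt_mem_nhds h2), (E x).open_source.mem_nhds (hxE x),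
      e.open_source.mem_nhds hx] with y hy hyE hye
    have h4 := key _ (hE x) e he y ⟨hyE, hye⟩
    have h5 := det_fderiv_fixedLocus_ne_zero (hE x).1 he hyE hye
    have h6 := (units_mul_pos_iff h5).1 h4
    have h7 := (units_mul_pos_iff h5).1 hy
    exact mul_right_cancel (h6.trans h7.symm)
  · have h1 := key _ (hE x) e he x ⟨hxE x, hx.1⟩
    have h2 := key _ (hE x) e' he' x ⟨hxE x, hx.2⟩
    rw [det_fderiv_trans (hxE x) hx.1
      (differentiableAt_fixedLocus_transition (hE x).1 he (hxE x) hx.1)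
      (differentiableAt_fixedLocus_transition he he' hx.1 hx.2)] at h2
    have h3 (a b : ℤˣ) : a * b = (a * u) * (b * u) := by
      rw [mul_mul_mul_comm, huu, mul_one]
    rw [h3]
    push_cast at h1 h2 ⊢
    -- In the product of `h1` and `h2` the determinant for `e` relative to the ordered chart occurs
    -- squared.
    refine pos_of_mul_pos_left (b := ((fderiv ℝ (e ∘ (E x).symm) (E x x)).det) ^ 2) ?_ (sq_nonneg _)
    nlinarith [mul_pos h1 h2]

end Orientation

theorem isSmoothAtlas_fixedLocusAtlas {S : Type*} [TopologicalSpace S] [ChartedSpace ℂ S]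
    [IsManifold 𝓘(ℂ) ω S] [T2Space S] [Nonempty S] {τ : S → S}
    {o : OpenPartialHomeomorph (QuotientSurface τ) ℂ → QuotientSurface τ → ℤˣ} {w : Finset S}
    (hs : IsPointedRealSurface τ o w)
    (ord : LinearOrder (ConnectedComponents (puncturedCurve τ w))) (m : ℕ) :
    IsSmoothAtlas (fixedLocusAtlas τ w m) := by
  refine ⟨fun x => ?_, fun e he e' he' a ha => ?_⟩
  · obtain ⟨e, he, hx⟩ := hs.exists_isOrderedFixedChart (ord := ord) x
    exact ⟨e, he.1, hx⟩
  · obtain ⟨ha1, ha2⟩ := ha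
    have ha1 : a ∈ e.target := ha1
    have h := contDiffAt_fixedLocus_transition he he' (e.map_target ha1) ha2
    rw [e.right_inv ha1] at h
    exact (h.of_le (by simp)).contDiffWithinAt

/-- With `n = m - 2k` the numbers `m(m-1)/2` and `n(n-1)/2` differ by `2kn + 2k² - k`, which has the
parity of `k`. The integers `h` and `l` occur twice and cancel. -/
theorem stratum_sign (h l : ℤ) {m k : ℕ} (hk : 2 * k ≤ m) :
    ((-1 : ℤˣ) ^ (h + l - 1 + ((m * (m - 1) / 2 : ℕ) : ℤ))) * (-1) ^ (h + l - k - 1) =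
      (-1) ^ ((m - 2 * k) * (m - 2 * k - 1) / 2) := by
  obtain ⟨n, rfl⟩ := Nat.exists_eq_add_of_le hk
  rw [Nat.add_sub_cancel_left]
  have h1 : (2 * k + n) * (2 * k + n - 1) / 2 = n * (n - 1) / 2 + (2 * k * n + 2 * k * k - k) := by
    have h2 : 2 ∣ n * (n - 1) := (Nat.even_mul_pred_self n).two_dvd
    have h3 : (2 * k + n) * (2 * k + n - 1) = n * (n - 1) + 2 * (2 * k * n + 2 * k * k - k) := by
      rcases n with _ | n
      · rcases k with _ | k
        · rfl
        · zify [show 1 ≤ 2 * (k + 1) + 0 by omega,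
            show k + 1 ≤ 2 * (k + 1) * 0 + 2 * (k + 1) * (k + 1) by nlinarith]
          ring
      · zify [show 1 ≤ 2 * k + (n + 1) by omega, show 1 ≤ n + 1 by omega,
          show k ≤ 2 * k * (n + 1) + 2 * k * k by nlinarith]
        ring
    omega
  rw [h1, ← zpow_add, ← zpow_natCast]
  have h4 : k ≤ 2 * k * n + 2 * k * k := by nlinarith [Nat.zero_le (k * n), Nat.le_mul_self k]
  have h5 : h + l - 1 + ((n * (n - 1) / 2 + (2 * k * n + 2 * k * k - k) : ℕ) : ℤ) +
      (h + l - k - 1) = ((n * (n - 1) / 2 : ℕ) : ℤ) + 2 * (h + l - 1 + k * n + k * k - k) := by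
    push_cast [Nat.cast_sub h4]
    ring
  rw [h5, zpow_add, zpow_mul]
  simp

end RealHF

/-! ### The theorem -/

open RealHF in
theorem mainTheorem11 {S : Type*} [TopologicalSpace S] [T2Space S] [CompactSpace S]
    [ConnectedSpace S] [ChartedSpace ℂ S] [IsManifold 𝓘(ℂ) ω S]
    (τ : S → S) (hτ : RealHF.IsAntiholInvolution τ) (hC : (RealHF.fixedCurve τ).Nonempty)
    (hquot : RealHF.IsOrientable (RealHF.quotientAtlas τ))
    (w : Finset S) (hw : ∀ p ∈ w, p ∈ RealHF.fixedCurve τ)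
    (hwC : ∀ K : ConnectedComponents (RealHF.fixedCurve τ),
      ∃ p : RealHF.fixedCurve τ, (p : S) ∈ w ∧ ConnectedComponents.mk p = K)
    (m : ℕ) :
    RealHF.IsSmoothAtlas (RealHF.fixedLocusAtlas τ w m) ∧
    RealHF.IsOrientable (RealHF.fixedLocusAtlas τ w m) ∧
    ∀ o' : OpenPartialHomeomorph (RealHF.QuotientSurface τ) ℂ → RealHF.QuotientSurface τ → ℤˣ,
      RealHF.IsOrientation (RealHF.quotientAtlas τ) o' →
    ∀ ord : LinearOrder (ConnectedComponents (RealHF.puncturedCurve τ w)),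
      (∀ k : ℕ, 2 * k ≤ m → ∀ x ∈ RealHF.stratumInterior τ w m k,
        ∃ s, RealHF.IsStratumChart τ o' w ord m k s ∧ x ∈ s.source) ∧
      ∃ o, RealHF.IsOrientation (RealHF.fixedLocusAtlas τ w m) o ∧
        ∀ k : ℕ, 2 * k ≤ m → ∀ s, RealHF.IsStratumChart τ o' w ord m k s →
          ∀ e ∈ RealHF.fixedLocusAtlas τ w m, ∀ x ∈ s.source ∩ e.source,
            0 < (((o e x * (-1) ^ ((RealHF.genus (RealHF.QuotientSurface τ) : ℤ) +
                  (Nat.card (ConnectedComponents (RealHF.fixedCurve τ)) : ℤ) - k - 1) : ℤˣ) : ℤ) : ℝ) *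
              (fderiv ℝ (e ∘ s.symm) (s x)).det := by
  have hne : Nonempty S := ConnectedSpace.toNonempty
  have hpointed (o' : OpenPartialHomeomorph (QuotientSurface τ) ℂ → QuotientSurface τ → ℤˣ)
      (ho' : IsOrientation (quotientAtlas τ) o') : IsPointedRealSurface τ o' w := ⟨hτ, ho', hwC⟩
  obtain ⟨o₀, ho₀⟩ := hquot
  classical
  -- Mere orientability and smoothness do not depend on the order of the components, so any one will
  -- do.
  let ord₀ : LinearOrder (ConnectedComponents (puncturedCurve τ w)) :=
    linearOrderOfSTO WellOrderingRel
  refine ⟨isSmoothAtlas_fixedLocusAtlas (hpointed o₀ ho₀) ord₀ m, ?_, fun o' ho' ord => ⟨?_, ?_⟩⟩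
  · obtain ⟨O, hO, -⟩ := (hpointed o₀ ho₀).exists_orientation ord₀ m 1
    exact ⟨O, hO⟩
  · intro k hk x hx
    obtain ⟨e, ⟨-, φ, hφ, hes, -⟩, hxe⟩ := (hpointed o' ho').exists_isOrderedFixedChart (ord := ord) x
    exact (hpointed o' ho').exists_isStratumChart hk hx hφ
      (show x ∈ fixedDomain τ w m φ from hes ▸ hxe)
  -- The global sign is the part of the product of `(-1)^(h+l-k-1)` and `(-1)^(n(n-1)/2)`, with `n =
  -- m - 2k`, that remains after the dependence on `k` has cancelled.
  · obtain ⟨O, hO, hO'⟩ := (hpointed o' ho').exists_orientation ord m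
      ((-1) ^ ((genus (QuotientSurface τ) : ℤ) +
        (Nat.card (ConnectedComponents (fixedCurve τ)) : ℤ) - 1 + ((m * (m - 1) / 2 : ℕ) : ℤ)))
    refine ⟨O, hO, fun k hk s hsc e he x hx => ?_⟩
    obtain ⟨e₀, he₀, hxe₀⟩ := (hpointed o' ho').exists_isOrderedFixedChart (ord := ord) x
    have h1 := hO' e₀ he₀ e he x ⟨hxe₀, hx.2⟩
    obtain ⟨φ, hφ, hes, heφ⟩ := he₀.2
    obtain ⟨h2, h3⟩ := hsc.fderiv_det hk hφ hes heφ hx.1 hxe₀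
    rw [det_fderiv_trans hx.1 hxe₀ h2
      (differentiableAt_fixedLocus_transition he₀.1 he hxe₀ hx.2)]
    have h4 := stratum_sign (genus (QuotientSurface τ) : ℤ)
      (Nat.card (ConnectedComponents (fixedCurve τ)) : ℤ) hk
    have h5 := mul_pos h1 h3
    have h6 : ∀ {a u v t : ℤˣ}, u * v = t → a * u * t = a * v := by
      rintro a u v _ rfl
      rw [mul_assoc, ← mul_assoc u u, Int.units_mul_self, one_mul]
    have h7 := congrArg (fun z : ℤˣ => ((z : ℤ) : ℝ)) (h6 (a := O e x) h4)
    simp only [Units.val_mul, Int.cast_mul] at h7 h5 ⊢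
    rw [← h7]
    push_cast
    push_cast at h5
    linarith
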